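/- **Conventions.** A compact quantum group $(A,\Delta)$ is a von Neumann algebra $A$ with a faithful normal unital $*$-homomorphism $\Delta:A\to A\mathbin{\overline\otimes}A$ satisfying $(\Delta\otimes\mathrm{id})\Delta=(\mathrm{id}\otimes\Delta)\Delta$ for which there is a faithful normal state $\varphi$ (the Haar state, necessarily unique) with $(\mathrm{id}\otimes\varphi)\Delta(a)=\varphi(a)1=(\varphi\otimes\mathrm{id})\Delta(a)$ for all $a\in A$; it is of Kac type if $\varphi$ is a trace. An isomorphism $(A,\Delta_A)\cong(B,\Delta_B)$ is a $*$-isomorphism $\pi:A\to B$ with $\Delta_B\circ\pi=(\pi\otimes\pi)\circ\Delta_A$. For a discrete group $G$, $L(G)\subset B(\ell^2(G))$ is the von Neumann algebra generated by the left translations $u_g$, with comultiplication $\Delta_G(u_g)=u_g\otimes u_g$. The group $G$ is quantum W$^*$-superrigid if every compact quantum group $(B,\Delta)$ with $B\cong L(G)$ as von Neumann algebras satisfies $(B,\Delta)\cong(L(G),\Delta_G)$. A nontrivial group is icc if all conjugacy classes of its nontrivial elements are infinite. For a group $\Gamma$ acting on a set $I$ and $n\ge 2$, $(\mathbb Z/n\mathbb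 Z)^{(I)}\rtimes\Gamma$ denotes the semidirect product of the direct sum of copies of $\mathbb Z/n\mathbb Z$ indexed by $I$ with $\Gamma$ permuting the coordinates. **Corollary.** (a) Let $G$ be an icc group that admits a finite abelian subgroup $G_0<G$ with $H^2(\widehat{G_0},\mathbb T)\neq 1$, where $\widehat{G_0}=\mathrm{Hom}(G_0,\mathbb T)$ acts trivially on $\mathbb T$. Then there is a Kac type compact quantum group $(B,\Delta)$ such that $B\cong L(G)$ as von Neumann algebras but $(B,\Delta)\not\cong(L(G),\Delta_G)$. In particular, $G$ is not quantum W$^*$-superrigid. (b) In particular, the following (generalized) wreath product groups are not quantum W$^*$-superrigid, for every $n\ge2$: 1. every icc group of the form $(\mathbb Z/n\mathbb Z)^{(I)}\rtimes\Gamma$, where $\Gamma$ is a group acting on a set $I$ with at least two elements; 2. every left-right wreath product $(\mathbb Z/n\mathbb Z)^{(\Gamma)}\rtimes(\Gamma\times\Gamma)$, with $(g,h)\cdot k=gkh^{-1}$, where $\Gamma$ is icc, or where $\Gamma$ is nonamenable and every nontrivial element of $\Gamma$ has an amenable centralizer (in particular, whenever $\Gamma$ is a countable group that is nonamenable, weakly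 amenable, biexact and such that every nontrivial element has an amenable centralizer); 3. every group $(\mathbb Z/n\mathbb Z)^{(\Gamma/S)}\rtimes\Gamma$, where $\Gamma=\Gamma_0^{(S)}\rtimes S$ is the restricted wreath product of a nontrivial group $\Gamma_0$ and an infinite group $S$ and $\Gamma$ acts on $\Gamma/S$ by left translation (in particular for $\Gamma_0$ nonamenable and $S$ infinite amenable). -/

import Mathlib

open scoped TensorProduct ComplexOrder

noncomputable section

namespace QGroup

section Hilbert

variable {H K : Type*}
  [NormedAddCommGroup H] [InnerProductSpace ℂ H]
  [NormedAddCommGroup K] [InnerProductSpace ℂ K]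

/-- The Hilbert space tensor product: the completion of the algebraic tensor product. -/
abbrev HTensor (H K : Type*) [NormedAddCommGroup H] [InnerProductSpace ℂ H]
    [NormedAddCommGroup K] [InnerProductSpace ℂ K] : Type _ :=
  UniformSpace.Completion (H ⊗[ℂ] K)

/-- The elementary tensor of two vectors. -/
def vecTensor (x : H) (y : K) : HTensor H K := ((x ⊗ₜ[ℂ] y : H ⊗[ℂ] K) : HTensor H K)

/-- The bounded operator `S ⊗ T` on the Hilbert space tensor product. -/
def opTensor (S : H →L[ℂ] H) (T : K →L[ℂ] K) : HTensor H K →L[ℂ] HTensor H K :=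
  (TensorProduct.mapL S T).completion

theorem opTensor_vecTensor (S : H →L[ℂ] H) (T : K →L[ℂ] K) (x : H) (y : K) :
    opTensor S T (vecTensor x y) = vecTensor (S x) (T y) := by
  simp [opTensor, vecTensor]

theorem inner_vecTensor (x x' : H) (y y' : K) :
    inner ℂ (vecTensor x y) (vecTensor x' y') = inner ℂ x x' * inner ℂ y y' := by
  simp [vecTensor]

/-- `y ↦ x ⊗ y` as a bounded operator. -/
def vecTensorLeft (x : H) : K →L[ℂ] HTensor H K :=
  (UniformSpace.Completion.toComplL (𝕜 := ℂ)).comp (TensorProduct.mkL ℂ H K x)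

theorem vecTensorLeft_apply (x : H) (y : K) : vecTensorLeft x y = vecTensor x y := by
  simp [vecTensorLeft, vecTensor]

/-- `x ↦ x ⊗ y` as a bounded operator. -/
def vecTensorRight (y : K) : H →L[ℂ] HTensor H K :=
  (UniformSpace.Completion.toComplL (𝕜 := ℂ)).comp ((TensorProduct.mkL ℂ H K).flip y)

theorem vecTensorRight_apply (x : H) (y : K) : vecTensorRight y x = vecTensor x y := by
  simp [vecTensorRight, vecTensor]

theorem dense_span_vecTensor :
    Dense (Submodule.span ℂ (Set.range fun p : H × K => vecTensor p.1 p.2) : Set (HTensor H K)) := by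
  refine UniformSpace.Completion.denseRange_coe.mono ?_
  rintro _ ⟨t, rfl⟩
  induction t using TensorProduct.induction_on with
  | zero => rw [UniformSpace.Completion.coe_zero]; exact Submodule.zero_mem _
  | tmul x y => exact Submodule.subset_span ⟨(x, y), rfl⟩
  | add s t hs ht => rw [UniformSpace.Completion.coe_add]; exact Submodule.add_mem _ hs ht

/-- Two bounded operators agreeing on elementary tensors are equal. -/
theorem ext_vecTensor {E : Type*} [NormedAddCommGroup E] [InnerProductSpace ℂ E]
    {S T : HTensor H K →L[ℂ] E}
    (h : ∀ x y, S (vecTensor x y) = T (vecTensor x y)) : S = T := by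
  refine ContinuousLinearMap.ext_on dense_span_vecTensor ?_
  rintro _ ⟨p, rfl⟩
  exact h p.1 p.2

/-- A vector orthogonal to all elementary tensors is zero. -/
theorem eq_of_inner_vecTensor {z z' : HTensor H K}
    (h : ∀ x y, inner ℂ (vecTensor x y) z = inner ℂ (vecTensor x y) z') : z = z' := by
  have : (innerSL ℂ z) = (innerSL ℂ z') := by
    refine ext_vecTensor fun x y => ?_
    have := congrArg (starRingEnd ℂ) (h x y)
    simpa [inner_conj_symm] using this
  exact ext_inner_right ℂ fun v => by simpa using DFunLike.congr_fun this v

theorem star_opTensor [CompleteSpace H] [CompleteSpace K] (S : H →L[ℂ] H) (T : K →L[ℂ] K) :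
    star (opTensor S T) = opTensor (star S) (star T) := by
  refine ext_vecTensor fun x y => eq_of_inner_vecTensor fun x' y' => ?_
  rw [ContinuousLinearMap.star_eq_adjoint, ContinuousLinearMap.adjoint_inner_right,
    opTensor_vecTensor, opTensor_vecTensor, inner_vecTensor, inner_vecTensor,
    ContinuousLinearMap.star_eq_adjoint, ContinuousLinearMap.star_eq_adjoint,
    ContinuousLinearMap.adjoint_inner_right, ContinuousLinearMap.adjoint_inner_right]

variable {ι κ : Type*}

/-- The unitary permuting the vectors of a Hilbert basis, `b i ↦ b (σ i)`. -/
def permUnitary (b : HilbertBasis ι ℂ H) (σ : Equiv.Perm ι) [CompleteSpace H] : H ≃ₗᵢ[ℂ] H :=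
  ((HilbertBasis.mk (b.orthonormal.comp σ σ.injective) (by
    rw [Set.range_comp, σ.surjective.range_eq, Set.image_univ]
    exact b.dense_span.ge)).repr.trans b.repr.symm).symm

theorem permUnitary_apply [CompleteSpace H] (b : HilbertBasis ι ℂ H) (σ : Equiv.Perm ι) (i : ι) :
    permUnitary b σ (b i) = b (σ i) := by
  classical
  simp [permUnitary, b.repr_self]

/-- The tensor product of two Hilbert bases. -/
def basisTensor (b : HilbertBasis ι ℂ H) (c : HilbertBasis κ ℂ K) :
    HilbertBasis (ι × κ) ℂ (HTensor H K) :=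
  HilbertBasis.mk (v := fun p => vecTensor (b p.1) (c p.2)) (by
    classical
    rw [orthonormal_iff_ite]
    rintro ⟨i, j⟩ ⟨i', j'⟩
    rw [inner_vecTensor, orthonormal_iff_ite.mp b.orthonormal, orthonormal_iff_ite.mp c.orthonormal]
    simp [← ite_and, and_comm]) (by
    set M := (Submodule.span ℂ (Set.range fun p : ι × κ =>
      vecTensor (b p.1) (c p.2))).topologicalClosure with hM
    have hMc : IsClosed (M : Set (HTensor H K)) := Submodule.isClosed_topologicalClosure _
    have h1 : ∀ (i : ι) (y : K), vecTensor (b i) y ∈ M := fun i y => by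
      have : (Submodule.span ℂ (Set.range c)).topologicalClosure ≤
          M.comap (vecTensorLeft (b i) : K →L[ℂ] HTensor H K).toLinearMap := by
        refine Submodule.topologicalClosure_minimal _ (Submodule.span_le.2 ?_)
          (hMc.preimage (vecTensorLeft (b i)).continuous)
        rintro _ ⟨j, rfl⟩
        refine Submodule.le_topologicalClosure _ (Submodule.subset_span ⟨(i, j), ?_⟩)
        exact (vecTensorLeft_apply _ _).symm
      have := this (c.dense_span ▸ Submodule.mem_top : y ∈ _)
      simpa [vecTensorLeft_apply] using this
    have h2 : ∀ (x : H) (y : K), vecTensor x y ∈ M := fun x y => by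
      have : (Submodule.span ℂ (Set.range b)).topologicalClosure ≤
          M.comap (vecTensorRight y : H →L[ℂ] HTensor H K).toLinearMap := by
        refine Submodule.topologicalClosure_minimal _ (Submodule.span_le.2 ?_)
          (hMc.preimage (vecTensorRight y).continuous)
        rintro _ ⟨i, rfl⟩
        have := h1 i y
        simpa [vecTensorRight_apply] using this
      have := this (b.dense_span ▸ Submodule.mem_top : x ∈ _)
      simpa [vecTensorRight_apply] using this
    intro z _
    have h3 : (Submodule.span ℂ (Set.range fun p : H × K => vecTensor p.1 p.2)) ≤ M :=
      Submodule.span_le.2 (by rintro _ ⟨p, rfl⟩; exact h2 _ _)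
    exact hMc.closure_subset_iff.2 h3 (dense_span_vecTensor z))

theorem basisTensor_apply (b : HilbertBasis ι ℂ H) (c : HilbertBasis κ ℂ K) (i : ι) (j : κ) :
    basisTensor b c (i, j) = vecTensor (b i) (c j) := by
  simp [basisTensor]

theorem opTensor_one_mul (S T : K →L[ℂ] K) :
    opTensor (1 : H →L[ℂ] H) (S * T) = opTensor 1 S * opTensor 1 T :=
  ext_vecTensor fun x y => by simp [opTensor_vecTensor]

theorem opTensor_one_add (S T : K →L[ℂ] K) :
    opTensor (1 : H →L[ℂ] H) (S + T) = opTensor 1 S + opTensor 1 T :=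
  ext_vecTensor fun x y => by
    rw [add_apply, opTensor_vecTensor, opTensor_vecTensor, opTensor_vecTensor,
      add_apply, ← vecTensorLeft_apply, ← vecTensorLeft_apply,
      ← vecTensorLeft_apply, map_add]

theorem opTensor_one_algebraMap (c : ℂ) :
    opTensor (1 : H →L[ℂ] H) (algebraMap ℂ (K →L[ℂ] K) c) = algebraMap ℂ _ c :=
  ext_vecTensor fun x y => by
    rw [opTensor_vecTensor, Algebra.algebraMap_eq_smul_one, Algebra.algebraMap_eq_smul_one,
      smul_apply, smul_apply, ← vecTensorLeft_apply,
      ← vecTensorLeft_apply, map_smul]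
    rfl

/-- Conjugation by a unitary, as a `*`-automorphism of the bounded operators. -/
def conjU [CompleteSpace H] (U : H ≃ₗᵢ[ℂ] H) : (H →L[ℂ] H) →⋆ₐ[ℂ] (H →L[ℂ] H) :=
  { (U.conjStarAlgEquiv.toAlgEquiv : (H →L[ℂ] H) →ₐ[ℂ] (H →L[ℂ] H)) with
    map_star' := fun T => map_star U.conjStarAlgEquiv T }

theorem conjU_apply [CompleteSpace H] (U : H ≃ₗᵢ[ℂ] H) (T : H →L[ℂ] H) (x : H) :
    conjU U T x = U (T (U.symm x)) := rfl

/-- Amplification `x ↦ 1 ⊗ x`, as a unital `*`-homomorphism. -/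
def amplify (H : Type*) [NormedAddCommGroup H] [InnerProductSpace ℂ H] [CompleteSpace H]
    [CompleteSpace K] : (K →L[ℂ] K) →⋆ₐ[ℂ] (HTensor H K →L[ℂ] HTensor H K) where
  toFun T := opTensor 1 T
  map_one' := by simpa using opTensor_one_algebraMap (H := H) (K := K) 1
  map_mul' := opTensor_one_mul
  map_zero' := by simpa using opTensor_one_algebraMap (H := H) (K := K) 0
  map_add' := opTensor_one_add
  commutes' := opTensor_one_algebraMap
  map_star' T := by rw [star_opTensor, star_one]

/-- If `T` commutes with `1 ⊗ y` for all `y` in a self-adjoint set `s`, then `T` commutes with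
`1 ⊗ x` for all `x` in the bicommutant of `s`. -/
theorem commute_opTensor_one [CompleteSpace H] [CompleteSpace K]
    {s : Set (K →L[ℂ] K)} (T : HTensor H K →L[ℂ] HTensor H K)
    (hT : ∀ y ∈ s, opTensor 1 y * T = T * opTensor 1 y) (x : K →L[ℂ] K)
    (hx : x ∈ Set.centralizer (Set.centralizer s)) :
    opTensor 1 x * T = T * opTensor 1 x := by
  have slice : ∀ (ξ η : H) (y : K →L[ℂ] K),
      y * ((vecTensorLeft (K := K) ξ).adjoint ∘L T ∘L vecTensorLeft η) =
      (vecTensorLeft (K := K) ξ).adjoint ∘L (opTensor 1 y * T) ∘L vecTensorLeft η := by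
    intro ξ η y
    ext k
    refine ext_inner_left ℂ fun k' => ?_
    simp only [mul_apply_eq_comp, ContinuousLinearMap.comp_apply]
    rw [← ContinuousLinearMap.adjoint_inner_left, ContinuousLinearMap.adjoint_inner_right,
      ContinuousLinearMap.adjoint_inner_right, vecTensorLeft_apply, vecTensorLeft_apply,
      vecTensorLeft_apply,
      ← ContinuousLinearMap.adjoint_inner_left (opTensor 1 y), ← ContinuousLinearMap.star_eq_adjoint,
      ← ContinuousLinearMap.star_eq_adjoint, star_opTensor, opTensor_vecTensor]
    simp
  have slice' : ∀ (ξ η : H) (y : K →L[ℂ] K),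
      ((vecTensorLeft (K := K) ξ).adjoint ∘L T ∘L vecTensorLeft η) * y =
      (vecTensorLeft (K := K) ξ).adjoint ∘L (T * opTensor 1 y) ∘L vecTensorLeft η := by
    intro ξ η y
    ext k
    simp [vecTensorLeft_apply, opTensor_vecTensor]
  have key : ∀ ξ η : H, (vecTensorLeft (K := K) ξ).adjoint ∘L (opTensor 1 x * T) ∘L
      vecTensorLeft η = (vecTensorLeft (K := K) ξ).adjoint ∘L (T * opTensor 1 x) ∘L
      vecTensorLeft η := by
    intro ξ η
    rw [← slice, ← slice']
    refine (hx _ ?_).symm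
    intro y hy
    rw [slice, slice', hT y hy]
  refine ext_vecTensor fun η k => eq_of_inner_vecTensor fun ξ k' => ?_
  have := congrArg (inner ℂ k') (DFunLike.congr_fun (key ξ η) k)
  simp only [ContinuousLinearMap.comp_apply] at this
  rwa [ContinuousLinearMap.adjoint_inner_right, ContinuousLinearMap.adjoint_inner_right,
    vecTensorLeft_apply, vecTensorLeft_apply] at this

end Hilbert

section VonNeumann

universe u v u' v' w
variable {H : Type u} {K : Type v} {H' : Type u'} {K' : Type v'} {L : Type w}
  [NormedAddCommGroup H] [InnerProductSpace ℂ H] [CompleteSpace H]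
  [NormedAddCommGroup K] [InnerProductSpace ℂ K] [CompleteSpace K]
  [NormedAddCommGroup H'] [InnerProductSpace ℂ H'] [CompleteSpace H']
  [NormedAddCommGroup K'] [InnerProductSpace ℂ K'] [CompleteSpace K']
  [NormedAddCommGroup L] [InnerProductSpace ℂ L] [CompleteSpace L]

/-- The von Neumann algebra generated by a set of operators: the bicommutant of `s ∪ s*`. -/
def generated (s : Set (H →L[ℂ] H)) : VonNeumannAlgebra H where
  toStarSubalgebra :=
    StarSubalgebra.centralizer ℂ (StarSubalgebra.centralizer ℂ s : Set (H →L[ℂ] H))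
  centralizer_centralizer' := by
    change Set.centralizer (Set.centralizer
      ((StarSubalgebra.centralizer ℂ (StarSubalgebra.centralizer ℂ s : Set (H →L[ℂ] H)) :
        Set (H →L[ℂ] H)))) =
      (StarSubalgebra.centralizer ℂ (StarSubalgebra.centralizer ℂ s : Set (H →L[ℂ] H)) :
        Set (H →L[ℂ] H))
    rw [StarSubalgebra.coe_centralizer_centralizer, Set.centralizer_centralizer_centralizer]

/-- The elements of a von Neumann algebra, as a unital `*`-algebra. -/
abbrev Elem (A : VonNeumannAlgebra H) : Type u := A.toStarSubalgebra

theorem mem_generated_iff {s : Set (H →L[ℂ] H)} {x : H →L[ℂ] H} :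
    x ∈ (generated s).toStarSubalgebra ↔ x ∈ Set.centralizer (Set.centralizer (s ∪ star s)) := by
  rw [← StarSubalgebra.coe_centralizer_centralizer ℂ s]; rfl

theorem subset_generated {s : Set (H →L[ℂ] H)} {x : H →L[ℂ] H} (hx : x ∈ s) :
    x ∈ (generated s).toStarSubalgebra :=
  mem_generated_iff.2 (Set.subset_centralizer_centralizer (Or.inl hx))

/-- The von Neumann algebra tensor product of `A` and `B`, generated by the operators `a ⊗ b`. -/
def vnTensor (A : VonNeumannAlgebra H) (B : VonNeumannAlgebra K) :
    VonNeumannAlgebra (HTensor H K) :=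
  generated (Set.range fun p : Elem A × Elem B =>
    opTensor (p.1 : H →L[ℂ] H) (p.2 : K →L[ℂ] K))

/-- The elementary tensor `a ⊗ b` in the von Neumann algebra tensor product. -/
def tmul {A : VonNeumannAlgebra H} {B : VonNeumannAlgebra K} (a : Elem A) (b : Elem B) :
    Elem (vnTensor A B) :=
  ⟨opTensor (a : H →L[ℂ] H) (b : K →L[ℂ] K), subset_generated ⟨(a, b), rfl⟩⟩

/-- Normal (ultraweakly continuous) functionals: those of the form
`x ↦ ∑ₙ ⟪ηₙ, x ξₙ⟫` with `∑ₙ ‖ξₙ‖² < ∞` and `∑ₙ ‖ηₙ‖² < ∞`. -/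
def IsNormalFunctional (A : VonNeumannAlgebra H) (ω : Elem A → ℂ) : Prop :=
  ∃ ξ η : ℕ → H, Summable (fun n => ‖ξ n‖ ^ 2) ∧ Summable (fun n => ‖η n‖ ^ 2) ∧
    ∀ x : Elem A, HasSum (fun n => inner ℂ (η n) ((x : H →L[ℂ] H) (ξ n))) (ω x)

/-- Normal (ultraweakly continuous) maps between von Neumann algebras: normal functionals pull back
to normal functionals. -/
def IsNormalMap {A : VonNeumannAlgebra H} {B : VonNeumannAlgebra K} (T : Elem A → Elem B) : Prop :=
  ∀ ω : Elem B → ℂ, IsNormalFunctional B ω → IsNormalFunctional A fun x => ω (T x)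

/-- `F` is the tensor product `f ⊗ g`: the (unique) normal unital `*`-homomorphism with
`F (a ⊗ b) = f a ⊗ g b`. -/
structure IsTensorMap {A : VonNeumannAlgebra H} {B : VonNeumannAlgebra K}
    {A' : VonNeumannAlgebra H'} {B' : VonNeumannAlgebra K'}
    (f : Elem A → Elem A') (g : Elem B → Elem B')
    (F : Elem (vnTensor A B) →⋆ₐ[ℂ] Elem (vnTensor A' B')) : Prop where
  normal : IsNormalMap F
  map_tmul : ∀ a b, F (tmul a b) = tmul (f a) (g b)

/-- `F` is the canonical identification of the two threefold tensor products: the (unique) normal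
unital `*`-homomorphism with `F ((a ⊗ b) ⊗ c) = a ⊗ (b ⊗ c)`. -/
structure IsAssociator {A : VonNeumannAlgebra H} {B : VonNeumannAlgebra K}
    {C : VonNeumannAlgebra L}
    (F : Elem (vnTensor (vnTensor A B) C) →⋆ₐ[ℂ] Elem (vnTensor A (vnTensor B C))) : Prop where
  normal : IsNormalMap F
  map_tmul : ∀ a b c, F (tmul (tmul a b) c) = tmul a (tmul b c)

/-- `E` is the slice map `id ⊗ φ`: the (unique) normal linear map with
`E (a ⊗ b) = φ b • a`. -/
structure IsRightSlice {A : VonNeumannAlgebra H} {B : VonNeumannAlgebra K}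
    (φ : Elem B →ₗ[ℂ] ℂ) (E : Elem (vnTensor A B) →ₗ[ℂ] Elem A) : Prop where
  normal : IsNormalMap E
  map_tmul : ∀ a b, E (tmul a b) = φ b • a

/-- `E` is the slice map `φ ⊗ id`: the (unique) normal linear map with
`E (a ⊗ b) = φ a • b`. -/
structure IsLeftSlice {A : VonNeumannAlgebra H} {B : VonNeumannAlgebra K}
    (φ : Elem A →ₗ[ℂ] ℂ) (E : Elem (vnTensor A B) →ₗ[ℂ] Elem B) : Prop where
  normal : IsNormalMap E
  map_tmul : ∀ a b, E (tmul a b) = φ a • b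

variable {A : VonNeumannAlgebra H} {B : VonNeumannAlgebra K}

/-- Co-associativity: `(Δ ⊗ id) Δ = (id ⊗ Δ) Δ`. -/
def IsCoassociative (Δ : Elem A →⋆ₐ[ℂ] Elem (vnTensor A A)) : Prop :=
  ∃ (D₁ : Elem (vnTensor A A) →⋆ₐ[ℂ] Elem (vnTensor (vnTensor A A) A))
    (D₂ : Elem (vnTensor A A) →⋆ₐ[ℂ] Elem (vnTensor A (vnTensor A A)))
    (α : Elem (vnTensor (vnTensor A A) A) →⋆ₐ[ℂ] Elem (vnTensor A (vnTensor A A))),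
    IsTensorMap Δ id D₁ ∧ IsTensorMap id Δ D₂ ∧ IsAssociator α ∧
      ∀ x : Elem A, α (D₁ (Δ x)) = D₂ (Δ x)

/-- A faithful normal state that is left and right invariant:
`(id ⊗ φ) Δ(a) = φ(a) 1 = (φ ⊗ id) Δ(a)`. -/
structure IsHaarState (Δ : Elem A →⋆ₐ[ℂ] Elem (vnTensor A A)) (φ : Elem A →ₗ[ℂ] ℂ) : Prop where
  map_one : φ 1 = 1
  nonneg : ∀ a, 0 ≤ φ (star a * a)
  faithful : ∀ a, φ (star a * a) = 0 → a = 0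
  normal : IsNormalFunctional A φ
  right_invariant : ∃ E : Elem (vnTensor A A) →ₗ[ℂ] Elem A, IsRightSlice φ E ∧
    ∀ a, E (Δ a) = φ a • 1
  left_invariant : ∃ E : Elem (vnTensor A A) →ₗ[ℂ] Elem A, IsLeftSlice φ E ∧
    ∀ a, E (Δ a) = φ a • 1

/-- `(A, Δ)` is a compact quantum group. -/
structure IsCompactQuantumGroup (Δ : Elem A →⋆ₐ[ℂ] Elem (vnTensor A A)) : Prop where
  injective : Function.Injective Δ
  normal : IsNormalMap Δ
  coassociative : IsCoassociative Δ
  exists_haar : ∃ φ : Elem A →ₗ[ℂ] ℂ, IsHaarState Δ φ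

/-- `(A, Δ)` is a compact quantum group of Kac type: its Haar state is a trace. -/
def IsKacType (Δ : Elem A →⋆ₐ[ℂ] Elem (vnTensor A A)) : Prop :=
  IsCompactQuantumGroup Δ ∧
    ∃ φ : Elem A →ₗ[ℂ] ℂ, IsHaarState Δ φ ∧ ∀ a b, φ (a * b) = φ (b * a)

/-- Isomorphism of compact quantum groups: a `*`-isomorphism `π : A → B` with
`Δ_B ∘ π = (π ⊗ π) ∘ Δ_A`. -/
def QGIsomorphic (ΔA : Elem A →⋆ₐ[ℂ] Elem (vnTensor A A))
    (ΔB : Elem B →⋆ₐ[ℂ] Elem (vnTensor B B)) : Prop :=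
  ∃ (π : Elem A ≃⋆ₐ[ℂ] Elem B) (P : Elem (vnTensor A A) →⋆ₐ[ℂ] Elem (vnTensor B B)),
    IsTensorMap π π P ∧ ∀ a, ΔB (π a) = P (ΔA a)

/-- Quantum W*-superrigidity of `(A, Δ)`: every compact quantum group whose underlying
von Neumann algebra is isomorphic to `A` is isomorphic to `(A, Δ)` as a compact quantum group. -/
def IsQuantumWStarSuperrigid (ΔA : Elem A →⋆ₐ[ℂ] Elem (vnTensor A A)) : Prop :=
  ∀ (K : Type u) [NormedAddCommGroup K] [InnerProductSpace ℂ K] [CompleteSpace K]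
    (B : VonNeumannAlgebra K) (ΔB : Elem B →⋆ₐ[ℂ] Elem (vnTensor B B)),
    IsCompactQuantumGroup ΔB → Nonempty (Elem B ≃⋆ₐ[ℂ] Elem A) → QGIsomorphic ΔA ΔB

end VonNeumann

section GroupVN

universe u
variable (G : Type u)

/-- The Hilbert space `ℓ²(G)`. -/
abbrev ell2 : Type u := lp (fun _ : G => ℂ) 2

/-- The canonical Hilbert basis `(δ_g)` of `ℓ²(G)`. -/
def delta : HilbertBasis G ℂ (ell2 G) := HilbertBasis.ofRepr (LinearIsometryEquiv.refl ℂ _)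

variable [Group G]

/-- The left regular representation, `δ_h ↦ δ_{gh}`. -/
def leftReg (g : G) : ell2 G →L[ℂ] ell2 G :=
  ((permUnitary (delta G) (Equiv.mulLeft g) : ell2 G ≃ₗᵢ[ℂ] ell2 G) : ell2 G →L[ℂ] ell2 G)

theorem leftReg_delta (g h : G) : leftReg G g (delta G h) = delta G (g * h) :=
  permUnitary_apply _ _ _

/-- The group von Neumann algebra `L(G)`, generated by the left translations on `ℓ²(G)`. -/
def groupVN : VonNeumannAlgebra (ell2 G) := generated (Set.range (leftReg G))

/-- The canonical unitary `u_g` in `L(G)`. -/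
def groupU (g : G) : Elem (groupVN G) := ⟨leftReg G g, subset_generated ⟨g, rfl⟩⟩

/-- The permutation `(h, g) ↦ (gh, g)` of `G × G`. -/
def shear : Equiv.Perm (G × G) where
  toFun p := (p.2 * p.1, p.2)
  invFun p := (p.2⁻¹ * p.1, p.2)
  left_inv p := by simp
  right_inv p := by simp

/-- The unitary on `ℓ²(G) ⊗ ℓ²(G)` given by `δ_h ⊗ δ_g ↦ δ_{gh} ⊗ δ_g`. -/
def shearU : HTensor (ell2 G) (ell2 G) ≃ₗᵢ[ℂ] HTensor (ell2 G) (ell2 G) :=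
  permUnitary (basisTensor (delta G) (delta G)) (shear G)

theorem shearU_delta (h g : G) : shearU G (vecTensor (delta G h) (delta G g)) =
    vecTensor (delta G (g * h)) (delta G g) := by
  have := permUnitary_apply (basisTensor (delta G) (delta G)) (shear G) (h, g)
  rw [basisTensor_apply, shear, Equiv.coe_fn_mk, basisTensor_apply] at this
  exact this

/-- Operators on a Hilbert space agreeing on a Hilbert basis are equal. -/
theorem ext_hilbertBasis {ι E F : Type*} [NormedAddCommGroup E] [InnerProductSpace ℂ E]
    [NormedAddCommGroup F] [InnerProductSpace ℂ F] (b : HilbertBasis ι ℂ E)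
    {S T : E →L[ℂ] F} (h : ∀ i, S (b i) = T (b i)) : S = T := by
  refine ContinuousLinearMap.ext_on (s := Set.range b) ?_ ?_
  · exact Submodule.dense_iff_topologicalClosure_eq_top.2 b.dense_span
  · rintro _ ⟨i, rfl⟩
    exact h i

theorem shearU_conj_leftReg (g : G) :
    conjU (shearU G) (opTensor 1 (leftReg G g)) =
      opTensor (leftReg G g) (leftReg G g) := by
  refine ext_hilbertBasis (basisTensor (delta G) (delta G)) fun p => ?_
  obtain ⟨h, k⟩ := p
  have : (shearU G).symm (vecTensor (delta G h) (delta G k)) =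
      vecTensor (delta G (k⁻¹ * h)) (delta G k) := by
    rw [LinearIsometryEquiv.symm_apply_eq, shearU_delta, mul_inv_cancel_left]
  rw [basisTensor_apply, conjU_apply, this,
    opTensor_vecTensor, opTensor_vecTensor, leftReg_delta, leftReg_delta,
    one_apply_eq_self, shearU_delta]
  simp [mul_assoc]

theorem star_leftReg (g : G) : star (leftReg G g) = leftReg G g⁻¹ := by
  have h1 : leftReg G g * leftReg G g⁻¹ = 1 :=
    ext_hilbertBasis (delta G) fun h => by simp [leftReg_delta]
  have h2 : star (leftReg G g) * leftReg G g = 1 := by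
    rw [ContinuousLinearMap.star_eq_adjoint]
    refine ContinuousLinearMap.ext fun x => ext_inner_left ℂ fun y => ?_
    rw [mul_apply_eq_comp, ContinuousLinearMap.adjoint_inner_right]
    exact (permUnitary (delta G) (Equiv.mulLeft g)).inner_map_map y x
  exact left_inv_eq_right_inv h2 h1

theorem shearU_conj_mem (x : Elem (groupVN G)) :
    conjU (shearU G) (opTensor 1 (x : ell2 G →L[ℂ] ell2 G)) ∈
      (vnTensor (groupVN G) (groupVN G)).toStarSubalgebra := by
  refine mem_generated_iff.2 fun T hT => ?_
  have hs : Set.range (leftReg G) ∪ star (Set.range (leftReg G)) = Set.range (leftReg G) := by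
    refine Set.union_eq_left.2 ?_
    rintro y ⟨g, hg⟩
    exact ⟨g⁻¹, by rw [← star_leftReg, hg, star_star]⟩
  have hx := mem_generated_iff.1 x.2
  rw [hs] at hx
  have inv₁ : ∀ S, conjU (shearU G).symm (conjU (shearU G) S) = S := fun S => by
    ext z; simp [conjU_apply]
  have inv₂ : ∀ S, conjU (shearU G) (conjU (shearU G).symm S) = S := fun S => by
    ext z; simp [conjU_apply]
  have := commute_opTensor_one (conjU (shearU G).symm T) (s := Set.range (leftReg G)) (by
    rintro _ ⟨g, rfl⟩
    rw [← inv₁ (opTensor 1 (leftReg G g)), ← map_mul, ← map_mul, shearU_conj_leftReg]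
    exact congrArg _ (hT _ (Or.inl ⟨(groupU G g, groupU G g), rfl⟩))) x hx
  have := congrArg (conjU (shearU G)) this
  rw [map_mul, map_mul, inv₂] at this
  exact this.symm

/-- The comultiplication `Δ_G : L(G) → L(G) ⊗ L(G)`, implemented by a unitary; it is the normal
unital `*`-homomorphism satisfying `Δ_G(u_g) = u_g ⊗ u_g`. -/
def groupComul : Elem (groupVN G) →⋆ₐ[ℂ] Elem (vnTensor (groupVN G) (groupVN G)) where
  toFun x := ⟨conjU (shearU G) (amplify (ell2 G) (x : ell2 G →L[ℂ] ell2 G)),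
    shearU_conj_mem G x⟩
  map_one' := Subtype.ext (by simp)
  map_mul' x y := Subtype.ext (by simp)
  map_zero' := Subtype.ext (by simp)
  map_add' x y := Subtype.ext (by simp)
  commutes' c := Subtype.ext (AlgHomClass.commutes
    ((conjU (shearU G)).comp (amplify (ell2 G))) c)
  map_star' x := Subtype.ext (map_star
    ((conjU (shearU G)).comp (amplify (ell2 G))) (x : ell2 G →L[ℂ] ell2 G))

theorem groupComul_groupU (g : G) :
    groupComul G (groupU G g) = tmul (groupU G g) (groupU G g) :=
  Subtype.ext (shearU_conj_leftReg G g)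

/-- The discrete group `G` is quantum W*-superrigid if `(L(G), Δ_G)` is. -/
def IsQuantumWStarSuperrigidGroup : Prop := IsQuantumWStarSuperrigid (groupComul G)

/-- Icc groups: nontrivial groups all of whose nontrivial conjugacy classes are infinite. -/
def IsICC : Prop := Nontrivial G ∧ ∀ g : G, g ≠ 1 → {h : G | IsConj g h}.Infinite

/-- `H²(K, 𝕋)` for the dual group `K` of the discrete group `G`, with trivial action on the
circle. The universe lifts only serve to put all objects in the same universe. -/
abbrev H2Dual : ModuleCat (ULift.{u} ℤ) :=
  groupCohomology.H2
    (Rep.trivial (ULift.{u} ℤ) (G →* Circle) (ULift.{u} (Additive Circle)))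

/-- Amenability: existence of a left invariant finitely additive probability measure. -/
def IsAmenableGroup : Prop :=
  ∃ m : Set G → ℝ, (∀ S, 0 ≤ m S) ∧ m Set.univ = 1 ∧
    (∀ S T, Disjoint S T → m (S ∪ T) = m S + m T) ∧
    ∀ (g : G) (S : Set G), m ((fun x => g * x) '' S) = m S

end GroupVN

section Wreath

universe u v
variable {I : Type u} {Γ : Type v} [Group Γ]

/-- The action of `Γ` on `(ℤ/nℤ)^(I)`, the direct sum of copies of `ℤ/nℤ` indexed by `I`,
induced by an action of `Γ` on `I`: `(γ · x)(i) = x(γ⁻¹ · i)`. -/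
def wreathAction (n : ℕ) (ρ : Γ →* Equiv.Perm I) :
    Γ →* MulAut (Multiplicative (I →₀ ZMod n)) where
  toFun γ := AddEquiv.toMultiplicative (Finsupp.domCongr (ρ γ))
  map_one' := by
    ext x : 1
    rw [map_one]
    exact congrArg Multiplicative.ofAdd (Finsupp.ext fun _ => rfl)
  map_mul' γ γ' := by
    ext x : 1
    rw [map_mul]
    exact congrArg Multiplicative.ofAdd (Finsupp.ext fun _ => rfl)

/-- The generalized wreath product `(ℤ/nℤ)^(I) ⋊ Γ`. -/
abbrev GenWreath (n : ℕ) (ρ : Γ →* Equiv.Perm I) : Type (max u v) :=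
  Multiplicative (I →₀ ZMod n) ⋊[wreathAction n ρ] Γ

/-- The left-right action of `Γ × Γ` on `Γ`: `(g, h) · k = g k h⁻¹`. -/
def leftRight (Γ : Type v) [Group Γ] : Γ × Γ →* Equiv.Perm Γ where
  toFun p := (Equiv.mulLeft p.1).trans (Equiv.mulRight p.2⁻¹)
  map_one' := by ext; simp
  map_mul' p q := by ext; simp [mul_assoc]

/-- The restricted wreath product `Γ₀^(S) ⋊ S`, as a subgroup of the unrestricted one. -/
def restrictedWreath (Γ₀ : Type u) (S : Type v) [Group Γ₀] [Group S] :
    Subgroup (RegularWreathProduct Γ₀ S) where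
  carrier := {w | (Function.mulSupport w.left).Finite}
  one_mem' := by simp
  mul_mem' {a b} ha hb := by
    refine (ha.union (hb.preimage (f := fun x => a.right⁻¹ * x)
      (mul_right_injective _).injOn)).subset ?_
    exact Function.mulSupport_mul _ _
  inv_mem' {a} ha := by
    refine (ha.preimage (f := fun x => a.right * x) (mul_right_injective _).injOn).subset ?_
    intro x hx
    simpa using hx

/-- The copy of `S` in the restricted wreath product `Γ₀^(S) ⋊ S`. -/
def wreathBase (Γ₀ : Type u) (S : Type v) [Group Γ₀] [Group S] :
    Subgroup (restrictedWreath Γ₀ S) :=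
  (RegularWreathProduct.inl : S →* RegularWreathProduct Γ₀ S).range.subgroupOf _

end Wreath

end QGroup

end

universe u

/-! The construction is a 2-cocycle twist. Let `Q` be the finite abelian subgroup and `p_χ` in L(G)
its spectral projections, indexed by characters. On their span `Δ_G` is dual to multiplication of
characters. Hence a circle-valued 2-cocycle `ω` on the dual gives a unitary `Ω = ∑ ω(χ,ψ) p_χ ⊗ p_ψ`
satisfying the 2-cocycle relation relative to `Δ_G`, and `Δ_Ω = Ω Δ_G(·) Ω*` is coassociative on the
same algebra L(G) (`isDualCocycle_diagUnitary`, `twist_coassociativity`). The canonical trace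
remains invariant: for `g` in `Q` the twist does not change `u_g ⊗ u_g`, and for `g` outside `Q`
each `p_χ u_g p_ψ` has trace zero. The twist is therefore of Kac type.

To tell the two quantum groups apart, use that `Δ_G` is cocommutative. An isomorphism in either
direction makes every `Δ_Ω(u_g)` invariant under the flip, so `Ω₂₁* Ω` commutes with all `u_g ⊗
u_g`. Applied to `δ_1 ⊗ δ_1`, this operator gives a vector supported on the finite set `Q × Q` and
invariant under simultaneous conjugation; the icc condition reduces it to a multiple of `δ_1 ⊗ δ_1`,
and `ω` must be symmetric (`diag_const`, `symmetric_of_flip`). But a symmetric cocycle with values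
in the divisible group 𝕋 defines an abelian extension, which splits; so a nontrivial `H²` supplies a
non-symmetric `ω` (`exists_nonsymmetric_cocycle`).

For wreath products, two coordinates give a copy of (ℤ/n)², whose dual carries an explicit
non-symmetric bicharacter; what remains is the icc property.

On the analytic side, all structure maps are restrictions of normal maps between full algebras of
bounded operators, and identities are tested on generators by `IsNormal.eq_zero`, a form of the
bicommutant density theorem. -/

noncomputable section

namespace QGroup

/-! ### Normal functionals and maps, and density of generators. -/

section Normality

variable {H K L : Type*}
  [NormedAddCommGroup H] [InnerProductSpace ℂ H]
  [NormedAddCommGroup K] [InnerProductSpace ℂ K]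
  [NormedAddCommGroup L] [InnerProductSpace ℂ L]

/-- Normal functionals on the bounded operators of a Hilbert space. -/
def IsNormal (ω : (H →L[ℂ] H) → ℂ) : Prop :=
  ∃ ξ η : ℕ → H, Summable (fun n => ‖ξ n‖ ^ 2) ∧ Summable (fun n => ‖η n‖ ^ 2) ∧
    ∀ x : H →L[ℂ] H, HasSum (fun n => inner ℂ (η n) (x (ξ n))) (ω x)

/-- Normal maps between the bounded operators of two Hilbert spaces. -/
def IsNormalOp (θ : (H →L[ℂ] H) → (K →L[ℂ] K)) : Prop :=
  ∀ ω : (K →L[ℂ] K) → ℂ, IsNormal ω → IsNormal fun x => ω (θ x)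

theorem IsNormal.of_family {ι : Type*} {ω : (H →L[ℂ] H) → ℂ} (ξ η : ι → H)
    (hξ : Summable fun i => ‖ξ i‖ ^ 2) (hη : Summable fun i => ‖η i‖ ^ 2)
    (h : ∀ x : H →L[ℂ] H, HasSum (fun i => inner ℂ (η i) (x (ξ i))) (ω x)) : IsNormal ω := by
  -- Only the countably many indices with `ξ i ≠ 0` contribute, so both families can be moved to ℕ
  -- along an injection of this support and extended by zero.
  set s : Set ι := Function.support fun i => ‖ξ i‖ ^ 2 with hs
  have hc : s.Countable := hξ.countable_support
  obtain ⟨e, he⟩ := (Set.countable_iff_exists_injective (s := s)).1 hc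
  have key : ∀ (f : ι → H), Summable (fun i => ‖f i‖ ^ 2) →
      Summable fun n => ‖Function.extend e (fun i : s => f i) 0 n‖ ^ 2 := fun f hf => by
    have : (fun n => ‖Function.extend e (fun i : s => f i) 0 n‖ ^ 2) =
        Function.extend e (fun i : s => ‖f i‖ ^ 2) 0 := by
      funext n
      rw [Function.apply_extend (fun v : H => ‖v‖ ^ 2)]
      congr 1
      funext m
      simp
    rw [this, summable_extend_zero he]
    exact hf.subtype s
  refine ⟨_, _, key ξ hξ, key η hη, fun x => ?_⟩
  have : (fun n => inner ℂ (Function.extend e (fun i : s => η i) 0 n)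
      (x (Function.extend e (fun i : s => ξ i) 0 n))) =
      Function.extend e (fun i : s => inner ℂ (η i) (x (ξ i))) 0 := by
    funext n
    by_cases hn : ∃ a, e a = n
    · obtain ⟨a, rfl⟩ := hn
      simp only [he.extend_apply]
    · simp only [Function.extend_apply' _ _ _ hn]
      simp
  rw [this, hasSum_extend_zero he]
  refine (hasSum_subtype_iff_of_support_subset ?_).2 (h x)
  intro i hi
  simp only [hs, Function.mem_support] at hi ⊢
  intro h0
  refine hi ?_
  rw [norm_eq_zero.1 (pow_eq_zero_iff two_ne_zero |>.1 h0), map_zero, inner_zero_right]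

theorem IsNormal.sub {ω ω' : (H →L[ℂ] H) → ℂ} (h : IsNormal ω) (h' : IsNormal ω') :
    IsNormal fun x => ω x - ω' x := by
  obtain ⟨ξ, η, hξ, hη, hs⟩ := h
  obtain ⟨ξ', η', hξ', hη', hs'⟩ := h'
  refine IsNormal.of_family (ι := ℕ ⊕ ℕ) (Sum.elim ξ ξ') (Sum.elim η (fun n => -η' n)) ?_ ?_ ?_
  · exact (HasSum.sum (by exact hξ.hasSum) (by exact hξ'.hasSum)).summable
  · exact (HasSum.sum (by exact hη.hasSum) (by simpa [Function.comp_def] using hη'.hasSum)).summable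
  · intro x
    rw [sub_eq_add_neg]
    refine HasSum.sum (by exact hs x) ?_
    simpa [Function.comp_def] using (hs' x).neg

theorem isNormal_inner (ξ η : H) : IsNormal fun x : H →L[ℂ] H => inner ℂ η (x ξ) :=
  IsNormal.of_family (ι := Unit) (fun _ => ξ) (fun _ => η) (hasSum_fintype _).summable
    (hasSum_fintype _).summable fun x => by simp

theorem summable_norm_sq_map (V : H →L[ℂ] K) {ξ : ℕ → H} (hξ : Summable fun n => ‖ξ n‖ ^ 2) :
    Summable fun n => ‖V (ξ n)‖ ^ 2 := by
  refine Summable.of_nonneg_of_le (fun _ => sq_nonneg _) (fun n => ?_) (hξ.mul_left (‖V‖ ^ 2))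
  rw [← mul_pow]
  gcongr
  exact V.le_opNorm _

variable [CompleteSpace H] [CompleteSpace K]

theorem isNormalOp_comp (W : H →L[ℂ] K) (V : K →L[ℂ] H) :
    IsNormalOp fun x : H →L[ℂ] H => W ∘L x ∘L V := by
  rintro ω ⟨ξ, η, hξ, hη, hs⟩
  refine ⟨fun n => V (ξ n), fun n => W.adjoint (η n), summable_norm_sq_map V hξ,
    summable_norm_sq_map _ hη, fun x => ?_⟩
  simpa [ContinuousLinearMap.adjoint_inner_left] using hs (W ∘L x ∘L V)

theorem IsNormalOp.comp {θ : (K →L[ℂ] K) → (L →L[ℂ] L)} {θ' : (H →L[ℂ] H) → (K →L[ℂ] K)}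
    (h : IsNormalOp θ) (h' : IsNormalOp θ') : IsNormalOp fun x => θ (θ' x) :=
  fun _ hω => h' _ (h _ hω)

theorem hasSum_inner_slice {ι : Type*} (b : HilbertBasis ι ℂ H) (z w : HTensor H K) :
    HasSum (fun i => inner ℂ ((vecTensorLeft (K := K) (b i)).adjoint z)
      ((vecTensorLeft (K := K) (b i)).adjoint w)) (inner ℂ z w) := by
  obtain ⟨s, c, -⟩ := exists_hilbertBasis ℂ K
  have h := (basisTensor b c).hasSum_inner_mul_inner z w
  refine h.prod_fiberwise fun i => ?_
  have := c.hasSum_inner_mul_inner ((vecTensorLeft (K := K) (b i)).adjoint z)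
      ((vecTensorLeft (K := K) (b i)).adjoint w)
  simpa only [ContinuousLinearMap.adjoint_inner_left, ContinuousLinearMap.adjoint_inner_right,
    vecTensorLeft_apply, basisTensor_apply] using this

theorem adjoint_vecTensorLeft_opTensor (x : H) (T : K →L[ℂ] K) (z : HTensor H K) :
    (vecTensorLeft (K := K) x).adjoint (opTensor 1 T z) =
      T ((vecTensorLeft (K := K) x).adjoint z) := by
  refine ext_inner_left ℂ fun k => ?_
  rw [ContinuousLinearMap.adjoint_inner_right, vecTensorLeft_apply,
    ← ContinuousLinearMap.adjoint_inner_left, ← ContinuousLinearMap.star_eq_adjoint, star_opTensor,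
    opTensor_vecTensor, star_one, one_apply_eq_self, ← vecTensorLeft_apply,
    ← ContinuousLinearMap.adjoint_inner_right, ContinuousLinearMap.star_eq_adjoint,
    ContinuousLinearMap.adjoint_inner_left]

/-- Slicing `ξ n` and `η n` along an orthonormal basis of `H` turns `⟪η n, (1 ⊗ x) ξ n⟫` into a sum
over that basis. Parseval keeps the doubly indexed families of slices square summable. -/
theorem isNormalOp_amplify : IsNormalOp fun x : K →L[ℂ] K => opTensor (1 : H →L[ℂ] H) x := by
  rintro ω ⟨ξ, η, hξ, hη, hs⟩
  obtain ⟨s, b, -⟩ := exists_hilbertBasis ℂ H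
  have key : ∀ ξ : ℕ → HTensor H K, Summable (fun n => ‖ξ n‖ ^ 2) →
      Summable fun p : ℕ × s => ‖(vecTensorLeft (K := K) (b p.2)).adjoint (ξ p.1)‖ ^ 2 := by
    intro ξ hξ
    have h1 : ∀ n, HasSum (fun i : s => ‖(vecTensorLeft (K := K) (b i)).adjoint (ξ n)‖ ^ 2)
        (‖ξ n‖ ^ 2) := fun n => by
      have := (hasSum_inner_slice b (ξ n) (ξ n))
      simp only [inner_self_eq_norm_sq_to_K] at this
      exact_mod_cast this
    refine (summable_prod_of_nonneg fun _ => sq_nonneg _).2 ⟨fun n => (h1 n).summable, ?_⟩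
    simpa only [(h1 _).tsum_eq] using hξ
  refine IsNormal.of_family (ι := ℕ × s)
    (fun p => (vecTensorLeft (K := K) (b p.2)).adjoint (ξ p.1))
    (fun p => (vecTensorLeft (K := K) (b p.2)).adjoint (η p.1)) (key ξ hξ) (key η hη) fun x => ?_
  have hsum : Summable fun p : ℕ × s => inner ℂ ((vecTensorLeft (K := K) (b p.2)).adjoint (η p.1))
      (x ((vecTensorLeft (K := K) (b p.2)).adjoint (ξ p.1))) := by
    refine Summable.of_norm_bounded (((key η hη).add ((key ξ hξ).mul_left (‖x‖ ^ 2)))) fun p => ?_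
    set v := (vecTensorLeft (K := K) (b p.2)).adjoint (η p.1)
    set w := (vecTensorLeft (K := K) (b p.2)).adjoint (ξ p.1)
    have h1 : ‖inner ℂ v (x w)‖ ≤ ‖v‖ * (‖x‖ * ‖w‖) :=
      (norm_inner_le_norm _ _).trans (by gcongr; exact x.le_opNorm _)
    nlinarith [sq_nonneg (‖v‖ - ‖x‖ * ‖w‖), sq_nonneg (‖v‖), sq_nonneg (‖x‖ * ‖w‖)]
  have h2 := hsum.hasSum.prod_fiberwise (g := fun n => inner ℂ (η n) (opTensor 1 x (ξ n)))
    fun n => by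
      simpa only [adjoint_vecTensorLeft_opTensor] using
        hasSum_inner_slice b (η n) (opTensor 1 x (ξ n))
  rw [(hs (opTensor 1 x)).unique h2]
  exact hsum.hasSum

theorem norm_vecTensor (x : H) (y : K) : ‖vecTensor x y‖ = ‖x‖ * ‖y‖ := by
  simp [vecTensor, UniformSpace.Completion.norm_coe]

/-- The terms are mutually orthogonal, so square summability suffices. This packs a sequence of
vectors into one vector of the amplified space. -/
theorem exists_hasSum_vecTensor {ξ : ℕ → H} (hξ : Summable fun n => ‖ξ n‖ ^ 2) :
    ∃ z : HTensor (ell2 ℕ) H, HasSum (fun n => vecTensor (delta ℕ n) (ξ n)) z := by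
  have hV : OrthogonalFamily ℂ (fun _ : ℕ => H) fun n =>
      ({ (vecTensorLeft (K := H) (delta ℕ n)).toLinearMap with
        norm_map' := fun y => by
          simp [vecTensorLeft_apply, norm_vecTensor, (delta ℕ).orthonormal.1 n] } :
          H →ₗᵢ[ℂ] HTensor (ell2 ℕ) H) := by
    intro i j hij x y
    change inner ℂ (vecTensorLeft (delta ℕ i) x) (vecTensorLeft (delta ℕ j) y) = 0
    rw [vecTensorLeft_apply, vecTensorLeft_apply, inner_vecTensor, (delta ℕ).orthonormal.2 hij,
      zero_mul]
  obtain ⟨z, hz⟩ := (hV.summable_iff_norm_sq_summable ξ).2 hξ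
  refine ⟨z, ?_⟩
  convert hz using 2 with n
  exact (vecTensorLeft_apply _ _).symm

theorem inner_vecTensor_of_hasSum {E : Type*} [NormedAddCommGroup E] [InnerProductSpace ℂ E]
    (b : HilbertBasis ℕ ℂ E) {η : ℕ → H} {Y : HTensor E H}
    (hY : HasSum (fun n => vecTensor (b n) (η n)) Y) (n : ℕ) (v : H) :
    inner ℂ Y (vecTensor (b n) v) = inner ℂ (η n) v := by
  have h3 : HasSum (fun m => inner ℂ (vecTensor (b n) v) (vecTensor (b m) (η m)))
      (inner ℂ (vecTensor (b n) v) Y) := by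
    simpa using (innerSL ℂ (vecTensor (b n) v)).hasSum hY
  have h4 : inner ℂ (vecTensor (b n) v) Y = inner ℂ v (η n) := by
    refine h3.unique ?_
    have h5 : inner ℂ v (η n) = inner ℂ (vecTensor (b n) v) (vecTensor (b n) (η n)) := by
      rw [inner_vecTensor, orthonormal_iff_ite.1 b.orthonormal, if_pos rfl, one_mul]
    rw [h5]
    refine hasSum_single n fun m hm => ?_
    rw [inner_vecTensor, b.orthonormal.2 hm.symm, zero_mul]
  rw [← inner_conj_symm, h4, inner_conj_symm]

/-- A normal functional is a vector functional of an amplification. -/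
theorem IsNormal.exists_vector {ω : (H →L[ℂ] H) → ℂ} (hω : IsNormal ω) :
    ∃ Ξ Y : HTensor (ell2 ℕ) H, ∀ T : H →L[ℂ] H, inner ℂ Y (opTensor 1 T Ξ) = ω T := by
  obtain ⟨ξ, η, hξ, hη, hs⟩ := hω
  obtain ⟨Ξ, hΞ⟩ := exists_hasSum_vecTensor hξ
  obtain ⟨Y, hY⟩ := exists_hasSum_vecTensor hη
  refine ⟨Ξ, Y, fun T => ?_⟩
  have h1 : HasSum (fun n => vecTensor (delta ℕ n) (T (ξ n))) (opTensor 1 T Ξ) := by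
    simpa [opTensor_vecTensor] using (opTensor 1 T).hasSum hΞ
  have h2 : HasSum (fun n => inner ℂ Y (vecTensor (delta ℕ n) (T (ξ n))))
      (inner ℂ Y (opTensor 1 T Ξ)) := by
    simpa using (innerSL ℂ Y).hasSum h1
  simp only [inner_vecTensor_of_hasSum (delta ℕ) hY] at h2
  exact h2.unique (hs T)

theorem starProjection_commute {T : H →L[ℂ] H} (M : Submodule ℂ H) [M.HasOrthogonalProjection]
    (h : ∀ v ∈ M, T v ∈ M) (h' : ∀ v ∈ M, star T v ∈ M) :
    T * M.starProjection = M.starProjection * T := by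
  ext v
  simp only [mul_apply_eq_comp]
  refine (Submodule.eq_starProjection_of_mem_of_inner_eq_zero
    (h _ (Submodule.starProjection_apply_mem _ _)) fun w hw => ?_).symm
  rw [← map_sub, ← ContinuousLinearMap.adjoint_inner_right, ← ContinuousLinearMap.star_eq_adjoint]
  exact Submodule.starProjection_inner_eq_zero _ _ (h' w hw)

/-- The projection onto the closed cyclic subspace generated by a vector under a self-adjoint
monoid of operators. -/
theorem exists_cyclic_projection {S : Submonoid (H →L[ℂ] H)} (hS : ∀ s ∈ S, star s ∈ S) (Ξ : H) :
    ∃ P : H →L[ℂ] H, (∀ s ∈ S, s * P = P * s) ∧ P Ξ = Ξ ∧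
      ∀ v : H, (∀ s ∈ S, inner ℂ v (s Ξ) = 0) → ∀ w, inner ℂ v (P w) = 0 := by
  set N : Submodule ℂ H := Submodule.span ℂ ((fun s => s Ξ) '' (S : Set (H →L[ℂ] H))) with hN
  have hNinv : ∀ s ∈ S, ∀ v ∈ N, s v ∈ N := by
    intro s hs
    change N ≤ N.comap s.toLinearMap
    refine Submodule.span_le.2 ?_
    rintro _ ⟨t, ht, rfl⟩
    exact Submodule.subset_span ⟨s * t, S.mul_mem hs ht, rfl⟩
  have hinv : ∀ s ∈ S, ∀ v ∈ N.topologicalClosure, s v ∈ N.topologicalClosure := by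
    intro s hs v hv
    exact map_mem_closure s.continuous hv (hNinv s hs)
  have : CompleteSpace N.topologicalClosure :=
    (Submodule.isClosed_topologicalClosure N).completeSpace_coe
  refine ⟨N.topologicalClosure.starProjection,
    fun s hs => starProjection_commute _ (hinv s hs) (hinv _ (hS s hs)),
    Submodule.starProjection_eq_self_iff.2 (Submodule.le_topologicalClosure _
      (Submodule.subset_span ⟨1, S.one_mem, rfl⟩)), fun v hv w => ?_⟩
  have hle : N ≤ LinearMap.ker (innerSL ℂ v).toLinearMap := by
    refine Submodule.span_le.2 ?_
    rintro _ ⟨s, hs, rfl⟩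
    exact hv s hs
  exact Submodule.topologicalClosure_minimal _ hle (innerSL ℂ v).isClosed_ker
    (Submodule.starProjection_apply_mem _ _)

/-- A normal functional vanishing on a self-adjoint monoid of operators vanishes on its
bicommutant. -/
theorem IsNormal.eq_zero {S : Submonoid (H →L[ℂ] H)} (hS : ∀ s ∈ S, star s ∈ S)
    {ω : (H →L[ℂ] H) → ℂ} (hω : IsNormal ω) (h : ∀ s ∈ S, ω s = 0) {x : H →L[ℂ] H}
    (hx : x ∈ Set.centralizer (Set.centralizer (S : Set (H →L[ℂ] H)))) : ω x = 0 := by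
  obtain ⟨Ξ, Y, key⟩ := hω.exists_vector
  obtain ⟨P, hP, hPΞ, hPv⟩ := exists_cyclic_projection
    (S := S.map (amplify (K := H) (ell2 ℕ) : (H →L[ℂ] H) →* _)) (by
      rintro _ ⟨s, hs, rfl⟩
      exact ⟨star s, hS s hs, map_star (amplify (K := H) (ell2 ℕ)) s⟩) Ξ
  -- `P` projects onto the closed span of `(1 ⊗ S) Ξ` and commutes with `1 ⊗ S`, hence with `1 ⊗ x`.
  -- So `(1 ⊗ x) Ξ` lies in that cyclic subspace, to which `Y` is orthogonal because `ω` vanishes on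
  -- `S`.
  have h1 := commute_opTensor_one P (fun s hs => hP _ ⟨s, hs, rfl⟩) x hx
  have h2 : opTensor 1 x Ξ = P (opTensor 1 x Ξ) := by
    have h3 := congrArg (fun T => T Ξ) h1
    simp only [mul_apply_eq_comp, hPΞ] at h3
    exact h3
  rw [← key x, h2]
  refine hPv Y ?_ _
  rintro _ ⟨s, hs, rfl⟩
  exact (key s).trans (h s hs)

/-- Two normal maps agreeing on a self-adjoint monoid agree on its bicommutant. -/
theorem IsNormalOp.eqOn {S : Submonoid (H →L[ℂ] H)} (hS : ∀ s ∈ S, star s ∈ S)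
    {θ θ' : (H →L[ℂ] H) → (K →L[ℂ] K)} (h : IsNormalOp θ) (h' : IsNormalOp θ')
    (hθ : ∀ s ∈ S, θ s = θ' s) {x : H →L[ℂ] H}
    (hx : x ∈ Set.centralizer (Set.centralizer (S : Set (H →L[ℂ] H)))) : θ x = θ' x := by
  ext v
  refine ext_inner_left ℂ fun w => sub_eq_zero.1 ?_
  exact ((h _ (isNormal_inner v w)).sub (h' _ (isNormal_inner v w))).eq_zero hS
    (fun s hs => by rw [hθ s hs, sub_self]) hx

end Normality

/-! ### Tensor products of operators, flip, associator and spatial homomorphisms. -/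

/-- The bounded operators on a Hilbert space. -/
abbrev Op (H : Type*) [NormedAddCommGroup H] [InnerProductSpace ℂ H] := H →L[ℂ] H

section Spatial

variable {H K L H' : Type*}
  [NormedAddCommGroup H] [InnerProductSpace ℂ H]
  [NormedAddCommGroup K] [InnerProductSpace ℂ K]
  [NormedAddCommGroup L] [InnerProductSpace ℂ L]
  [NormedAddCommGroup H'] [InnerProductSpace ℂ H']
  {ι κ μ : Type*}

/-- The tensor product of two operators. -/
def tens (S : Op H) (T : Op K) : Op (HTensor H K) := opTensor S T

theorem tens_vecTensor (S : Op H) (T : Op K) (x : H) (y : K) :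
    tens S T (vecTensor x y) = vecTensor (S x) (T y) := opTensor_vecTensor S T x y

theorem tens_mul (S S' : Op H) (T T' : Op K) :
    tens (S * S') (T * T') = tens S T * tens S' T' :=
  ext_vecTensor (E := HTensor H K) fun x y => by simp [tens_vecTensor]

theorem tens_one_one : tens (1 : Op H) (1 : Op K) = 1 :=
  ext_vecTensor (E := HTensor H K) fun x y => by rw [tens_vecTensor]; rfl

theorem tens_add_left (S S' : Op H) (T : Op K) :
    tens (S + S') T = tens S T + tens S' T :=
  ext_vecTensor (E := HTensor H K) fun x y => by
    rw [add_apply, tens_vecTensor, tens_vecTensor, tens_vecTensor, add_apply,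
      ← vecTensorRight_apply, ← vecTensorRight_apply, ← vecTensorRight_apply, map_add]

theorem tens_add_right (S : Op H) (T T' : Op K) :
    tens S (T + T') = tens S T + tens S T' :=
  ext_vecTensor (E := HTensor H K) fun x y => by
    rw [add_apply, tens_vecTensor, tens_vecTensor, tens_vecTensor, add_apply,
      ← vecTensorLeft_apply, ← vecTensorLeft_apply, ← vecTensorLeft_apply, map_add]

theorem tens_smul_left (c : ℂ) (S : Op H) (T : Op K) :
    tens (c • S) T = c • tens S T :=
  ext_vecTensor (E := HTensor H K) fun x y => by
    rw [smul_apply, tens_vecTensor, tens_vecTensor, smul_apply,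
      ← vecTensorRight_apply, ← vecTensorRight_apply, map_smul]

theorem tens_smul_right (c : ℂ) (S : Op H) (T : Op K) :
    tens S (c • T) = c • tens S T :=
  ext_vecTensor (E := HTensor H K) fun x y => by
    rw [smul_apply, tens_vecTensor, tens_vecTensor, smul_apply,
      ← vecTensorLeft_apply, ← vecTensorLeft_apply, map_smul]

theorem star_tens [CompleteSpace H] [CompleteSpace K] (S : Op H) (T : Op K) :
    star (tens S T) = tens (star S) (star T) := star_opTensor S T

/-- The tensor product of operators, as a bilinear map. -/
def tensₗ (H K : Type*) [NormedAddCommGroup H] [InnerProductSpace ℂ H]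
    [NormedAddCommGroup K] [InnerProductSpace ℂ K] :
    Op H →ₗ[ℂ] Op K →ₗ[ℂ] Op (HTensor H K) :=
  LinearMap.mk₂ ℂ tens tens_add_left tens_smul_left tens_add_right
    tens_smul_right

theorem tensₗ_apply (S : Op H) (T : Op K) : tensₗ H K S T = tens S T := rfl

/-- The algebraic tensor product of operators embeds into the operators on the tensor product. -/
theorem injective_lift_tens :
    Function.Injective (TensorProduct.lift (tensₗ H K)) := by
  refine (injective_iff_map_eq_zero _).2 fun t ht => ?_
  classical
  let e := Module.Basis.ofVectorSpace ℂ (Op K)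
  let f := TensorProduct.equivFinsuppOfBasisRight (M := Op H) e
  obtain ⟨a, rfl⟩ := f.symm.surjective t
  suffices a = 0 by rw [this]; exact f.symm.map_zero
  have h1 : f.symm a = a.sum fun i S => S ⊗ₜ[ℂ] e i :=
    TensorProduct.equivFinsuppOfBasisRight_symm_apply e a
  rw [h1, Finsupp.sum, map_sum] at ht
  simp only [TensorProduct.lift.tmul, tensₗ_apply] at ht
  ext i x
  refine ext_inner_left ℂ fun x' => ?_
  -- Taking the matrix coefficient at `x'`, `x` in the left leg leaves a vanishing combination of
  -- the linearly independent `e j`.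
  have h2 : ∑ j ∈ a.support, inner ℂ x' (a j x) • e j = 0 := by
    ext y
    refine ext_inner_left ℂ fun y' => ?_
    have := congrArg (fun T => inner ℂ (vecTensor x' y') (T (vecTensor x y))) ht
    simpa [sum_apply, inner_sum, tens_vecTensor, inner_vecTensor, inner_smul_right] using this
  have h3 := linearIndependent_iff'.1 e.linearIndependent _ _ h2 i
  by_cases hi : i ∈ a.support
  · simpa using h3 hi
  · simp [Finsupp.notMem_support_iff.1 hi]

/-- The unitary mapping a Hilbert basis to another one. -/
def basisUnitary (b : HilbertBasis ι ℂ H) (c : HilbertBasis κ ℂ K) (e : ι ≃ κ)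
    [CompleteSpace K] : H ≃ₗᵢ[ℂ] K :=
  b.repr.trans (HilbertBasis.mk (c.orthonormal.comp e e.injective) (by
    rw [Set.range_comp, e.surjective.range_eq, Set.image_univ]
    exact c.dense_span.ge)).repr.symm

theorem basisUnitary_apply [CompleteSpace K] (b : HilbertBasis ι ℂ H) (c : HilbertBasis κ ℂ K)
    (e : ι ≃ κ) (i : ι) : basisUnitary b c e (b i) = c (e i) := by
  classical
  simp [basisUnitary, b.repr_self]

/-- The unitary `x ⊗ y ↦ y ⊗ x`. -/
def flipU (b : HilbertBasis ι ℂ H) (c : HilbertBasis κ ℂ K) : HTensor H K ≃ₗᵢ[ℂ] HTensor K H :=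
  basisUnitary (basisTensor b c) (basisTensor c b) (Equiv.prodComm ι κ)

/-- Boundedness in each variable separately is enough: extend from the basis in the first variable,
then in the second. -/
theorem ext_basis_vecTensor {b : HilbertBasis ι ℂ H} {c : HilbertBasis κ ℂ K} {f : H → K → L}
    (S : HTensor H K →L[ℂ] L) (hl : ∀ x, ∃ T : K →L[ℂ] L, ∀ y, f x y = T y)
    (hr : ∀ y, ∃ T : H →L[ℂ] L, ∀ x, f x y = T x)
    (h : ∀ i j, S (vecTensor (b i) (c j)) = f (b i) (c j)) (x : H) (y : K) :
    S (vecTensor x y) = f x y := by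
  have h1 : ∀ j, ∀ x, S (vecTensor x (c j)) = f x (c j) := by
    intro j x
    obtain ⟨T, hT⟩ := hr (c j)
    have : S ∘L vecTensorRight (c j) = T := ext_hilbertBasis b fun i => by
      rw [ContinuousLinearMap.comp_apply, vecTensorRight_apply, h, hT]
    rw [hT, ← this, ContinuousLinearMap.comp_apply, vecTensorRight_apply]
  obtain ⟨T, hT⟩ := hl x
  have : S ∘L vecTensorLeft x = T := ext_hilbertBasis c fun j => by
    rw [ContinuousLinearMap.comp_apply, vecTensorLeft_apply, h1, hT]
  rw [hT, ← this, ContinuousLinearMap.comp_apply, vecTensorLeft_apply]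

theorem flipU_vecTensor (b : HilbertBasis ι ℂ H) (c : HilbertBasis κ ℂ K) (x : H) (y : K) :
    flipU b c (vecTensor x y) = vecTensor y x := by
  refine ext_basis_vecTensor (b := b) (c := c) (f := fun x y => vecTensor y x)
    (flipU b c : HTensor H K →L[ℂ] HTensor K H)
    (fun x => ⟨vecTensorRight x, fun y => (vecTensorRight_apply _ _).symm⟩)
    (fun y => ⟨vecTensorLeft y, fun x => (vecTensorLeft_apply _ _).symm⟩) (fun i j => ?_) x y
  have := basisUnitary_apply (basisTensor b c) (basisTensor c b) (Equiv.prodComm ι κ) (i, j)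
  rw [basisTensor_apply] at this
  exact this.trans (basisTensor_apply _ _ _ _)

/-- The unitary `(x ⊗ y) ⊗ z ↦ x ⊗ (y ⊗ z)`. -/
def assocU (b : HilbertBasis ι ℂ H) (c : HilbertBasis κ ℂ K) (d : HilbertBasis μ ℂ L) :
    HTensor (HTensor H K) L ≃ₗᵢ[ℂ] HTensor H (HTensor K L) :=
  basisUnitary (basisTensor (basisTensor b c) d) (basisTensor b (basisTensor c d))
    (Equiv.prodAssoc ι κ μ)

theorem assocU_vecTensor (b : HilbertBasis ι ℂ H) (c : HilbertBasis κ ℂ K)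
    (d : HilbertBasis μ ℂ L) (x : H) (y : K) (z : L) :
    assocU b c d (vecTensor (vecTensor x y) z) = vecTensor x (vecTensor y z) := by
  have h1 : ∀ i j k, assocU b c d (vecTensor (vecTensor (b i) (c j)) (d k)) =
      vecTensor (b i) (vecTensor (c j) (d k)) := by
    intro i j k
    have := basisUnitary_apply (basisTensor (basisTensor b c) d) (basisTensor b (basisTensor c d))
      (Equiv.prodAssoc ι κ μ) ((i, j), k)
    simp only [Equiv.prodAssoc_apply, basisTensor_apply] at this
    exact this
  let A : HTensor (HTensor H K) L →L[ℂ] HTensor H (HTensor K L) := assocU b c d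
  have h2 : ∀ k x y, A (vecTensor (vecTensor x y) (d k)) = vecTensor x (vecTensor y (d k)) := by
    intro k x y
    have := ext_basis_vecTensor (b := b) (c := c)
      (f := fun x y => vecTensor x (vecTensor y (d k)))
      (A ∘L vecTensorRight (d k))
      (fun x => ⟨vecTensorLeft x ∘L vecTensorRight (d k), fun y => by
        simp [vecTensorLeft_apply, vecTensorRight_apply]⟩)
      (fun y => ⟨vecTensorRight (vecTensor y (d k)), fun y => by simp [vecTensorRight_apply]⟩)
      (fun i j => by
        simp only [ContinuousLinearMap.comp_apply, vecTensorRight_apply]; exact h1 i j k) x y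
    simpa only [ContinuousLinearMap.comp_apply, vecTensorRight_apply] using this
  have h3 : A ∘L vecTensorLeft (vecTensor x y) = vecTensorLeft x ∘L vecTensorLeft y :=
    ext_hilbertBasis d fun k => by
      simp only [ContinuousLinearMap.comp_apply, vecTensorLeft_apply, h2]
  have h4 := DFunLike.congr_fun h3 z
  simp only [ContinuousLinearMap.comp_apply, vecTensorLeft_apply] at h4
  exact h4

variable [CompleteSpace H] [CompleteSpace K] [CompleteSpace H'] [CompleteSpace L]

/-- Conjugation by a unitary between two Hilbert spaces. -/
def conjHom (U : H ≃ₗᵢ[ℂ] K) : Op H →⋆ₐ[ℂ] Op K :=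
  { (U.conjStarAlgEquiv.toAlgEquiv.toAlgHom : Op H →ₐ[ℂ] Op K) with
    map_star' := fun T => map_star U.conjStarAlgEquiv T }

theorem conjHom_apply (U : H ≃ₗᵢ[ℂ] K) (T : Op H) (x : K) :
    conjHom U T x = U (T (U.symm x)) := rfl

theorem conjHom_eq_iff (U : H ≃ₗᵢ[ℂ] K) (T : Op H) (S : Op K) :
    conjHom U T = S ↔ ∀ x, U (T x) = S (U x) := by
  refine ⟨fun h x => by rw [← h, conjHom_apply, U.symm_apply_apply], fun h => ?_⟩
  ext x
  rw [conjHom_apply, h, U.apply_symm_apply]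

theorem isNormalOp_conjHom (U : H ≃ₗᵢ[ℂ] K) : IsNormalOp (conjHom U) :=
  isNormalOp_comp (U : H →L[ℂ] K) (U.symm : K →L[ℂ] H)

/-- The normal `*`-homomorphism `x ↦ U (1 ⊗ x) U*`. -/
def spatialHom (U : HTensor K H ≃ₗᵢ[ℂ] H') : Op H →⋆ₐ[ℂ] Op H' :=
  (conjHom U).comp (amplify K)

theorem isNormalOp_spatialHom (U : HTensor K H ≃ₗᵢ[ℂ] H') : IsNormalOp (spatialHom U) :=
  (isNormalOp_conjHom U).comp isNormalOp_amplify

theorem conjHom_flipU (b : HilbertBasis ι ℂ H) (c : HilbertBasis κ ℂ K)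
    (S : Op H) (T : Op K) :
    conjHom (flipU b c) (tens S T) = tens T S := by
  refine (conjHom_eq_iff _ _ _).2 fun z => ?_
  have : (flipU b c : HTensor H K →L[ℂ] HTensor K H) ∘L tens S T =
      tens T S ∘L (flipU b c : HTensor H K →L[ℂ] HTensor K H) :=
    ext_vecTensor fun x y => by simp [tens_vecTensor, flipU_vecTensor]
  exact DFunLike.congr_fun this z

theorem conjHom_assocU (b : HilbertBasis ι ℂ H) (c : HilbertBasis κ ℂ K)
    (d : HilbertBasis μ ℂ L) (R : Op H) (S : Op K) (T : Op L) :
    conjHom (assocU b c d) (tens (tens R S) T) = tens R (tens S T) := by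
  refine (conjHom_eq_iff _ _ _).2 fun z => ?_
  have : (assocU b c d : HTensor (HTensor H K) L →L[ℂ] HTensor H (HTensor K L)) ∘L
      tens (tens R S) T = tens R (tens S T) ∘L
        (assocU b c d : HTensor (HTensor H K) L →L[ℂ] HTensor H (HTensor K L)) :=
    ext_hilbertBasis (basisTensor (basisTensor b c) d) fun p => by
      obtain ⟨⟨i, j⟩, k⟩ := p
      simp [basisTensor_apply, tens_vecTensor, assocU_vecTensor]
  exact DFunLike.congr_fun this z

/-- Conjugating the left amplification by the flip reduces this to `isNormalOp_spatialHom`. -/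
theorem isNormalOp_amplifyRight :
    IsNormalOp fun x : Op H => tens x (1 : Op K) := by
  obtain ⟨s, b, -⟩ := exists_hilbertBasis ℂ H
  obtain ⟨t, c, -⟩ := exists_hilbertBasis ℂ K
  have := isNormalOp_spatialHom (flipU c b)
  convert this using 2 with x
  exact (conjHom_flipU c b 1 x).symm

theorem IsNormalOp.conj_mul {θ : Op H → Op K} (h : IsNormalOp θ)
    (a b : Op K) : IsNormalOp fun x => a * θ x * b :=
  (isNormalOp_comp a b).comp h

end Spatial

/-! ### Von Neumann algebras: testing membership and normality on generators. -/

section VN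

variable {H K L : Type*}
  [NormedAddCommGroup H] [InnerProductSpace ℂ H] [CompleteSpace H]
  [NormedAddCommGroup K] [InnerProductSpace ℂ K] [CompleteSpace K]
  [NormedAddCommGroup L] [InnerProductSpace ℂ L] [CompleteSpace L]

theorem mem_generated_iff_of_star {s : Set (Op H)} (hs : ∀ x ∈ s, star x ∈ s)
    {x : Op H} :
    x ∈ (generated s).toStarSubalgebra ↔ x ∈ Set.centralizer (Set.centralizer s) := by
  have : s ∪ star s = s := Set.union_eq_left.2 fun y hy => by simpa using hs _ hy
  rw [mem_generated_iff, this]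

theorem mem_of_centralizer (A : VonNeumannAlgebra H) {x : Op H}
    (h : ∀ T ∈ Set.centralizer (A.toStarSubalgebra : Set (Op H)), T * x = x * T) :
    x ∈ A.toStarSubalgebra := by
  have : x ∈ Set.centralizer (Set.centralizer (A.toStarSubalgebra : Set (Op H))) := h
  exact (congrArg (x ∈ ·) A.centralizer_centralizer').mp this

/-- The self-adjoint monoid of elementary tensors in `A ⊗ B`. -/
def tensorMonoid (A : VonNeumannAlgebra H) (B : VonNeumannAlgebra K) :
    Submonoid (Op (HTensor H K)) where
  carrier := Set.range fun p : Elem A × Elem B => tens (p.1 : Op H) (p.2 : Op K)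
  one_mem' := ⟨1, tens_one_one⟩
  mul_mem' := by
    rintro _ _ ⟨p, rfl⟩ ⟨q, rfl⟩
    exact ⟨p * q, tens_mul _ _ _ _⟩

theorem star_mem_tensorMonoid (A : VonNeumannAlgebra H) (B : VonNeumannAlgebra K) :
    ∀ s ∈ tensorMonoid A B, star s ∈ tensorMonoid A B := by
  rintro _ ⟨p, rfl⟩
  exact ⟨star p, (star_tens _ _).symm⟩

theorem mem_vnTensor_iff (A : VonNeumannAlgebra H) (B : VonNeumannAlgebra K)
    {x : Op (HTensor H K)} : x ∈ (vnTensor A B).toStarSubalgebra ↔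
      x ∈ Set.centralizer (Set.centralizer
        (tensorMonoid A B : Set (Op (HTensor H K)))) :=
  mem_generated_iff_of_star (star_mem_tensorMonoid A B)

theorem tens_mem_vnTensor {A : VonNeumannAlgebra H} {B : VonNeumannAlgebra K}
    {a : Op H} {b : Op K} (ha : a ∈ A.toStarSubalgebra) (hb : b ∈ B.toStarSubalgebra) :
    tens a b ∈ (vnTensor A B).toStarSubalgebra :=
  (tmul (A := A) (B := B) ⟨a, ha⟩ ⟨b, hb⟩).2

/-- A normal map sending a self-adjoint monoid into a von Neumann algebra sends its bicommutant
there. -/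
theorem IsNormalOp.map_mem {S : Submonoid (Op H)} (hS : ∀ s ∈ S, star s ∈ S)
    {θ : Op H → Op K} (h : IsNormalOp θ) (B : VonNeumannAlgebra K)
    (hθ : ∀ s ∈ S, θ s ∈ B.toStarSubalgebra) {x : Op H}
    (hx : x ∈ Set.centralizer (Set.centralizer (S : Set (Op H)))) :
    θ x ∈ B.toStarSubalgebra := by
  refine mem_of_centralizer B fun T hT => ?_
  -- For `T` in the commutant of `B`, the maps `x ↦ T θ(x)` and `x ↦ θ(x) T` are normal and agree on
  -- `S`, hence on its bicommutant.
  have h1 := h.conj_mul T 1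
  have h2 := h.conj_mul 1 T
  simp only [mul_one, one_mul] at h1 h2
  exact h1.eqOn hS h2 (fun s hs => (hT _ (hθ s hs)).symm) hx

theorem IsNormalOp.map_mem_of_vnTensor {A : VonNeumannAlgebra H} {B : VonNeumannAlgebra K}
    (C : VonNeumannAlgebra L) {θ : Op (HTensor H K) → Op L}
    (h : IsNormalOp θ)
    (hθ : ∀ a ∈ A.toStarSubalgebra, ∀ b ∈ B.toStarSubalgebra,
      θ (tens a b) ∈ C.toStarSubalgebra)
    {x : Op (HTensor H K)} (hx : x ∈ (vnTensor A B).toStarSubalgebra) :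
    θ x ∈ C.toStarSubalgebra := by
  refine h.map_mem (star_mem_tensorMonoid A B) C ?_ ((mem_vnTensor_iff A B).1 hx)
  rintro _ ⟨p, rfl⟩
  exact hθ _ p.1.2 _ p.2.2

theorem summable_inner_apply {ξ η : ℕ → H} (hξ : Summable fun n => ‖ξ n‖ ^ 2)
    (hη : Summable fun n => ‖η n‖ ^ 2) (x : Op H) :
    Summable fun n => inner ℂ (η n) (x (ξ n)) := by
  refine Summable.of_norm_bounded (hη.add (hξ.mul_left (‖x‖ ^ 2))) fun n => ?_
  have h1 : ‖inner ℂ (η n) (x (ξ n))‖ ≤ ‖η n‖ * (‖x‖ * ‖ξ n‖) :=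
    (norm_inner_le_norm _ _).trans (by gcongr; exact x.le_opNorm _)
  nlinarith [sq_nonneg (‖η n‖ - ‖x‖ * ‖ξ n‖), sq_nonneg (‖η n‖), sq_nonneg (‖x‖ * ‖ξ n‖)]

/-- The vectors defining a normal functional on `A` define one on all bounded operators, since
square summability makes the series converge for every operator. Normality questions can thus be
settled on the full operator algebra. -/
theorem isNormalFunctional_iff {A : VonNeumannAlgebra H} {ω : Elem A → ℂ} :
    IsNormalFunctional A ω ↔
      ∃ ω' : Op H → ℂ, IsNormal ω' ∧ ∀ x : Elem A, ω x = ω' x := by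
  constructor
  · rintro ⟨ξ, η, hξ, hη, h⟩
    exact ⟨fun x => ∑' n, inner ℂ (η n) (x (ξ n)),
      ⟨ξ, η, hξ, hη, fun x => (summable_inner_apply hξ hη x).hasSum⟩, fun x => (h x).tsum_eq.symm⟩
  · rintro ⟨ω', ⟨ξ, η, hξ, hη, h⟩, hω⟩
    exact ⟨ξ, η, hξ, hη, fun x => by rw [hω]; exact h x⟩

theorem IsNormalOp.isNormalMap {A : VonNeumannAlgebra H} {B : VonNeumannAlgebra K}
    {θ : Op H → Op K} (h : IsNormalOp θ) {F : Elem A → Elem B}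
    (hF : ∀ x : Elem A, (F x : Op K) = θ x) : IsNormalMap F := by
  intro ω hω
  obtain ⟨ω', hω', hωω'⟩ := isNormalFunctional_iff.1 hω
  exact isNormalFunctional_iff.2 ⟨_, h _ hω', fun x => by rw [hωω', hF]⟩

/-- The restriction of a `*`-homomorphism to von Neumann algebras. -/
def restrictHom (θ : Op H →⋆ₐ[ℂ] Op K) (A : VonNeumannAlgebra H)
    (B : VonNeumannAlgebra K) (h : ∀ x ∈ A.toStarSubalgebra, θ x ∈ B.toStarSubalgebra) :
    Elem A →⋆ₐ[ℂ] Elem B :=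
  StarAlgHom.codRestrict (θ.comp A.toStarSubalgebra.subtype) B.toStarSubalgebra fun x => h x x.2

theorem restrictHom_coe (θ : Op H →⋆ₐ[ℂ] Op K) (A : VonNeumannAlgebra H)
    (B : VonNeumannAlgebra K) (h : ∀ x ∈ A.toStarSubalgebra, θ x ∈ B.toStarSubalgebra)
    (x : Elem A) : (restrictHom θ A B h x : Op K) = θ x := rfl

end VN

/-! ### Conjugation by unitary operators. -/

section UnitaryOperators

variable {H K L : Type*}
  [NormedAddCommGroup H] [InnerProductSpace ℂ H] [CompleteSpace H]
  [NormedAddCommGroup K] [InnerProductSpace ℂ K] [CompleteSpace K]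
  [NormedAddCommGroup L] [InnerProductSpace ℂ L] [CompleteSpace L]

theorem tens_mem_unitary {u : Op H} {v : Op K} (hu : u ∈ unitary (Op H))
    (hv : v ∈ unitary (Op K)) :
    tens u v ∈ unitary (Op (HTensor H K)) := by
  rw [Unitary.mem_iff] at *
  rw [star_tens, ← tens_mul, ← tens_mul, hu.1, hu.2, hv.1, hv.2, tens_one_one]
  exact ⟨rfl, rfl⟩

/-- Conjugation by a unitary operator. -/
def adHom (u : unitary (Op H)) : (Op H) →⋆ₐ[ℂ] (Op H) :=
  { ((Unitary.conjStarAlgAut ℂ (Op H) u).toAlgEquiv.toAlgHom :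
      (Op H) →ₐ[ℂ] (Op H)) with
    map_star' := fun T => map_star (Unitary.conjStarAlgAut ℂ (Op H) u) T }

theorem adHom_apply (u : unitary (Op H)) (x : Op H) :
    adHom u x = u * x * star (u : Op H) := rfl

theorem isNormalOp_adHom (u : unitary (Op H)) : IsNormalOp (adHom u) :=
  isNormalOp_comp (u : Op H) (star (u : Op H))

/-- A unitary as a unitary operator. -/
def toUnitary (U : H ≃ₗᵢ[ℂ] H) : unitary (Op H) := Unitary.linearIsometryEquiv.symm U

theorem toUnitary_apply (U : H ≃ₗᵢ[ℂ] H) (x : H) : (toUnitary U : Op H) x = U x := rfl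

theorem conjHom_eq_adHom (U : H ≃ₗᵢ[ℂ] H) (x : Op H) :
    conjHom U x = adHom (toUnitary U) x := by
  refine (conjHom_eq_iff _ _ _).2 fun v => ?_
  have h : star (toUnitary U : Op H) (U v) = v :=
    DFunLike.congr_fun (Unitary.star_mul_self_of_mem (toUnitary U).2) v
  rw [adHom_apply, mul_apply_eq_comp, mul_apply_eq_comp, h, toUnitary_apply]

/-- The unitary operator `u ⊗ v`. -/
def unitaryTensor (u : unitary (Op H)) (v : unitary (Op K)) :
    unitary (Op (HTensor H K)) :=
  ⟨tens u v, tens_mem_unitary u.2 v.2⟩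

theorem adHom_unitaryTensor (u : unitary (Op H)) (v : unitary (Op K))
    (x : Op H) (y : Op K) :
    adHom (unitaryTensor u v) (tens x y) = tens (adHom u x) (adHom v y) := by
  rw [adHom_apply, adHom_apply, adHom_apply, unitaryTensor, star_tens, ← tens_mul,
    ← tens_mul]

theorem adHom_one (x : Op H) : adHom (1 : unitary (Op H)) x = x := by
  simp [adHom_apply]

end UnitaryOperators

/-! ### Spatially implemented comultiplications and their twists. -/

section Coassociativity

variable {ι : Type*} {H : Type*} [NormedAddCommGroup H] [InnerProductSpace ℂ H] [CompleteSpace H]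
  (b : HilbertBasis ι ℂ H)

theorem conjHom_assocU_symm (x y z : Op H) :
    conjHom (assocU b b b).symm (tens x (tens y z)) = tens (tens x y) z := by
  rw [← conjHom_assocU b b b]
  ext v
  simp [conjHom_apply]

/-- The associator, on all bounded operators. -/
def assocHom : (Op (HTensor (HTensor H H) H)) →⋆ₐ[ℂ]
    (Op (HTensor H (HTensor H H))) :=
  conjHom (assocU b b b)

theorem isNormalOp_assocHom : IsNormalOp (assocHom b) := isNormalOp_conjHom (assocU b b b)

theorem assocHom_tens (x y z : Op H) :
    assocHom b (tens (tens x y) z) = tens x (tens y z) :=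
  conjHom_assocU b b b x y z

/-- The normal `*`-homomorphism `x ⊗ y ↦ V (1 ⊗ x) V* ⊗ y`. -/
def comulLeft (V : unitary (Op (HTensor H H))) :
    (Op (HTensor H H)) →⋆ₐ[ℂ]
      (Op (HTensor (HTensor H H) H)) :=
  (adHom (unitaryTensor V 1)).comp (spatialHom (assocU b b b).symm)

theorem isNormalOp_comulLeft (V : unitary (Op (HTensor H H))) :
    IsNormalOp (comulLeft b V) :=
  (isNormalOp_adHom (unitaryTensor V 1)).comp (isNormalOp_spatialHom (assocU b b b).symm)

theorem comulLeft_tens (V : unitary (Op (HTensor H H))) (x y : Op H) :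
    comulLeft b V (tens x y) = tens (adHom V (tens 1 x)) y := by
  change adHom (unitaryTensor V 1) (conjHom (assocU b b b).symm (tens 1 (tens x y))) = _
  rw [conjHom_assocU_symm, adHom_unitaryTensor, adHom_one]

/-- The normal `*`-homomorphism `x ⊗ y ↦ x ⊗ V (1 ⊗ y) V*`. -/
def comulRight (V : unitary (Op (HTensor H H))) :
    (Op (HTensor H H)) →⋆ₐ[ℂ]
      (Op (HTensor H (HTensor H H))) :=
  (adHom (unitaryTensor 1 V)).comp
    ((assocHom b).comp
      ((adHom (unitaryTensor (toUnitary (flipU b b)) 1)).comp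
        (spatialHom (assocU b b b).symm)))

theorem isNormalOp_comulRight (V : unitary (Op (HTensor H H))) :
    IsNormalOp (comulRight b V) :=
  (isNormalOp_adHom (unitaryTensor 1 V)).comp ((isNormalOp_assocHom b).comp
    ((isNormalOp_adHom (unitaryTensor (toUnitary (flipU b b)) 1)).comp
      (isNormalOp_spatialHom (assocU b b b).symm)))

theorem comulRight_tens (V : unitary (Op (HTensor H H))) (x y : Op H) :
    comulRight b V (tens x y) = tens x (adHom V (tens 1 y)) := by
  -- The `1` created by amplification sits on the far left and is moved next to `y`: `1 ⊗ (x ⊗ y)`,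
  -- `(1 ⊗ x) ⊗ y`, `(x ⊗ 1) ⊗ y`, `x ⊗ (1 ⊗ y)`; then `V` acts on the last two legs.
  change adHom (unitaryTensor 1 V) (assocHom b
    (adHom (unitaryTensor (toUnitary (flipU b b)) 1)
      (conjHom (assocU b b b).symm (tens 1 (tens x y))))) = _
  rw [conjHom_assocU_symm, adHom_unitaryTensor, adHom_one, ← conjHom_eq_adHom, conjHom_flipU,
    assocHom_tens, adHom_unitaryTensor, adHom_one]

theorem adHom_mul (u v : unitary (Op H)) (x : Op H) :
    adHom (u * v) x = adHom u (adHom v x) := by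
  simp [adHom_apply, mul_assoc]

theorem unitaryTensor_mul {K : Type*} [NormedAddCommGroup K] [InnerProductSpace ℂ K]
    [CompleteSpace K] (u u' : unitary (Op H)) (v v' : unitary (Op K)) :
    unitaryTensor (u * u') (v * v') = unitaryTensor u v * unitaryTensor u' v' :=
  Subtype.ext (tens_mul _ _ _ _)

theorem comulLeft_mul (U V : unitary (Op (HTensor H H)))
    (x : Op (HTensor H H)) :
    comulLeft b (U * V) x = adHom (unitaryTensor U 1) (comulLeft b V x) := by
  change adHom (unitaryTensor (U * V) 1) _ = adHom _ (adHom _ _)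
  rw [← adHom_mul, ← unitaryTensor_mul, one_mul]

theorem comulRight_mul (U V : unitary (Op (HTensor H H)))
    (x : Op (HTensor H H)) :
    comulRight b (U * V) x = adHom (unitaryTensor 1 U) (comulRight b V x) := by
  change adHom (unitaryTensor 1 (U * V)) _ = adHom _ (adHom _ _)
  rw [← adHom_mul, ← unitaryTensor_mul, one_mul]

theorem assocHom_mem {A : VonNeumannAlgebra H}
    {x : Op (HTensor (HTensor H H) H)}
    (hx : x ∈ (vnTensor (vnTensor A A) A).toStarSubalgebra) :
    assocHom b x ∈ (vnTensor A (vnTensor A A)).toStarSubalgebra := by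
  refine (isNormalOp_assocHom b).map_mem_of_vnTensor (vnTensor A (vnTensor A A)) ?_ hx
  -- Here `z` is a general element of `A ⊗ A`, not an elementary tensor. Writing `z ⊗ c = (z ⊗ 1)((1
  -- ⊗ 1) ⊗ c)` allows a second density argument, for `z` alone.
  intro z hz c hc
  have h1 : assocHom b (tens z 1) ∈
      (vnTensor A (vnTensor A A)).toStarSubalgebra := by
    refine ((isNormalOp_assocHom b).comp
      isNormalOp_amplifyRight).map_mem_of_vnTensor (vnTensor A (vnTensor A A)) ?_ hz
    intro x hx y hy
    rw [assocHom_tens]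
    exact tens_mem_vnTensor hx (tens_mem_vnTensor hy (one_mem _))
  have h2 : tens z c = tens z 1 * tens (tens 1 1) c := by
    rw [tens_one_one, ← tens_mul, mul_one, one_mul]
  rw [h2, map_mul, assocHom_tens]
  exact mul_mem h1 (tens_mem_vnTensor (one_mem _) (tens_mem_vnTensor (one_mem _) hc))

theorem isNormalOp_adHom_amplify (V : unitary (Op (HTensor H H))) :
    IsNormalOp fun x : Op H => adHom V (tens 1 x) :=
  (isNormalOp_adHom V).comp isNormalOp_amplify

/-- Coassociativity of a spatially implemented comultiplication, checked on generators. -/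
theorem isCoassociative_of_generators {A : VonNeumannAlgebra H}
    {S : Submonoid (Op H)} (hS : ∀ s ∈ S, star s ∈ S)
    (hA : ∀ x ∈ A.toStarSubalgebra,
      x ∈ Set.centralizer (Set.centralizer (S : Set (Op H))))
    (V : unitary (Op (HTensor H H))) (Δ : Elem A →⋆ₐ[ℂ] Elem (vnTensor A A))
    (hΔ : ∀ x : Elem A, (Δ x : Op (HTensor H H)) = adHom V (tens 1 x))
    (h : ∀ s ∈ S, assocHom b (comulLeft b V (adHom V (tens 1 s))) =
      comulRight b V (adHom V (tens 1 s))) : IsCoassociative Δ := by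
  have hV : ∀ x ∈ A.toStarSubalgebra, adHom V (tens 1 x) ∈ (vnTensor A A).toStarSubalgebra :=
    fun x hx => by
      rw [← hΔ ⟨x, hx⟩]
      exact (Δ ⟨x, hx⟩).2
  have m1 : ∀ x ∈ (vnTensor A A).toStarSubalgebra,
      comulLeft b V x ∈ (vnTensor (vnTensor A A) A).toStarSubalgebra := fun x hx => by
    refine (isNormalOp_comulLeft b V).map_mem_of_vnTensor _ (fun x hx y hy => ?_) hx
    rw [comulLeft_tens]
    exact tens_mem_vnTensor (hV _ hx) hy
  have m2 : ∀ x ∈ (vnTensor A A).toStarSubalgebra,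
      comulRight b V x ∈ (vnTensor A (vnTensor A A)).toStarSubalgebra := fun x hx => by
    refine (isNormalOp_comulRight b V).map_mem_of_vnTensor _ (fun x hx y hy => ?_) hx
    rw [comulRight_tens]
    exact tens_mem_vnTensor hx (hV _ hy)
  refine ⟨restrictHom _ _ _ m1, restrictHom _ _ _ m2,
    restrictHom _ _ _ fun x hx => assocHom_mem b hx,
    ⟨(isNormalOp_comulLeft b V).isNormalMap fun _ => restrictHom_coe _ _ _ _ _,
      fun x y => Subtype.ext ?_⟩,
    ⟨(isNormalOp_comulRight b V).isNormalMap fun _ => restrictHom_coe _ _ _ _ _,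
      fun x y => Subtype.ext ?_⟩,
    ⟨(isNormalOp_assocHom b).isNormalMap fun _ => restrictHom_coe _ _ _ _ _,
      fun x y z => Subtype.ext ?_⟩,
    fun x => Subtype.ext ?_⟩
  · rw [restrictHom_coe]
    change comulLeft b V (tens (x : Op H) (y : Op H)) =
      tens (Δ x : Op (HTensor H H)) (y : Op H)
    rw [comulLeft_tens, hΔ]
  · rw [restrictHom_coe]
    change comulRight b V (tens (x : Op H) (y : Op H)) =
      tens (x : Op H) (Δ y : Op (HTensor H H))
    rw [comulRight_tens, hΔ]
  · rw [restrictHom_coe]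
    exact assocHom_tens b _ _ _
  · rw [restrictHom_coe, restrictHom_coe, restrictHom_coe, hΔ]
    -- Both sides of coassociativity are normal in `x`, so equality on `S` suffices.
    exact (((isNormalOp_assocHom b).comp (isNormalOp_comulLeft b V)).comp
      (isNormalOp_adHom_amplify V)).eqOn hS
      ((isNormalOp_comulRight b V).comp (isNormalOp_adHom_amplify V)) h (hA _ x.2)

/-- The algebra behind twisting: each iterated comultiplication conjugates `φ x` or `ψ x` by a
single element, `v * φ u` or `w * ψ u`, and the cocycle relation `h` says that `α` matches these two
elements. -/
theorem map_conj_mul_eq {R R₁ R₂ : Type*} [Semiring R] [StarRing R] [Algebra ℂ R]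
    [Semiring R₁] [StarRing R₁] [Algebra ℂ R₁] [Semiring R₂] [StarRing R₂] [Algebra ℂ R₂] (φ : R →⋆ₐ[ℂ] R₁) (ψ : R →⋆ₐ[ℂ] R₂)
    (α : R₁ →⋆ₐ[ℂ] R₂) {u x : R} {v : R₁} {w : R₂} (h : α (v * φ u) = w * ψ u)
    (hx : α (φ x) = ψ x) :
    α (v * φ (u * x * star u) * star v) = w * ψ (u * x * star u) * star w := by
  have h1 : v * φ (u * x * star u) * star v = (v * φ u) * φ x * star (v * φ u) := by
    simp only [map_mul, map_star, star_mul, mul_assoc]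
  have h2 : w * ψ (u * x * star u) * star w = (w * ψ u) * ψ x * star (w * ψ u) := by
    simp only [map_mul, map_star, star_mul, mul_assoc]
  rw [h1, h2, map_mul, map_mul α (v * φ u), map_star, h, hx]

/-- Twisting by a unitary 2-cocycle preserves the coassociativity relation. -/
theorem twist_coassociativity (Ω W : unitary (Op (HTensor H H))) {s : Op H}
    (hs : adHom W (tens 1 s) = tens s s)
    (h : assocHom b
        (tens (Ω : Op (HTensor H H)) 1 * comulLeft b W Ω) =
      tens 1 (Ω : Op (HTensor H H)) * comulRight b W Ω) :
    assocHom b (comulLeft b (Ω * W) (adHom (Ω * W) (tens 1 s))) =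
      comulRight b (Ω * W) (adHom (Ω * W) (tens 1 s)) := by
  rw [comulLeft_mul, comulRight_mul, adHom_mul, hs]
  refine map_conj_mul_eq (R := Op (HTensor H H))
    (R₁ := Op (HTensor (HTensor H H) H))
    (R₂ := Op (HTensor H (HTensor H H)))
    (comulLeft b W) (comulRight b W) (assocHom b) h ?_
  rw [comulLeft_tens, comulRight_tens, hs, assocHom_tens]

end Coassociativity

/-! ### The group von Neumann algebra, its trace, and the twisted comultiplication. -/

/-- The regular representations of a group on a Hilbert space with its group von Neumann algebra and
a unitary implementing the comultiplication. -/
structure RegularModel (G : Type*) [Group G] (H : Type*) [NormedAddCommGroup H]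
    [InnerProductSpace ℂ H] [CompleteSpace H] where
  /-- The canonical basis. -/
  basis : HilbertBasis G ℂ H
  /-- The left regular representation. -/
  lam : G → Op H
  /-- The right regular representation. -/
  rho : G → Op H
  /-- The group von Neumann algebra. -/
  alg : VonNeumannAlgebra H
  /-- The unitary implementing the comultiplication. -/
  W : unitary (Op (HTensor H H))
  lam_basis : ∀ g h, lam g (basis h) = basis (g * h)
  rho_basis : ∀ g h, rho g (basis h) = basis (h * g)
  inner_lam : ∀ g v w, inner ℂ (lam g v) (lam g w) = inner ℂ v w
  inner_rho : ∀ g v w, inner ℂ (rho g v) (rho g w) = inner ℂ v w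
  star_lam : ∀ g, star (lam g) = lam g⁻¹
  mem_alg : ∀ x : Op H, x ∈ alg.toStarSubalgebra ↔
    x ∈ Set.centralizer (Set.centralizer (Set.range lam))
  adHom_W : ∀ g, adHom W (tens 1 (lam g)) = tens (lam g) (lam g)

namespace RegularModel

variable {G : Type*} [Group G] {H : Type*} [NormedAddCommGroup H] [InnerProductSpace ℂ H]
  [CompleteSpace H] (m : RegularModel G H)

theorem lam_mul (g h : G) : m.lam (g * h) = m.lam g * m.lam h :=
  ext_hilbertBasis m.basis fun k => by
    rw [m.lam_basis, mul_apply_eq_comp, m.lam_basis, m.lam_basis, mul_assoc]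

theorem lam_one : m.lam 1 = 1 :=
  ext_hilbertBasis m.basis fun k => by rw [m.lam_basis, one_mul]; rfl

/-- The self-adjoint monoid of left translations. -/
def lamMonoid : Submonoid (Op H) where
  carrier := Set.range m.lam
  one_mem' := ⟨1, m.lam_one⟩
  mul_mem' := by
    rintro _ _ ⟨g, rfl⟩ ⟨h, rfl⟩
    exact ⟨g * h, m.lam_mul g h⟩

theorem star_mem_lamMonoid : ∀ s ∈ m.lamMonoid, star s ∈ m.lamMonoid := by
  rintro _ ⟨g, rfl⟩
  exact ⟨g⁻¹, (m.star_lam g).symm⟩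

theorem lam_mem (g : G) : m.lam g ∈ m.alg.toStarSubalgebra :=
  (m.mem_alg _).2 (Set.subset_centralizer_centralizer ⟨g, rfl⟩)

theorem mem_bicommutant {x : Op H} (hx : x ∈ m.alg.toStarSubalgebra) :
    x ∈ Set.centralizer (Set.centralizer (m.lamMonoid : Set (Op H))) := (m.mem_alg x).1 hx

/-- Normal maps agreeing on the left translations agree on the group von Neumann algebra. -/
theorem eqOn_alg {K : Type*} [NormedAddCommGroup K] [InnerProductSpace ℂ K]
    [CompleteSpace K] {θ θ' : Op H → Op K} (h : IsNormalOp θ)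
    (h' : IsNormalOp θ') (hθ : ∀ g, θ (m.lam g) = θ' (m.lam g))
    {x : Op H} (hx : x ∈ m.alg.toStarSubalgebra) : θ x = θ' x :=
  h.eqOn m.star_mem_lamMonoid h' (by rintro _ ⟨g, rfl⟩; exact hθ g) (m.mem_bicommutant hx)

theorem functional_eqOn_alg {ω ω' : Op H → ℂ} (h : IsNormal ω) (h' : IsNormal ω')
    (hω : ∀ g, ω (m.lam g) = ω' (m.lam g)) {x : Op H} (hx : x ∈ m.alg.toStarSubalgebra) :
    ω x = ω' x :=
  sub_eq_zero.1 ((h.sub h').eq_zero m.star_mem_lamMonoid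
    (by rintro _ ⟨g, rfl⟩; exact sub_eq_zero.2 (hω g)) (m.mem_bicommutant hx))

theorem rho_commute {x : Op H} (hx : x ∈ m.alg.toStarSubalgebra) (g : G) :
    m.rho g * x = x * m.rho g := by
  refine m.mem_bicommutant hx _ ?_
  rintro _ ⟨h, rfl⟩
  exact ext_hilbertBasis m.basis fun k => by
    simp only [mul_apply_eq_comp, m.lam_basis, m.rho_basis, mul_assoc]

theorem apply_basis_mul {x : Op H} (hx : x ∈ m.alg.toStarSubalgebra)
    (h g : G) : x (m.basis (h * g)) = m.rho g (x (m.basis h)) := by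
  rw [← m.rho_basis]
  exact (DFunLike.congr_fun (m.rho_commute hx g) (m.basis h)).symm

theorem inner_basis [DecidableEq G] (g h : G) :
    inner ℂ (m.basis g) (m.basis h) = if g = h then 1 else 0 :=
  orthonormal_iff_ite.1 m.basis.orthonormal g h

/-- The canonical trace. -/
def trace (x : Op H) : ℂ := inner ℂ (m.basis 1) (x (m.basis 1))

theorem isNormal_trace : IsNormal m.trace := isNormal_inner _ _

theorem trace_lam [DecidableEq G] (g : G) : m.trace (m.lam g) = if g = 1 then 1 else 0 := by
  rw [trace, m.lam_basis, mul_one, m.inner_basis]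
  simp [eq_comm]

theorem trace_add (x y : Op H) : m.trace (x + y) = m.trace x + m.trace y := by
  simp [trace, inner_add_right]

theorem trace_smul (c : ℂ) (x : Op H) : m.trace (c • x) = c * m.trace x := by
  simp [trace, inner_smul_right]

/-- Right translations commute with `x` and carry `δ_1` to every basis vector, so `δ_1` is
separating. This gives faithfulness of the trace. -/
theorem eq_zero_of_apply_basis_one {x : Op H}
    (hx : x ∈ m.alg.toStarSubalgebra) (h : x (m.basis 1) = 0) : x = 0 :=
  ext_hilbertBasis m.basis fun g => by
    rw [← one_mul g, m.apply_basis_mul hx, h, map_zero]; rfl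

theorem trace_star_mul (x : Op H) :
    m.trace (star x * x) = ((‖x (m.basis 1)‖ ^ 2 : ℝ) : ℂ) := by
  rw [trace, mul_apply_eq_comp, ContinuousLinearMap.star_eq_adjoint,
    ContinuousLinearMap.adjoint_inner_right, inner_self_eq_norm_sq_to_K]
  simp

/-- By normality `x` may be taken to be a left translation by `g`. Both sides then equal `⟪δ_{g⁻¹},
y δ_1⟫`, one through left invariance of the inner product and the other through right invariance. -/
theorem trace_mul_comm {x y : Op H} (hx : x ∈ m.alg.toStarSubalgebra)
    (hy : y ∈ m.alg.toStarSubalgebra) : m.trace (x * y) = m.trace (y * x) := by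
  have h1 : IsNormal fun x => m.trace (x * y) :=
    isNormalOp_comp (H := H) (K := H) 1 y _ m.isNormal_trace
  have h2 : IsNormal fun x => m.trace (y * x) :=
    isNormalOp_comp (H := H) (K := H) y 1 _ m.isNormal_trace
  refine m.functional_eqOn_alg h1 h2 (fun g => ?_) hx
  have hl : m.basis 1 = m.lam g (m.basis g⁻¹) := by rw [m.lam_basis, mul_inv_cancel]
  have hr : m.basis 1 = m.rho g (m.basis g⁻¹) := by rw [m.rho_basis, inv_mul_cancel]
  have h3 : m.trace (m.lam g * y) = inner ℂ (m.basis g⁻¹) (y (m.basis 1)) := by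
    rw [trace, mul_apply_eq_comp]
    nth_rewrite 1 [hl]
    rw [m.inner_lam]
  have h4 : m.trace (y * m.lam g) = inner ℂ (m.basis g⁻¹) (y (m.basis 1)) := by
    rw [trace, mul_apply_eq_comp, m.lam_basis, mul_one, ← one_mul g, m.apply_basis_mul hy, one_mul]
    nth_rewrite 1 [hr]
    rw [m.inner_rho]
  rw [h3, h4]

/-- The comultiplication on all bounded operators. -/
def comul : Op H →⋆ₐ[ℂ] Op (HTensor H H) := (adHom m.W).comp (amplify H)

theorem comul_apply (x : Op H) : m.comul x = adHom m.W (tens 1 x) := rfl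

theorem comul_lam (g : G) : m.comul (m.lam g) = tens (m.lam g) (m.lam g) := m.adHom_W g

theorem isNormalOp_comul : IsNormalOp m.comul := isNormalOp_adHom_amplify m.W

theorem comul_mem {x : Op H} (hx : x ∈ m.alg.toStarSubalgebra) :
    m.comul x ∈ (vnTensor m.alg m.alg).toStarSubalgebra := by
  refine m.isNormalOp_comul.map_mem m.star_mem_lamMonoid _ ?_ (m.mem_bicommutant hx)
  rintro _ ⟨g, rfl⟩
  rw [comul_lam]
  exact tens_mem_vnTensor (m.lam_mem g) (m.lam_mem g)

/-- Unitary 2-cocycles on the dual of `G`. -/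
structure IsDualCocycle (Ω : unitary (Op (HTensor H H))) : Prop where
  mem : (Ω : Op (HTensor H H)) ∈ (vnTensor m.alg m.alg).toStarSubalgebra
  cocycle : assocHom m.basis
      (tens (Ω : Op (HTensor H H)) 1 * comulLeft m.basis m.W (Ω : Op (HTensor H H))) =
    tens 1 (Ω : Op (HTensor H H)) * comulRight m.basis m.W (Ω : Op (HTensor H H))

variable {m}
variable {Ω : unitary (Op (HTensor H H))}

theorem adHom_comul_mem (hΩ : m.IsDualCocycle Ω) :
    ∀ x ∈ m.alg.toStarSubalgebra, ((adHom Ω).comp m.comul) x ∈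
      (vnTensor m.alg m.alg).toStarSubalgebra := fun _ hx =>
  mul_mem (mul_mem hΩ.mem (m.comul_mem hx)) (star_mem hΩ.mem)

/-- The comultiplication of `L(G)` twisted by a dual 2-cocycle. -/
def twist (hΩ : m.IsDualCocycle Ω) : Elem m.alg →⋆ₐ[ℂ] Elem (vnTensor m.alg m.alg) :=
  restrictHom ((adHom Ω).comp m.comul) _ _ (adHom_comul_mem hΩ)

theorem coe_twist (hΩ : m.IsDualCocycle Ω) (x : Elem m.alg) :
    (twist hΩ x : Op (HTensor H H)) = adHom Ω (m.comul x) := rfl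

theorem isNormalOp_twist : IsNormalOp fun x => adHom Ω (m.comul x) :=
  (isNormalOp_adHom Ω).comp m.isNormalOp_comul

theorem isNormalMap_twist (hΩ : m.IsDualCocycle Ω) : IsNormalMap (twist hΩ) :=
  (isNormalOp_twist (m := m) (Ω := Ω)).isNormalMap (coe_twist hΩ)

theorem isCoassociative_twist (hΩ : m.IsDualCocycle Ω) : IsCoassociative (twist hΩ) := by
  refine isCoassociative_of_generators m.basis m.star_mem_lamMonoid
    (fun x hx => m.mem_bicommutant hx) (Ω * m.W) (twist hΩ) (fun x => ?_) ?_
  · rw [coe_twist, comul_apply, adHom_mul]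
  · rintro _ ⟨g, rfl⟩
    exact twist_coassociativity m.basis Ω m.W (m.adHom_W g) hΩ.cocycle

/-- Undoing the two conjugations leaves `1 ⊗ x`, which is tested on the vectors `δ_1 ⊗ v`. -/
theorem injective_twist (hΩ : m.IsDualCocycle Ω) : Function.Injective (twist hΩ) := by
  have h : ∀ (u : unitary (Op (HTensor H H))) (x : Op (HTensor H H)),
      adHom u x = 0 → x = 0 := fun u x hx => by
    rw [← adHom_one x, ← inv_mul_cancel u, adHom_mul, hx, map_zero]
  refine (injective_iff_map_eq_zero _).2 fun x hx => Subtype.ext ?_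
  have h1 := congrArg Subtype.val hx
  rw [coe_twist] at h1
  have h2 := h _ _ (h _ _ h1)
  refine ContinuousLinearMap.ext fun v => ?_
  have h3 : vecTensor (m.basis 1) ((x : Op H) v) = 0 := by
    have := DFunLike.congr_fun h2 (vecTensor (m.basis 1) v)
    exact (tens_vecTensor 1 (x : Op H) (m.basis 1) v).symm.trans this
  have h4 := norm_vecTensor (m.basis 1) ((x : Op H) v)
  rw [h3, norm_zero, m.basis.orthonormal.1, one_mul] at h4
  exact norm_eq_zero.1 h4.symm

end RegularModel

/-! ### Slice maps and invariance of the Haar state. -/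

section Slices

variable {H K : Type*}
  [NormedAddCommGroup H] [InnerProductSpace ℂ H] [CompleteSpace H]
  [NormedAddCommGroup K] [InnerProductSpace ℂ K] [CompleteSpace K]

/-- The slice map `S ⊗ T ↦ ⟪v, T v⟫ S`. -/
def rightSlice (v : K) : Op (HTensor H K) →ₗ[ℂ] Op H where
  toFun z := (vecTensorRight (H := H) v).adjoint ∘L z ∘L vecTensorRight v
  map_add' z z' := by ext; simp
  map_smul' c z := by ext; simp

theorem rightSlice_tens (v : K) (S : Op H) (T : Op K) :
    rightSlice v (tens S T) = (inner ℂ v (T v) : ℂ) • S := by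
  refine ContinuousLinearMap.ext fun x => ext_inner_left ℂ fun y => ?_
  change inner ℂ y ((vecTensorRight (H := H) v).adjoint (tens S T (vecTensorRight v x))) =
    inner ℂ y ((inner ℂ v (T v) : ℂ) • S x)
  rw [ContinuousLinearMap.adjoint_inner_right, vecTensorRight_apply, vecTensorRight_apply,
    tens_vecTensor, inner_vecTensor, inner_smul_right, mul_comm]

theorem isNormalOp_rightSlice (v : K) : IsNormalOp fun z : Op (HTensor H K) => rightSlice v z :=
  isNormalOp_comp _ _

/-- The slice map `S ⊗ T ↦ ⟪v, S v⟫ T`. -/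
def leftSlice (v : H) : Op (HTensor H K) →ₗ[ℂ] Op K where
  toFun z := (vecTensorLeft (K := K) v).adjoint ∘L z ∘L vecTensorLeft v
  map_add' z z' := by ext; simp
  map_smul' c z := by ext; simp

theorem leftSlice_tens (v : H) (S : Op H) (T : Op K) :
    leftSlice v (tens S T) = (inner ℂ v (S v) : ℂ) • T := by
  refine ContinuousLinearMap.ext fun x => ext_inner_left ℂ fun y => ?_
  change inner ℂ y ((vecTensorLeft (K := K) v).adjoint (tens S T (vecTensorLeft v x))) =
    inner ℂ y ((inner ℂ v (S v) : ℂ) • T x)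
  rw [ContinuousLinearMap.adjoint_inner_right, vecTensorLeft_apply, vecTensorLeft_apply,
    tens_vecTensor, inner_vecTensor, inner_smul_right]

theorem isNormalOp_leftSlice (v : H) : IsNormalOp fun z : Op (HTensor H K) => leftSlice v z :=
  isNormalOp_comp _ _

/-- The restriction of a linear map to von Neumann algebras. -/
def restrictLinear (E : Op H →ₗ[ℂ] Op K) (A : VonNeumannAlgebra H)
    (B : VonNeumannAlgebra K) (h : ∀ x ∈ A.toStarSubalgebra, E x ∈ B.toStarSubalgebra) :
    Elem A →ₗ[ℂ] Elem B where
  toFun x := ⟨E x, h x x.2⟩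
  map_add' x y := Subtype.ext (map_add E _ _)
  map_smul' c x := Subtype.ext (map_smul E _ _)

theorem rightSlice_mem {A : VonNeumannAlgebra H} {B : VonNeumannAlgebra K} (v : K) :
    ∀ z ∈ (vnTensor A B).toStarSubalgebra, rightSlice v z ∈ A.toStarSubalgebra := fun z hz => by
  refine (isNormalOp_rightSlice v).map_mem_of_vnTensor A (fun a ha b _ => ?_) hz
  rw [rightSlice_tens]
  exact SMulMemClass.smul_mem _ ha

theorem leftSlice_mem {A : VonNeumannAlgebra H} {B : VonNeumannAlgebra K} (v : H) :
    ∀ z ∈ (vnTensor A B).toStarSubalgebra, leftSlice v z ∈ B.toStarSubalgebra := fun z hz => by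
  refine (isNormalOp_leftSlice v).map_mem_of_vnTensor B (fun a _ b hb => ?_) hz
  rw [leftSlice_tens]
  exact SMulMemClass.smul_mem _ hb

end Slices

namespace RegularModel

variable {G : Type*} [Group G] {H : Type*} [NormedAddCommGroup H] [InnerProductSpace ℂ H]
  [CompleteSpace H] (m : RegularModel G H)

/-- The canonical trace on the group von Neumann algebra. -/
def traceₗ : Elem m.alg →ₗ[ℂ] ℂ where
  toFun x := m.trace x
  map_add' x y := m.trace_add x y
  map_smul' c x := m.trace_smul c x

/-- A normal functional `ω'` pulls back to `ω' 1` times `ω`. This is the right-hand side of the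
invariance identity, so that invariance can be checked on the `u_g`. -/
theorem isNormalOp_smul_one {ω : Op H → ℂ} (hω : IsNormal ω) :
    IsNormalOp fun x : Op H => ω x • (1 : Op H) := by
  rintro ω' ⟨ξ, η, hξ, hη, h⟩
  have h1 : (fun x => ω' (ω x • (1 : Op H))) = fun x => ω' 1 * ω x := by
    funext x
    have h2 := (h 1).mul_left (ω x)
    have h3 := h (ω x • (1 : Op H))
    simp only [smul_apply, inner_smul_right] at h3
    rw [h3.unique h2, mul_comm]
  rw [h1]
  obtain ⟨ξ, η, hξ, hη, h⟩ := hω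
  refine ⟨fun n => ω' 1 • ξ n, η, ?_, hη, fun x => ?_⟩
  · simpa [norm_smul, mul_pow] using hξ.mul_left (‖ω' 1‖ ^ 2)
  · simpa [inner_smul_right] using (h x).mul_left (ω' 1)

variable {m}
variable {Ω : unitary (Op (HTensor H H))}

/-- The canonical trace is the Haar state of a twisted comultiplication if it is invariant on the
canonical unitaries. -/
theorem isHaarState_twist (hΩ : m.IsDualCocycle Ω)
    (hr : ∀ g, rightSlice (m.basis 1) (adHom Ω (tens (m.lam g) (m.lam g))) =
      m.trace (m.lam g) • 1)
    (hl : ∀ g, leftSlice (m.basis 1) (adHom Ω (tens (m.lam g) (m.lam g))) =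
      m.trace (m.lam g) • 1) : IsHaarState (twist hΩ) m.traceₗ where
  map_one := by
    change inner ℂ (m.basis 1) (m.basis 1) = 1
    classical
    rw [m.inner_basis, if_pos rfl]
  nonneg a := by
    change 0 ≤ m.trace (star (a : Op H) * a)
    rw [m.trace_star_mul]
    exact_mod_cast sq_nonneg ‖(a : Op H) (m.basis 1)‖
  faithful a ha := by
    have h : m.trace (star (a : Op H) * a) = 0 := ha
    rw [m.trace_star_mul, Complex.ofReal_eq_zero, sq_eq_zero_iff, norm_eq_zero] at h
    exact Subtype.ext (m.eq_zero_of_apply_basis_one a.2 h)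
  normal := isNormalFunctional_iff.2 ⟨m.trace, m.isNormal_trace, fun _ => rfl⟩
  right_invariant := by
    refine ⟨restrictLinear (rightSlice (m.basis 1)) _ _ (rightSlice_mem _),
      ⟨(isNormalOp_rightSlice (m.basis 1)).isNormalMap fun _ => rfl,
        fun a b => Subtype.ext (rightSlice_tens _ _ _)⟩, fun a => Subtype.ext ?_⟩
    refine m.eqOn_alg ((isNormalOp_rightSlice (m.basis 1)).comp isNormalOp_twist)
      (isNormalOp_smul_one m.isNormal_trace) (fun g => ?_) a.2
    rw [m.comul_lam, hr]
  left_invariant := by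
    refine ⟨restrictLinear (leftSlice (m.basis 1)) _ _ (leftSlice_mem _),
      ⟨(isNormalOp_leftSlice (m.basis 1)).isNormalMap fun _ => rfl,
        fun a b => Subtype.ext (leftSlice_tens _ _ _)⟩, fun a => Subtype.ext ?_⟩
    refine m.eqOn_alg ((isNormalOp_leftSlice (m.basis 1)).comp isNormalOp_twist)
      (isNormalOp_smul_one m.isNormal_trace) (fun g => ?_) a.2
    rw [m.comul_lam, hl]

theorem isKacType_twist (hΩ : m.IsDualCocycle Ω)
    (hr : ∀ g, rightSlice (m.basis 1) (adHom Ω (tens (m.lam g) (m.lam g))) =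
      m.trace (m.lam g) • 1)
    (hl : ∀ g, leftSlice (m.basis 1) (adHom Ω (tens (m.lam g) (m.lam g))) =
      m.trace (m.lam g) • 1) : IsKacType (twist hΩ) :=
  ⟨⟨injective_twist hΩ, isNormalMap_twist hΩ, isCoassociative_twist hΩ,
    m.traceₗ, isHaarState_twist hΩ hr hl⟩, m.traceₗ, isHaarState_twist hΩ hr hl,
    fun a b => m.trace_mul_comm a.2 b.2⟩

end RegularModel

/-! ### The algebraic tensor product inside the von Neumann tensor product. -/

section AlgebraicTensor

variable {H K : Type*}
  [NormedAddCommGroup H] [InnerProductSpace ℂ H] [CompleteSpace H]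
  [NormedAddCommGroup K] [InnerProductSpace ℂ K] [CompleteSpace K]
  (A : VonNeumannAlgebra H)

/-- The embedding of the algebraic tensor product in the von Neumann algebra tensor product. -/
def algTensor : Elem A ⊗[ℂ] Elem A →ₗ[ℂ] Elem (vnTensor A A) :=
  TensorProduct.lift (LinearMap.mk₂ ℂ tmul
    (fun _ _ _ => Subtype.ext (tens_add_left _ _ _))
    (fun _ _ _ => Subtype.ext (tens_smul_left _ _ _))
    (fun _ _ _ => Subtype.ext (tens_add_right _ _ _))
    (fun _ _ _ => Subtype.ext (tens_smul_right _ _ _)))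

theorem algTensor_tmul (a b : Elem A) : algTensor A (a ⊗ₜ b) = tmul a b := rfl

theorem coe_algTensor (t : Elem A ⊗[ℂ] Elem A) : (algTensor A t : Op (HTensor H H)) =
    TensorProduct.lift (tensₗ H H) (TensorProduct.map A.toStarSubalgebra.subtype.toLinearMap
      A.toStarSubalgebra.subtype.toLinearMap t) := by
  induction t using TensorProduct.induction_on with
  | zero => simp
  | tmul a b => rfl
  | add s t hs ht => rw [map_add, map_add, map_add, ← hs, ← ht]; rfl

/-- Flatness over ℂ embeds the tensor square of `A` in that of all bounded operators, where
`injective_lift_tens` applies. It lets symmetry of a tensor be pulled back along `π ⊗ π`. -/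
theorem injective_algTensor : Function.Injective (algTensor A) := by
  intro s t h
  have h1 := congrArg Subtype.val h
  rw [coe_algTensor, coe_algTensor] at h1
  refine TensorProduct.map_injective_of_flat_flat _ _ ?_ ?_ (injective_lift_tens h1)
  · exact Subtype.val_injective
  · exact Subtype.val_injective

theorem conjHom_flipU_algTensor {ι : Type*} (b : HilbertBasis ι ℂ H) (t : Elem A ⊗[ℂ] Elem A) :
    conjHom (flipU b b) (algTensor A t : Op (HTensor H H)) =
      algTensor A (TensorProduct.comm ℂ _ _ t) := by
  induction t using TensorProduct.induction_on with
  | zero => simp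
  | tmul x y => exact conjHom_flipU b b (x : Op H) (y : Op H)
  | add s t hs ht =>
    rw [map_add, map_add, map_add]
    change conjHom (flipU b b) ((algTensor A s : Op (HTensor H H)) + algTensor A t) = _
    rw [map_add, hs, ht]
    rfl

theorem congr_comm {M N : Type*} [AddCommGroup M] [Module ℂ M] [AddCommGroup N] [Module ℂ N]
    (f : M ≃ₗ[ℂ] N) (t : M ⊗[ℂ] M) :
    TensorProduct.congr f f (TensorProduct.comm ℂ M M t) =
      TensorProduct.comm ℂ N N (TensorProduct.congr f f t) := by
  induction t using TensorProduct.induction_on with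
  | zero => simp
  | tmul x y => simp
  | add s t hs ht => simp only [map_add, hs, ht]

theorem IsTensorMap.map_algTensor {A : VonNeumannAlgebra H} {B : VonNeumannAlgebra K}
    (π : Elem A ≃⋆ₐ[ℂ] Elem B) {P : Elem (vnTensor A A) →⋆ₐ[ℂ] Elem (vnTensor B B)}
    (hP : IsTensorMap π π P) (t : Elem A ⊗[ℂ] Elem A) :
    P (algTensor A t) = algTensor B (TensorProduct.congr π.toAlgEquiv.toLinearEquiv
      π.toAlgEquiv.toLinearEquiv t) := by
  induction t using TensorProduct.induction_on with
  | zero => simp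
  | tmul x y => exact hP.map_tmul x y
  | add s t hs ht => rw [map_add, map_add, map_add, map_add, hs, ht]

end AlgebraicTensor

/-! ### An isomorphism with the cocommutative `Δ_G` forces flip invariance. -/

namespace RegularModel

variable {G : Type*} [Group G] {H : Type*} [NormedAddCommGroup H] [InnerProductSpace ℂ H]
  [CompleteSpace H] {m : RegularModel G H}

theorem flip_comul {x : Op H} (hx : x ∈ m.alg.toStarSubalgebra) :
    conjHom (flipU m.basis m.basis) (m.comul x) = m.comul x := by
  refine m.eqOn_alg ((isNormalOp_conjHom _).comp m.isNormalOp_comul) m.isNormalOp_comul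
    (fun g => ?_) hx
  rw [m.comul_lam, conjHom_flipU]

/-- On the image of `u_g` the comultiplication `Δ'` takes the value `π(u_g) ⊗ π(u_g)`, visibly
symmetric; the general case follows by normality of `P ∘ Δ`. Normality of `π` itself is never
needed. -/
theorem flip_of_qgIsomorphic {Δ Δ' : Elem m.alg →⋆ₐ[ℂ] Elem (vnTensor m.alg m.alg)}
    (hΔ : ∀ x, (Δ x : Op (HTensor H H)) = m.comul x) (h : QGIsomorphic Δ Δ') (x : Elem m.alg) :
    conjHom (flipU m.basis m.basis) (Δ' x : Op (HTensor H H)) = Δ' x := by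
  obtain ⟨π, P, hP, hπ⟩ := h
  obtain ⟨x, rfl⟩ := EquivLike.surjective π x
  rw [hπ]
  have hlam : ∀ g, conjHom (flipU m.basis m.basis)
      (P (Δ ⟨m.lam g, m.lam_mem g⟩) : Op (HTensor H H)) = P (Δ ⟨m.lam g, m.lam_mem g⟩) := by
    intro g
    have : Δ ⟨m.lam g, m.lam_mem g⟩ =
        tmul (⟨m.lam g, m.lam_mem g⟩ : Elem m.alg) ⟨m.lam g, m.lam_mem g⟩ :=
      Subtype.ext ((hΔ _).trans (m.comul_lam g))
    rw [this, hP.map_tmul]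
    exact conjHom_flipU m.basis m.basis _ _
  have hn : ∀ ω : Op (HTensor H H) → ℂ, IsNormal ω → ∃ ω' : Op H → ℂ, IsNormal ω' ∧
      ∀ x : Elem m.alg, ω (P (Δ x)) = ω' x := by
    intro ω hω
    have h1 : IsNormalMap Δ := m.isNormalOp_comul.isNormalMap hΔ
    have h2 : IsNormalFunctional (vnTensor m.alg m.alg) fun z => ω z :=
      isNormalFunctional_iff.2 ⟨ω, hω, fun _ => rfl⟩
    exact isNormalFunctional_iff.1 (h1 _ (hP.normal _ h2))
  refine ContinuousLinearMap.ext fun v => ext_inner_left ℂ fun w => ?_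
  obtain ⟨ω₁, hω₁, h1⟩ := hn _ (isNormal_inner v w)
  obtain ⟨ω₂, hω₂, h2⟩ := hn _ (isNormalOp_conjHom (flipU m.basis m.basis) _ (isNormal_inner v w))
  refine (h2 x).trans (Eq.trans ?_ (h1 x).symm)
  refine m.functional_eqOn_alg hω₂ hω₁ (fun g => ?_) x.2
  refine (h2 ⟨m.lam g, m.lam_mem g⟩).symm.trans (Eq.trans ?_ (h1 ⟨m.lam g, m.lam_mem g⟩))
  rw [hlam]

/-- The opposite direction is not formal, since inverting `π` would require a normal extension of
`π⁻¹ ⊗ π⁻¹`. Instead `P (Δ' x)` is symmetric, and as `Δ' x` is an algebraic tensor, on which `P` is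
the injective map `π ⊗ π`, symmetry descends to `Δ' x`. -/
theorem flip_of_qgIsomorphic' {Δ Δ' : Elem m.alg →⋆ₐ[ℂ] Elem (vnTensor m.alg m.alg)}
    (hΔ : ∀ x, (Δ x : Op (HTensor H H)) = m.comul x) (h : QGIsomorphic Δ' Δ) {x : Elem m.alg}
    (hx : Δ' x ∈ LinearMap.range (algTensor m.alg)) :
    conjHom (flipU m.basis m.basis) (Δ' x : Op (HTensor H H)) = Δ' x := by
  obtain ⟨π, P, hP, hπ⟩ := h
  obtain ⟨t, ht⟩ := hx
  have h1 := flip_comul (m := m) (π x).2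
  rw [← hΔ, hπ, ← ht, hP.map_algTensor π, conjHom_flipU_algTensor] at h1
  have h2 := injective_algTensor m.alg (Subtype.ext h1)
  have h3 : TensorProduct.comm ℂ _ _ t = t := by
    refine (TensorProduct.congr π.toAlgEquiv.toLinearEquiv π.toAlgEquiv.toLinearEquiv).injective
      ((congr_comm _ t).trans h2)
  rw [← ht, conjHom_flipU_algTensor, h3]

end RegularModel

/-! ### Character orthogonality for finite abelian groups. -/

section Characters

variable (Q : Type*) [CommGroup Q]

/-- The additive character with values in the circle attached to a multiplicative one. -/
def toAddChar : (Q →* Circle) → AddChar (Additive Q) Circle := fun χ =>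
  { toFun := fun a => χ a.toMul
    map_zero_eq_one' := map_one χ
    map_add_eq_mul' := fun a b => map_mul χ a.toMul b.toMul }

theorem finite_dual [Finite Q] : Finite (Q →* Circle) := by
  have : Finite (AddChar (Additive Q) ℂ) := inferInstance
  refine Finite.of_injective
    (fun χ => AddChar.circleEquivComplex (α := Additive Q) (toAddChar Q χ)) ?_
  intro χ ψ h
  have h1 := AddChar.circleEquivComplex.injective h
  ext a
  exact congrArg (fun f : AddChar (Additive Q) Circle => (f (Additive.ofMul a) : ℂ)) h1

variable {Q}

theorem exists_char_ne_one [Finite Q] {a : Q} (ha : a ≠ 1) : ∃ χ : Q →* Circle, χ a ≠ 1 := by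
  obtain ⟨ψ, hψ⟩ := AddChar.exists_apply_ne_zero.2
    (show (Additive.ofMul a) ≠ 0 from fun h => ha (Additive.ofMul.injective h))
  refine ⟨⟨⟨fun q => AddChar.circleEquivComplex.symm ψ (Additive.ofMul q),
    AddChar.map_zero_eq_one _⟩, fun q r => AddChar.map_add_eq_mul _ _ _⟩, fun h => hψ ?_⟩
  have h1 : AddChar.circleEquivComplex (AddChar.circleEquivComplex.symm ψ) (Additive.ofMul a) = 1 :=
    congrArg (fun z : Circle => (z : ℂ)) h
  rwa [AddEquiv.apply_symm_apply] at h1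

variable [Fintype Q]

open scoped Classical in
theorem sum_char (χ : Q →* Circle) :
    ∑ a, (χ a : ℂ) = if χ = 1 then (Fintype.card Q : ℂ) else 0 := by
  have h := sum_hom_units (Circle.coeHom.comp χ)
  have h1 : Circle.coeHom.comp χ = 1 ↔ χ = 1 := by
    refine ⟨fun h => MonoidHom.ext fun a => Circle.ext ?_, fun h => by rw [h]; rfl⟩
    exact DFunLike.congr_fun h a
  simp only [h1] at h
  exact_mod_cast h

variable [Fintype (Q →* Circle)]

open scoped Classical in
theorem sum_dual_char (a : Q) :
    ∑ χ : Q →* Circle, (χ a : ℂ) =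
      if a = 1 then (Fintype.card (Q →* Circle) : ℂ) else 0 := by
  have h := sum_hom_units (Circle.coeHom.comp (MonoidHom.eval a : (Q →* Circle) →* Circle))
  have h1 : Circle.coeHom.comp (MonoidHom.eval a : (Q →* Circle) →* Circle) = 1 ↔ a = 1 := by
    constructor
    · intro h
      by_contra ha
      obtain ⟨χ, hχ⟩ := exists_char_ne_one ha
      exact hχ (Circle.ext (DFunLike.congr_fun h χ))
    · rintro rfl
      ext χ
      simp
  simp only [h1] at h
  exact_mod_cast h

/-- Double counting of the sum of `χ a` over all `a` and `χ`. -/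
theorem card_dual : (Fintype.card (Q →* Circle) : ℂ) = Fintype.card Q := by
  classical
  have h := Finset.sum_comm (s := (Finset.univ : Finset Q))
    (t := (Finset.univ : Finset (Q →* Circle))) (f := fun a χ => (χ a : ℂ))
  simp only [sum_char, sum_dual_char, Finset.sum_ite_eq', Finset.mem_univ, if_true] at h
  exact h

end Characters

/-! ### Spectral projections of a finite abelian subgroup and diagonal operators. -/

section TensorSums

variable {H K : Type*}
  [NormedAddCommGroup H] [InnerProductSpace ℂ H]
  [NormedAddCommGroup K] [InnerProductSpace ℂ K] {α : Type*}

theorem tens_sum_left (s : Finset α) (f : α → Op H) (T : Op K) :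
    tens (∑ i ∈ s, f i) T = ∑ i ∈ s, tens (f i) T := by
  simp only [← tensₗ_apply, map_sum, LinearMap.sum_apply]

theorem tens_sum_right (s : Finset α) (S : Op H) (f : α → Op K) :
    tens S (∑ i ∈ s, f i) = ∑ i ∈ s, tens S (f i) := by
  simp only [← tensₗ_apply, map_sum]

theorem tens_zero_left (T : Op K) : tens (0 : Op H) T = 0 := by
  rw [← tensₗ_apply, map_zero, LinearMap.zero_apply]

theorem tens_zero_right (S : Op H) : tens S (0 : Op K) = 0 := by
  rw [← tensₗ_apply, map_zero]

end TensorSums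

namespace RegularModel

variable {G : Type*} [Group G] {H : Type*} [NormedAddCommGroup H] [InnerProductSpace ℂ H]
  [CompleteSpace H] (m : RegularModel G H)
  {Q : Type*} [CommGroup Q] [Fintype Q] [Fintype (Q →* Circle)] (ι : Q →* G)

/-- The spectral projection of a finite abelian subgroup at a character. -/
def charProj (χ : Q →* Circle) : Op H :=
  (Fintype.card Q : ℂ)⁻¹ • ∑ a, (χ a⁻¹ : ℂ) • m.lam (ι a)

omit [Fintype (Q →* Circle)] in
theorem lam_mul_charProj (a : Q) (χ : Q →* Circle) :
    m.lam (ι a) * m.charProj ι χ = (χ a : ℂ) • m.charProj ι χ := by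
  rw [charProj, mul_smul_comm, smul_comm (χ a : ℂ)]
  congr 1
  rw [Finset.mul_sum, Finset.smul_sum]
  refine Fintype.sum_equiv (Equiv.mulLeft a) (fun b => m.lam (ι a) * (χ b⁻¹ : ℂ) • m.lam (ι b))
    (fun b => (χ a : ℂ) • (χ b⁻¹ : ℂ) • m.lam (ι b)) fun b => ?_
  rw [mul_smul_comm, ← lam_mul, ← map_mul, Equiv.coe_mulLeft, smul_smul]
  congr 1
  rw [mul_inv_rev, ← Circle.coe_mul, ← map_mul, mul_comm b⁻¹, mul_inv_cancel_left]

omit [Fintype (Q →* Circle)] in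
theorem commute_lam_charProj (a : Q) (χ : Q →* Circle) :
    Commute (m.lam (ι a)) (m.charProj ι χ) := by
  rw [commute_iff_eq, charProj, mul_smul_comm, smul_mul_assoc, Finset.mul_sum, Finset.sum_mul]
  congr 1
  refine Finset.sum_congr rfl fun b _ => ?_
  rw [mul_smul_comm, smul_mul_assoc, ← lam_mul, ← lam_mul, ← map_mul, ← map_mul, mul_comm]

omit [Fintype (Q →* Circle)] in
theorem charProj_mem (χ : Q →* Circle) : m.charProj ι χ ∈ m.alg.toStarSubalgebra :=
  SMulMemClass.smul_mem _ (sum_mem fun a _ => SMulMemClass.smul_mem _ (m.lam_mem (ι a)))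

omit [Fintype (Q →* Circle)] in
theorem star_charProj (χ : Q →* Circle) : star (m.charProj ι χ) = m.charProj ι χ := by
  rw [charProj, star_smul, star_sum]
  congr 1
  · simp
  · refine Fintype.sum_equiv (Equiv.inv Q) _ _ fun a => ?_
    rw [star_smul, m.star_lam, Equiv.inv_apply, inv_inv, map_inv, map_inv]
    congr 1
    rw [Circle.coe_inv_eq_conj]
    simp

omit [Fintype (Q →* Circle)] in
open scoped Classical in
theorem charProj_mul (χ ψ : Q →* Circle) :
    m.charProj ι χ * m.charProj ι ψ = if χ = ψ then m.charProj ι ψ else 0 := by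
  have h1 : m.charProj ι χ * m.charProj ι ψ = ((Fintype.card Q : ℂ)⁻¹ *
      ∑ a, ((χ⁻¹ * ψ) a : ℂ)) • m.charProj ι ψ := by
    rw [charProj, smul_mul_assoc, Finset.sum_mul, mul_smul, Finset.sum_smul]
    congr 1
    refine Finset.sum_congr rfl fun a _ => ?_
    rw [smul_mul_assoc, lam_mul_charProj, smul_smul]
    simp
  rw [h1, sum_char]
  by_cases h : χ = ψ
  · subst h
    simp
  · rw [if_neg h, if_neg (fun h' => h (inv_mul_eq_one.1 h')), mul_zero, zero_smul]

theorem sum_charProj : ∑ χ, m.charProj ι χ = 1 := by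
  classical
  simp only [charProj]
  rw [← Finset.smul_sum, Finset.sum_comm]
  simp only [← Finset.sum_smul, sum_dual_char, inv_eq_one, ite_smul, zero_smul, Finset.sum_ite_eq',
    Finset.mem_univ, if_true, map_one, m.lam_one, smul_smul, card_dual]
  rw [inv_mul_cancel₀ (by simp), one_smul]

-- On the range of `p_{χ₁} ⊗ p_{χ₂}` the operator `u_a ⊗ u_a` acts by `χ₁(a) χ₂(a)`, so character
-- orthogonality selects `χ = χ₁ χ₂`: the comultiplication is dual to multiplication of characters.
omit [Fintype (Q →* Circle)] in
open scoped Classical in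
theorem comul_charProj_mul (χ χ₁ χ₂ : Q →* Circle) :
    m.comul (m.charProj ι χ) * tens (m.charProj ι χ₁) (m.charProj ι χ₂) =
      if χ = χ₁ * χ₂ then tens (m.charProj ι χ₁) (m.charProj ι χ₂) else 0 := by
  have h1 : m.comul (m.charProj ι χ) * tens (m.charProj ι χ₁) (m.charProj ι χ₂) =
      ((Fintype.card Q : ℂ)⁻¹ * ∑ a, ((χ⁻¹ * (χ₁ * χ₂)) a : ℂ)) •
        tens (m.charProj ι χ₁) (m.charProj ι χ₂) := by
    rw [charProj, map_smul, map_sum, smul_mul_assoc, Finset.sum_mul, mul_smul, Finset.sum_smul]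
    congr 1
    refine Finset.sum_congr rfl fun a _ => ?_
    rw [map_smul, smul_mul_assoc, comul_lam, ← tens_mul, lam_mul_charProj, lam_mul_charProj,
      tens_smul_left, tens_smul_right, smul_smul, smul_smul]
    simp [mul_assoc]
  rw [h1, sum_char]
  by_cases h : χ = χ₁ * χ₂
  · subst h
    simp
  · rw [if_neg h, if_neg (fun h' => h (inv_mul_eq_one.1 h')), mul_zero, zero_smul]

/-- The operator acting by `c χ ψ` on the joint spectral subspace at `(χ, ψ)`. -/
def diag (c : (Q →* Circle) → (Q →* Circle) → ℂ) : Op (HTensor H H) :=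
  ∑ χ, ∑ ψ, c χ ψ • tens (m.charProj ι χ) (m.charProj ι ψ)

theorem diag_mul_tens (c : (Q →* Circle) → (Q →* Circle) → ℂ) (χ ψ : Q →* Circle) :
    m.diag ι c * tens (m.charProj ι χ) (m.charProj ι ψ) =
      c χ ψ • tens (m.charProj ι χ) (m.charProj ι ψ) := by
  classical
  simp only [diag, Finset.sum_mul, smul_mul_assoc, ← tens_mul, charProj_mul]
  rw [Finset.sum_eq_single χ, Finset.sum_eq_single ψ]
  · simp
  · intro ψ' _ h
    rw [if_neg h, tens_zero_right, smul_zero]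
  · simp
  · intro χ' _ h
    simp [if_neg h, tens_zero_left]
  · simp

theorem tens_mul_diag (c : (Q →* Circle) → (Q →* Circle) → ℂ) (χ ψ : Q →* Circle) :
    tens (m.charProj ι χ) (m.charProj ι ψ) * m.diag ι c =
      c χ ψ • tens (m.charProj ι χ) (m.charProj ι ψ) := by
  classical
  simp only [diag, Finset.mul_sum, mul_smul_comm, ← tens_mul, charProj_mul]
  rw [Finset.sum_eq_single χ, Finset.sum_eq_single ψ]
  · simp
  · intro ψ' _ h
    rw [if_neg h.symm, tens_zero_right, smul_zero]
  · simp
  · intro χ' _ h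
    simp [if_neg h.symm, tens_zero_left]
  · simp

/-- The projections sum to `1`, so identities between diagonal operators reduce to identities
between scalars. -/
theorem ext_charProj {S T : Op (HTensor H H)}
    (h : ∀ χ ψ, S * tens (m.charProj ι χ) (m.charProj ι ψ) =
      T * tens (m.charProj ι χ) (m.charProj ι ψ)) : S = T := by
  rw [← mul_one S, ← mul_one T, ← tens_one_one, ← m.sum_charProj ι]
  simp only [tens_sum_left, tens_sum_right, Finset.mul_sum, h]

theorem ext_charProj₃ {S T : Op (HTensor H (HTensor H H))}
    (h : ∀ χ₁ χ₂ χ₃,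
      S * tens (m.charProj ι χ₁) (tens (m.charProj ι χ₂) (m.charProj ι χ₃)) =
      T * tens (m.charProj ι χ₁) (tens (m.charProj ι χ₂) (m.charProj ι χ₃))) : S = T := by
  rw [← mul_one S, ← mul_one T, ← tens_one_one, ← tens_one_one (H := H) (K := H),
    ← m.sum_charProj ι]
  simp only [tens_sum_left, tens_sum_right, Finset.mul_sum, h]

theorem diag_mul_diag (c d : (Q →* Circle) → (Q →* Circle) → ℂ) :
    m.diag ι c * m.diag ι d = m.diag ι fun χ ψ => c χ ψ * d χ ψ :=
  m.ext_charProj ι fun χ ψ => by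
    rw [mul_assoc, diag_mul_tens, diag_mul_tens, mul_smul_comm, diag_mul_tens, smul_smul, mul_comm]

theorem diag_one : m.diag ι (fun _ _ => 1) = 1 :=
  m.ext_charProj ι fun χ ψ => by rw [diag_mul_tens, one_smul, one_mul]

theorem star_diag (c : (Q →* Circle) → (Q →* Circle) → ℂ) :
    star (m.diag ι c) = m.diag ι fun χ ψ => star (c χ ψ) := by
  simp only [diag, star_sum, star_smul, star_tens, star_charProj]

theorem diag_mem (c : (Q →* Circle) → (Q →* Circle) → ℂ) :
    m.diag ι c ∈ (vnTensor m.alg m.alg).toStarSubalgebra :=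
  sum_mem fun _ _ => sum_mem fun _ _ => SMulMemClass.smul_mem _
    (tens_mem_vnTensor (m.charProj_mem ι _) (m.charProj_mem ι _))

/-- The unitary attached to a circle-valued function of two characters. -/
def diagUnitary (ω : (Q →* Circle) → (Q →* Circle) → Circle) : unitary (Op (HTensor H H)) :=
  ⟨m.diag ι fun χ ψ => ω χ ψ, by
    rw [Unitary.mem_iff, star_diag, diag_mul_diag, diag_mul_diag]
    have h : ∀ z : Circle, star (z : ℂ) * z = 1 := fun z => by
      rw [← starRingEnd_apply, ← Circle.coe_inv_eq_conj, ← Circle.coe_mul, inv_mul_cancel,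
        Circle.coe_one]
    simp only [h, mul_comm _ (star _), diag_one, and_self]⟩

theorem coe_diagUnitary (ω : (Q →* Circle) → (Q →* Circle) → Circle) :
    (m.diagUnitary ι ω : Op (HTensor H H)) = m.diag ι fun χ ψ => ω χ ψ := rfl

theorem comulLeft_diag_mul (c : (Q →* Circle) → (Q →* Circle) → ℂ) (χ₁ χ₂ χ₃ : Q →* Circle) :
    comulLeft m.basis m.W (m.diag ι c) *
        tens (tens (m.charProj ι χ₁) (m.charProj ι χ₂)) (m.charProj ι χ₃) =
      c (χ₁ * χ₂) χ₃ • tens (tens (m.charProj ι χ₁) (m.charProj ι χ₂)) (m.charProj ι χ₃) := by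
  classical
  simp only [diag, map_sum, map_smul, comulLeft_tens, ← comul_apply, Finset.sum_mul,
    smul_mul_assoc, ← tens_mul, comul_charProj_mul, charProj_mul]
  rw [Finset.sum_eq_single (χ₁ * χ₂), Finset.sum_eq_single χ₃]
  · simp
  · intro ψ' _ h
    rw [if_neg h, tens_zero_right, smul_zero]
  · simp
  · intro χ' _ h
    simp [if_neg h, tens_zero_left]
  · simp

theorem comulRight_diag_mul (c : (Q →* Circle) → (Q →* Circle) → ℂ) (χ₁ χ₂ χ₃ : Q →* Circle) :
    comulRight m.basis m.W (m.diag ι c) *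
        tens (m.charProj ι χ₁) (tens (m.charProj ι χ₂) (m.charProj ι χ₃)) =
      c χ₁ (χ₂ * χ₃) • tens (m.charProj ι χ₁) (tens (m.charProj ι χ₂) (m.charProj ι χ₃)) := by
  classical
  simp only [diag, map_sum, map_smul, comulRight_tens, ← comul_apply, Finset.sum_mul,
    smul_mul_assoc, ← tens_mul, comul_charProj_mul, charProj_mul]
  rw [Finset.sum_eq_single χ₁, Finset.sum_eq_single (χ₂ * χ₃)]
  · simp
  · intro ψ' _ h
    rw [if_neg h, tens_zero_right, smul_zero]
  · simp
  · intro χ' _ h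
    simp [if_neg h, tens_zero_left]
  · simp

theorem tens_diag_one_mul (c : (Q →* Circle) → (Q →* Circle) → ℂ) (χ₁ χ₂ χ₃ : Q →* Circle) :
    tens (m.diag ι c) (1 : Op H) *
        tens (tens (m.charProj ι χ₁) (m.charProj ι χ₂)) (m.charProj ι χ₃) =
      c χ₁ χ₂ • tens (tens (m.charProj ι χ₁) (m.charProj ι χ₂)) (m.charProj ι χ₃) := by
  rw [← tens_mul, diag_mul_tens, tens_smul_left, one_mul]

theorem tens_one_diag_mul (c : (Q →* Circle) → (Q →* Circle) → ℂ) (χ₁ χ₂ χ₃ : Q →* Circle) :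
    tens (1 : Op H) (m.diag ι c) *
        tens (m.charProj ι χ₁) (tens (m.charProj ι χ₂) (m.charProj ι χ₃)) =
      c χ₂ χ₃ • tens (m.charProj ι χ₁) (tens (m.charProj ι χ₂) (m.charProj ι χ₃)) := by
  rw [← tens_mul, diag_mul_tens, tens_smul_right, one_mul]

end RegularModel

/-! ### The cocycle unitary and invariance of the trace under its twist. -/

section Eigen

variable {A B : Type*} [Ring A] [Algebra ℂ A] [StarRing A] [Ring B] [Algebra ℂ B] [StarRing B]

theorem mul_mul_eq_smul {x y p : A} {a b : ℂ} (hx : x * p = a • p) (hy : y * p = b • p) :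
    x * y * p = (b * a) • p := by
  rw [mul_assoc, hy, mul_smul_comm, hx, smul_smul]

theorem map_mul_eq_smul (D : A →⋆ₐ[ℂ] B) {x p : A} {a : ℂ} (hx : x * p = a • p) :
    D x * D p = a • D p := by
  rw [← map_mul, hx, map_smul]

end Eigen

namespace RegularModel

variable {G : Type*} [Group G] {H : Type*} [NormedAddCommGroup H] [InnerProductSpace ℂ H]
  [CompleteSpace H] (m : RegularModel G H)
  {Q : Type*} [CommGroup Q] [Fintype Q] [Fintype (Q →* Circle)] (ι : Q →* G)

/-- On each triple spectral projection both sides are scalars, and their equality is exactly the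
2-cocycle identity for `ω`. -/
theorem isDualCocycle_diagUnitary {ω : (Q →* Circle) → (Q →* Circle) → Circle}
    (hω : ∀ χ₁ χ₂ χ₃, ω (χ₁ * χ₂) χ₃ * ω χ₁ χ₂ = ω χ₂ χ₃ * ω χ₁ (χ₂ * χ₃)) :
    m.IsDualCocycle (m.diagUnitary ι ω) where
  mem := m.diag_mem ι _
  cocycle := by
    refine m.ext_charProj₃ ι fun χ₁ χ₂ χ₃ => ?_
    have h1 := map_mul_eq_smul (assocHom m.basis) (mul_mul_eq_smul
      (m.tens_diag_one_mul ι (fun χ ψ => (ω χ ψ : ℂ)) χ₁ χ₂ χ₃)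
      (m.comulLeft_diag_mul ι (fun χ ψ => (ω χ ψ : ℂ)) χ₁ χ₂ χ₃))
    have h2 := mul_mul_eq_smul
      (m.tens_one_diag_mul ι (fun χ ψ => (ω χ ψ : ℂ)) χ₁ χ₂ χ₃)
      (m.comulRight_diag_mul ι (fun χ ψ => (ω χ ψ : ℂ)) χ₁ χ₂ χ₃)
    rw [assocHom_tens] at h1
    have h3 : (ω (χ₁ * χ₂) χ₃ : ℂ) * ω χ₁ χ₂ = ω χ₁ (χ₂ * χ₃) * ω χ₂ χ₃ := by
      rw [← Circle.coe_mul, ← Circle.coe_mul, hω, mul_comm]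
    rw [h3] at h1
    exact h1.trans h2.symm

theorem lam_range_commute_diag (a : Q) (c : (Q →* Circle) → (Q →* Circle) → ℂ) :
    Commute (tens (m.lam (ι a)) (m.lam (ι a))) (m.diag ι c) := by
  rw [commute_iff_eq, diag]
  simp only [Finset.mul_sum, Finset.sum_mul, mul_smul_comm, smul_mul_assoc, ← tens_mul,
    (m.commute_lam_charProj ι a _).eq]

theorem diag_mul_tens_mul_diag (c d : (Q →* Circle) → (Q →* Circle) → ℂ) (x y : Op H) :
    m.diag ι c * tens x y * m.diag ι d = ∑ χ', ∑ ψ', d χ' ψ' • ∑ χ, ∑ ψ, c χ ψ •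
      tens (m.charProj ι χ * x * m.charProj ι χ') (m.charProj ι ψ * y * m.charProj ι ψ') := by
  simp only [diag, Finset.mul_sum, Finset.sum_mul, mul_smul_comm, smul_mul_assoc, tens_mul]

theorem adHom_diag (ω : (Q →* Circle) → (Q →* Circle) → Circle) (x y : Op H) :
    adHom (m.diagUnitary ι ω) (tens x y) = ∑ χ', ∑ ψ',
      star (ω χ' ψ' : ℂ) • ∑ χ, ∑ ψ, (ω χ ψ : ℂ) •
        tens (m.charProj ι χ * x * m.charProj ι χ') (m.charProj ι ψ * y * m.charProj ι ψ') := by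
  rw [adHom_apply, coe_diagUnitary, star_diag, diag_mul_tens_mul_diag]

/-- The operator is a combination of translations by `a g b` with `a`, `b` in the subgroup, none of
which is the identity. -/
theorem trace_charProj_mul {g : G} (hg : g ∉ Set.range ι) (χ ψ : Q →* Circle) :
    m.trace (m.charProj ι χ * m.lam g * m.charProj ι ψ) = 0 := by
  classical
  have h : ∀ a b, m.trace (m.lam (ι a) * m.lam g * m.lam (ι b)) = 0 := fun a b => by
    rw [← lam_mul, ← lam_mul, trace_lam, if_neg]
    intro h
    refine hg ⟨a⁻¹ * b⁻¹, ?_⟩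
    rw [map_mul, map_inv, map_inv, ← mul_right_inj (ι a), ← mul_left_inj (ι b), h]
    group
  change m.trace _ = 0
  have ha : ∀ x, m.trace x = innerSL ℂ (m.basis 1) (x (m.basis 1)) := fun x => rfl
  simp only [charProj, Finset.mul_sum, Finset.sum_mul, smul_mul_assoc, mul_smul_comm, ha, map_sum,
    sum_apply, smul_apply, map_smul]
  simp only [← ha, h, smul_zero, Finset.sum_const_zero]

theorem adHom_diag_lam_range (ω : (Q →* Circle) → (Q →* Circle) → Circle) (a : Q) :
    adHom (m.diagUnitary ι ω) (tens (m.lam (ι a)) (m.lam (ι a))) =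
      tens (m.lam (ι a)) (m.lam (ι a)) := by
  rw [adHom_apply, coe_diagUnitary, ← (m.lam_range_commute_diag ι a _).eq, mul_assoc,
    ← coe_diagUnitary, Unitary.mul_star_self_of_mem (m.diagUnitary ι ω).2, mul_one]

theorem inner_basis_one_apply (x : Op H) :
    inner ℂ (m.basis 1) (x (m.basis 1)) = m.trace x := rfl

theorem trace_smul_lam (g : G) : m.trace (m.lam g) • m.lam g = m.trace (m.lam g) • 1 := by
  classical
  rw [trace_lam]
  split_ifs with h
  · rw [h, lam_one]
  · rw [zero_smul, zero_smul]

theorem trace_lam_of_not_mem_range {g : G} (hg : g ∉ Set.range ι) : m.trace (m.lam g) = 0 := by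
  classical
  rw [trace_lam, if_neg]
  rintro rfl
  exact hg ⟨1, map_one ι⟩

/-- Inside the abelian subgroup, `u_g ⊗ u_g` commutes with the cocycle unitary and is unchanged.
Outside it, every term of the expanded conjugate has a leg `p_χ u_g p_ψ` of trace zero. -/
theorem rightSlice_adHom_diag (ω : (Q →* Circle) → (Q →* Circle) → Circle) (g : G) :
    rightSlice (m.basis 1) (adHom (m.diagUnitary ι ω) (tens (m.lam g) (m.lam g))) =
      m.trace (m.lam g) • 1 := by
  by_cases hg : g ∈ Set.range ι
  · obtain ⟨a, rfl⟩ := hg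
    rw [adHom_diag_lam_range, rightSlice_tens, inner_basis_one_apply, trace_smul_lam]
  · simp only [adHom_diag, map_sum, map_smul, rightSlice_tens, inner_basis_one_apply,
      trace_charProj_mul m ι hg, trace_lam_of_not_mem_range m ι hg, zero_smul, smul_zero,
      Finset.sum_const_zero]

theorem leftSlice_adHom_diag (ω : (Q →* Circle) → (Q →* Circle) → Circle) (g : G) :
    leftSlice (m.basis 1) (adHom (m.diagUnitary ι ω) (tens (m.lam g) (m.lam g))) =
      m.trace (m.lam g) • 1 := by
  by_cases hg : g ∈ Set.range ι
  · obtain ⟨a, rfl⟩ := hg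
    rw [adHom_diag_lam_range, leftSlice_tens, inner_basis_one_apply, trace_smul_lam]
  · simp only [adHom_diag, map_sum, map_smul, leftSlice_tens, inner_basis_one_apply,
      trace_charProj_mul m ι hg, trace_lam_of_not_mem_range m ι hg, zero_smul, smul_zero,
      Finset.sum_const_zero]

section Twist

variable {ω : (Q →* Circle) → (Q →* Circle) → Circle}
  (hω : ∀ χ₁ χ₂ χ₃, ω (χ₁ * χ₂) χ₃ * ω χ₁ χ₂ = ω χ₂ χ₃ * ω χ₁ (χ₂ * χ₃))
include hω

theorem isKacType_twist_diagUnitary : IsKacType (twist (m.isDualCocycle_diagUnitary ι hω)) :=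
  isKacType_twist _ (m.rightSlice_adHom_diag ι ω) (m.leftSlice_adHom_diag ι ω)

/-- The cocycle unitary is a finite sum of elementary tensors, so conjugating `u_g ⊗ u_g` stays in
the algebraic tensor product, as `flip_of_qgIsomorphic'` requires. -/
theorem twist_lam_mem_range (g : G) :
    twist (m.isDualCocycle_diagUnitary ι hω) ⟨m.lam g, m.lam_mem g⟩ ∈
      LinearMap.range (algTensor m.alg) := by
  have hmem : ∀ χ ψ, m.charProj ι χ * m.lam g * m.charProj ι ψ ∈ m.alg.toStarSubalgebra :=
    fun χ ψ => mul_mem (mul_mem (m.charProj_mem ι χ) (m.lam_mem g)) (m.charProj_mem ι ψ)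
  have h : twist (m.isDualCocycle_diagUnitary ι hω) ⟨m.lam g, m.lam_mem g⟩ =
      ∑ χ', ∑ ψ', star (ω χ' ψ' : ℂ) • ∑ χ, ∑ ψ, (ω χ ψ : ℂ) •
        (tmul ⟨_, hmem χ χ'⟩ ⟨_, hmem ψ ψ'⟩ : Elem (vnTensor m.alg m.alg)) := by
    refine Subtype.ext ?_
    rw [coe_twist, comul_lam, adHom_diag]
    have hs : ∀ (c : ℂ) (z : Elem (vnTensor m.alg m.alg)),
        ((c • z : Elem (vnTensor m.alg m.alg)) : Op (HTensor H H)) = c • (z : Op (HTensor H H)) :=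
      fun _ _ => rfl
    simp only [AddSubmonoidClass.coe_finsetSum, hs]
    rfl
  rw [h]
  exact sum_mem fun _ _ => sum_mem fun _ _ => Submodule.smul_mem _ _ (sum_mem fun _ _ =>
    sum_mem fun _ _ => Submodule.smul_mem _ _ ⟨_ ⊗ₜ _, algTensor_tmul m.alg _ _⟩)

end Twist

end RegularModel

/-! ### The icc condition forces the cocycle to be symmetric. -/

namespace RegularModel

variable {G : Type*} [Group G] {H : Type*} [NormedAddCommGroup H] [InnerProductSpace ℂ H]
  [CompleteSpace H] (m : RegularModel G H)

/-- Conjugation by `g` on the tensor square of the canonical Hilbert space. -/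
def conjTensor (g : G) : Op (HTensor H H) :=
  tens (m.lam g * m.rho g⁻¹) (m.lam g * m.rho g⁻¹)

theorem inner_conjTensor (g x y : G) (v : HTensor H H) :
    inner ℂ (vecTensor (m.basis (g * x * g⁻¹)) (m.basis (g * y * g⁻¹))) (m.conjTensor g v) =
      inner ℂ (vecTensor (m.basis x) (m.basis y)) v := by
  have h : ∀ x, m.basis (g * x * g⁻¹) = m.lam g (m.rho g⁻¹ (m.basis x)) := fun x => by
    rw [m.rho_basis, m.lam_basis, mul_assoc]
  have h1 : (innerSL ℂ (vecTensor (m.basis (g * x * g⁻¹)) (m.basis (g * y * g⁻¹)))).comp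
      (m.conjTensor g) = innerSL ℂ (vecTensor (m.basis x) (m.basis y)) := by
    refine ext_vecTensor fun p q => ?_
    rw [ContinuousLinearMap.comp_apply, conjTensor, tens_vecTensor, innerSL_apply_apply,
      innerSL_apply_apply, inner_vecTensor, inner_vecTensor, h, h, mul_apply_eq_comp,
      mul_apply_eq_comp, m.inner_lam, m.inner_lam, m.inner_rho, m.inner_rho]
  exact DFunLike.congr_fun h1 v

theorem conjTensor_basis_one (g : G) :
    m.conjTensor g (vecTensor (m.basis 1) (m.basis 1)) = vecTensor (m.basis 1) (m.basis 1) := by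
  rw [conjTensor, tens_vecTensor, mul_apply_eq_comp, m.rho_basis, m.lam_basis, one_mul,
    mul_inv_cancel]

theorem ext_inner_basis {v w : HTensor H H}
    (h : ∀ x y, inner ℂ (vecTensor (m.basis x) (m.basis y)) v =
      inner ℂ (vecTensor (m.basis x) (m.basis y)) w) : v = w := by
  refine (basisTensor m.basis m.basis).repr.injective (lp.ext (funext fun p => ?_))
  rw [HilbertBasis.repr_apply_apply, HilbertBasis.repr_apply_apply, ← Prod.mk.eta (p := p),
    basisTensor_apply]
  exact h p.1 p.2

variable {Q : Type*} [CommGroup Q] [Fintype Q] [Fintype (Q →* Circle)] (ι : Q →* G)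

theorem conjHom_flipU_diag (c : (Q →* Circle) → (Q →* Circle) → ℂ) :
    conjHom (flipU m.basis m.basis) (m.diag ι c) = m.diag ι fun χ ψ => c ψ χ := by
  simp only [diag, map_sum, map_smul, conjHom_flipU]
  exact Finset.sum_comm

/-- The right translations contained in `conjTensor` commute with L(G), so only the left ones impose
a condition. -/
theorem commute_conjTensor_diag {c : (Q →* Circle) → (Q →* Circle) → ℂ} {g : G}
    (h : Commute (tens (m.lam g) (m.lam g)) (m.diag ι c)) :
    Commute (m.conjTensor g) (m.diag ι c) := by
  rw [conjTensor, tens_mul]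
  refine h.mul_left ?_
  rw [commute_iff_eq, diag]
  simp only [Finset.mul_sum, Finset.sum_mul, mul_smul_comm, smul_mul_assoc, ← tens_mul,
    m.rho_commute (m.charProj_mem ι _)]

omit [Fintype (Q →* Circle)] in
theorem inner_charProj_basis {x : G} (hx : x ∉ Set.range ι) (χ : Q →* Circle) :
    inner ℂ (m.basis x) (m.charProj ι χ (m.basis 1)) = 0 := by
  classical
  have h : ∀ a, innerSL ℂ (m.basis x) (m.lam (ι a) (m.basis 1)) = 0 := fun a => by
    rw [m.lam_basis, mul_one, innerSL_apply_apply, m.inner_basis, if_neg]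
    exact fun h => hx ⟨a, h.symm⟩
  rw [← innerSL_apply_apply]
  simp only [charProj, smul_apply, sum_apply, map_smul,
    map_sum, h, smul_zero, Finset.sum_const_zero]

theorem inner_diag_basis {x y : G} (h : x ∉ Set.range ι ∨ y ∉ Set.range ι)
    (c : (Q →* Circle) → (Q →* Circle) → ℂ) :
    inner ℂ (vecTensor (m.basis x) (m.basis y))
      (m.diag ι c (vecTensor (m.basis 1) (m.basis 1))) = 0 := by
  have h1 : ∀ χ ψ, innerSL ℂ (vecTensor (m.basis x) (m.basis y))
      (tens (m.charProj ι χ) (m.charProj ι ψ) (vecTensor (m.basis 1) (m.basis 1))) = 0 :=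
    fun χ ψ => by
      rw [tens_vecTensor, innerSL_apply_apply, inner_vecTensor]
      rcases h with h | h
      · rw [m.inner_charProj_basis ι h, zero_mul]
      · rw [m.inner_charProj_basis ι h, mul_zero]
  rw [← innerSL_apply_apply]
  simp only [diag, smul_apply, sum_apply, map_smul,
    map_sum, h1, smul_zero, Finset.sum_const_zero]

omit [Fintype (Q →* Circle)] in
theorem charProj_basis_ne_zero (hι : Function.Injective ι) (χ : Q →* Circle) :
    m.charProj ι χ (m.basis 1) ≠ 0 := by
  classical
  intro h
  have h2 : m.trace (m.charProj ι χ) = (Fintype.card Q : ℂ)⁻¹ := by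
    have ha : ∀ x, m.trace x = innerSL ℂ (m.basis 1) (x (m.basis 1)) := fun x => rfl
    simp only [charProj, ha, smul_apply, sum_apply,
      map_smul, map_sum]
    simp only [← ha, trace_lam, map_eq_one_iff ι hι, smul_eq_mul, mul_ite, mul_one, mul_zero,
      Finset.sum_ite_eq', Finset.mem_univ, if_true, inv_one, map_one, Circle.coe_one]
  rw [trace, h, inner_zero_right] at h2
  exact inv_ne_zero (by simp) h2.symm

/-- The vector `v`, the image of `δ_1 ⊗ δ_1`, is invariant under simultaneous conjugation and
supported on a finite set. Any nontrivial coordinate can be conjugated out of that set, so `v` is a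
multiple of `δ_1 ⊗ δ_1`; the nonzero vectors `p_χ δ_1 ⊗ p_ψ δ_1` then read off `c χ ψ`. -/
theorem diag_const (hG : IsICC G) (hι : Function.Injective ι)
    {c : (Q →* Circle) → (Q →* Circle) → ℂ}
    (hc : ∀ g, Commute (tens (m.lam g) (m.lam g)) (m.diag ι c)) :
    ∃ z : ℂ, ∀ χ ψ, c χ ψ = z := by
  set v := m.diag ι c (vecTensor (m.basis 1) (m.basis 1)) with hv
  have hinv : ∀ g, m.conjTensor g v = v := fun g => by
    have h1 := DFunLike.congr_fun (m.commute_conjTensor_diag ι (hc g)).eq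
      (vecTensor (m.basis 1) (m.basis 1))
    rw [mul_apply_eq_comp, mul_apply_eq_comp, conjTensor_basis_one] at h1
    exact h1
  have hfin : (Set.range ι).Finite := Set.finite_range ι
  have hconj : ∀ x : G, x ≠ 1 → ∃ g : G, g * x * g⁻¹ ∉ Set.range ι := fun x hx => by
    by_contra! h
    refine (hG.2 x hx) (hfin.subset ?_)
    intro y hy
    obtain ⟨g, rfl⟩ := isConj_iff.1 hy
    exact h g
  have hz : ∀ x y, (x ≠ 1 ∨ y ≠ 1) →
      inner ℂ (vecTensor (m.basis x) (m.basis y)) v = 0 := fun x y h => by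
    rcases h with h | h
    · obtain ⟨g, hg⟩ := hconj x h
      rw [← m.inner_conjTensor g, hinv]
      exact m.inner_diag_basis ι (Or.inl hg) c
    · obtain ⟨g, hg⟩ := hconj y h
      rw [← m.inner_conjTensor g, hinv]
      exact m.inner_diag_basis ι (Or.inr hg) c
  obtain ⟨z, hvz⟩ : ∃ z : ℂ, v = z • vecTensor (m.basis 1) (m.basis 1) := by
    classical
    refine ⟨inner ℂ (vecTensor (m.basis 1) (m.basis 1)) v, m.ext_inner_basis fun x y => ?_⟩
    rw [inner_smul_right, inner_vecTensor, m.inner_basis, m.inner_basis]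
    by_cases hx : x = 1
    · by_cases hy : y = 1
      · subst hx hy
        simp
      · rw [hz x y (Or.inr hy), if_neg hy, mul_zero, mul_zero]
    · rw [hz x y (Or.inl hx), if_neg hx, zero_mul, mul_zero]
  refine ⟨z, fun χ ψ => ?_⟩
  have h1 := DFunLike.congr_fun (m.tens_mul_diag ι c χ ψ) (vecTensor (m.basis 1) (m.basis 1))
  rw [mul_apply_eq_comp, ← hv, hvz, map_smul, smul_apply,
    tens_vecTensor] at h1
  refine (smul_left_injective ℂ ?_ h1).symm
  rw [← norm_ne_zero_iff, norm_vecTensor]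
  exact mul_ne_zero (norm_ne_zero_iff.2 (m.charProj_basis_ne_zero ι hι χ))
    (norm_ne_zero_iff.2 (m.charProj_basis_ne_zero ι hι ψ))

theorem symmetric_of_flip (hG : IsICC G) (hι : Function.Injective ι)
    {ω : (Q →* Circle) → (Q →* Circle) → Circle}
    (h : ∀ g, conjHom (flipU m.basis m.basis)
      (adHom (m.diagUnitary ι ω) (tens (m.lam g) (m.lam g))) =
        adHom (m.diagUnitary ι ω) (tens (m.lam g) (m.lam g))) (χ ψ : Q →* Circle) :
    ω χ ψ = ω ψ χ := by
  have hc : ∀ g, Commute (tens (m.lam g) (m.lam g))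
      (m.diag ι fun χ ψ => star (ω ψ χ : ℂ) * (ω χ ψ : ℂ)) := fun g => by
    have hU : ∀ U : unitary (Op (HTensor H H)),
        (star (U : Op (HTensor H H))) * (U : Op (HTensor H H)) = 1 := fun U =>
      Unitary.star_mul_self_of_mem U.2
    have h1 := h g
    rw [adHom_apply, coe_diagUnitary, map_mul, map_mul, conjHom_flipU_diag, conjHom_flipU,
      star_diag, conjHom_flipU_diag] at h1
    have h2 : (m.diag ι fun χ ψ => star (ω ψ χ : ℂ)) * (m.diag ι fun χ ψ => (ω ψ χ : ℂ)) = 1 := by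
      have := hU (m.diagUnitary ι fun χ ψ => ω ψ χ)
      rwa [coe_diagUnitary, star_diag] at this
    have h3 : (m.diag ι fun χ ψ => star (ω χ ψ : ℂ)) * (m.diag ι fun χ ψ => (ω χ ψ : ℂ)) = 1 := by
      have := hU (m.diagUnitary ι ω)
      rwa [coe_diagUnitary, star_diag] at this
    rw [← diag_mul_diag, commute_iff_eq]
    generalize (tens (m.lam g) (m.lam g) : Op (HTensor H H)) = t at *
    generalize (m.diag ι fun χ ψ => star (ω χ ψ : ℂ)) = a at *
    generalize (m.diag ι fun χ ψ => (ω χ ψ : ℂ)) = a' at *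
    generalize (m.diag ι fun χ ψ => star (ω ψ χ : ℂ)) = b at *
    generalize (m.diag ι fun χ ψ => (ω ψ χ : ℂ)) = b' at *
    -- With `a' = Ω`, `a = Ω*`, `b' = Ω₂₁`, `b = Ω₂₁*`, flip invariance `b' t b = a' t a` says that
    -- `Ω₂₁* Ω` commutes with `t`.
    calc t * (b * a') = (b * b') * t * b * a' := by rw [h2, one_mul, mul_assoc]
      _ = b * (b' * t * b) * a' := by simp only [mul_assoc]
      _ = b * (a' * t * a) * a' := by rw [h1]
      _ = b * a' * t * (a * a') := by simp only [mul_assoc]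
      _ = b * a' * t := by rw [h3, mul_one]
  obtain ⟨z, hz⟩ := m.diag_const ι hG hι hc
  have hs : ∀ w : Circle, star (w : ℂ) = ((w⁻¹ : Circle) : ℂ) := fun w => by
    rw [Circle.coe_inv_eq_conj, starRingEnd_apply]
  -- At the pair `(1, 1)` the function is `ω(1,1)⁻¹ ω(1,1) = 1`, which fixes the constant.
  have h1 := hz 1 1
  have h2 := hz χ ψ
  rw [← h1, hs, hs, ← Circle.coe_mul, ← Circle.coe_mul, inv_mul_cancel] at h2
  exact (inv_mul_eq_one.1 (Circle.ext h2)).symm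

/-- A twist of an icc group by a non-symmetric cocycle is not isomorphic to the original
quantum group, in either direction. -/
theorem not_qgIsomorphic_twist (hG : IsICC G) (hι : Function.Injective ι)
    {ω : (Q →* Circle) → (Q →* Circle) → Circle}
    (hω : ∀ χ₁ χ₂ χ₃, ω (χ₁ * χ₂) χ₃ * ω χ₁ χ₂ = ω χ₂ χ₃ * ω χ₁ (χ₂ * χ₃))
    {χ ψ : Q →* Circle} (hne : ω χ ψ ≠ ω ψ χ)
    {Δ : Elem m.alg →⋆ₐ[ℂ] Elem (vnTensor m.alg m.alg)}
    (hΔ : ∀ x, (Δ x : Op (HTensor H H)) = m.comul x) :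
    ¬ QGIsomorphic Δ (twist (m.isDualCocycle_diagUnitary ι hω)) ∧
      ¬ QGIsomorphic (twist (m.isDualCocycle_diagUnitary ι hω)) Δ := by
  have hcoe : ∀ g, (twist (m.isDualCocycle_diagUnitary ι hω) ⟨m.lam g, m.lam_mem g⟩ :
      Op (HTensor H H)) = adHom (m.diagUnitary ι ω) (tens (m.lam g) (m.lam g)) := fun g => by
    rw [coe_twist, comul_lam]
  constructor
  · intro h
    refine hne (m.symmetric_of_flip ι hG hι (fun g => ?_) χ ψ)
    rw [← hcoe]
    exact flip_of_qgIsomorphic hΔ h _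
  · intro h
    refine hne (m.symmetric_of_flip ι hG hι (fun g => ?_) χ ψ)
    rw [← hcoe]
    exact flip_of_qgIsomorphic' hΔ h (m.twist_lam_mem_range ι hω g)

end RegularModel

/-! ### The concrete regular representation and its twists. -/

section Regular

variable (G : Type u) [Group G]

/-- The regular representations on `ℓ²(G)`. -/
def regularModel : RegularModel G (ell2 G) where
  basis := delta G
  lam := leftReg G
  rho g := ((permUnitary (delta G) (Equiv.mulRight g) : ell2 G ≃ₗᵢ[ℂ] ell2 G) :
    ell2 G →L[ℂ] ell2 G)
  alg := groupVN G
  W := toUnitary (shearU G)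
  lam_basis := leftReg_delta G
  rho_basis g h := permUnitary_apply _ _ _
  inner_lam g v w := (permUnitary (delta G) (Equiv.mulLeft g)).inner_map_map v w
  inner_rho g v w := (permUnitary (delta G) (Equiv.mulRight g)).inner_map_map v w
  star_lam := star_leftReg G
  mem_alg x := mem_generated_iff_of_star (by
    rintro _ ⟨g, rfl⟩
    exact ⟨g⁻¹, (star_leftReg G g).symm⟩)
  adHom_W g := by
    rw [← conjHom_eq_adHom]
    exact shearU_conj_leftReg G g

theorem coe_groupComul (x : Elem (groupVN G)) :
    (groupComul G x : Op (HTensor (ell2 G) (ell2 G))) = (regularModel G).comul x := by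
  refine Eq.trans ?_ (conjHom_eq_adHom (shearU G) (tens 1 (x : Op (ell2 G))))
  rfl

variable {G}

/-- An icc group with a finite abelian subgroup carrying a non-symmetric 2-cocycle on its dual
has a Kac type twist which is not isomorphic to it. -/
theorem exists_twist (hG : IsICC G) {Q : Type*} [CommGroup Q] [Finite Q] (ι : Q →* G)
    (hι : Function.Injective ι) (ω : (Q →* Circle) → (Q →* Circle) → Circle)
    (hω : ∀ χ₁ χ₂ χ₃, ω (χ₁ * χ₂) χ₃ * ω χ₁ χ₂ = ω χ₂ χ₃ * ω χ₁ (χ₂ * χ₃))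
    {χ ψ : Q →* Circle} (hne : ω χ ψ ≠ ω ψ χ) :
    ∃ Δ : Elem (groupVN G) →⋆ₐ[ℂ] Elem (vnTensor (groupVN G) (groupVN G)),
      IsKacType Δ ∧ ¬ QGIsomorphic (groupComul G) Δ ∧ ¬ QGIsomorphic Δ (groupComul G) := by
  have := Fintype.ofFinite Q
  have := finite_dual Q
  have := Fintype.ofFinite (Q →* Circle)
  have h := (regularModel G).not_qgIsomorphic_twist ι hG hι hω hne (coe_groupComul G)
  exact ⟨_, (regularModel G).isKacType_twist_diagUnitary ι hω, h.1, h.2⟩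

theorem not_superrigid_of_twist
    {Δ : Elem (groupVN G) →⋆ₐ[ℂ] Elem (vnTensor (groupVN G) (groupVN G))}
    (hΔ : IsKacType Δ) (h : ¬ QGIsomorphic (groupComul G) Δ) : ¬ IsQuantumWStarSuperrigidGroup G :=
  fun hs => h (hs (ell2 G) (groupVN G) Δ hΔ.1 ⟨StarAlgEquiv.refl ℂ _⟩)

end Regular

/-! ### Symmetric cocycles are coboundaries. -/

section Cohomology

/-- The underlying set of the extension of `K` by `A` defined by a 2-cocycle. -/
@[ext]
structure CocycleExtension {K A : Type*} (f : K → K → A) where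
  /-- The coordinate in the kernel. -/
  fiber : A
  /-- The coordinate in the quotient. -/
  base : K

/-- The abelian extension defined by a symmetric 2-cocycle. -/
abbrev CocycleExtension.addCommGroup {K A : Type*} [AddCommGroup K] [AddCommGroup A]
    (f : K → K → A) (hf : ∀ k l p, f (k + l) p + f k l = f l p + f k (l + p))
    (hs : ∀ k l, f k l = f l k) : AddCommGroup (CocycleExtension f) :=
  have h0 : ∀ k, f 0 k = f 0 0 := fun k => by simpa using (hf 0 0 k).symm
  { add := fun x y => ⟨x.fiber + y.fiber + f x.base y.base, x.base + y.base⟩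
    -- The cocycle is not assumed normalised, so the neutral element carries the correction `-f 0
    -- 0`; the embedding of the kernel is shifted in the same way.
    zero := ⟨-f 0 0, 0⟩
    neg := fun x => ⟨-x.fiber - f x.base (-x.base) - f 0 0, -x.base⟩
    nsmul := @nsmulRec _ ⟨⟨-f 0 0, 0⟩⟩
      ⟨fun x y => ⟨x.fiber + y.fiber + f x.base y.base, x.base + y.base⟩⟩
    zsmul := @zsmulRec _ ⟨⟨-f 0 0, 0⟩⟩
      ⟨fun x y => ⟨x.fiber + y.fiber + f x.base y.base, x.base + y.base⟩⟩
      ⟨fun x => ⟨-x.fiber - f x.base (-x.base) - f 0 0, -x.base⟩⟩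
      (@nsmulRec _ ⟨⟨-f 0 0, 0⟩⟩
        ⟨fun x y => ⟨x.fiber + y.fiber + f x.base y.base, x.base + y.base⟩⟩)
    add_assoc := fun x y z => CocycleExtension.ext (by
      change x.fiber + y.fiber + f x.base y.base + z.fiber + f (x.base + y.base) z.base =
        x.fiber + (y.fiber + z.fiber + f y.base z.base) + f x.base (y.base + z.base)
      have := hf x.base y.base z.base
      calc _ = x.fiber + y.fiber + z.fiber +
            (f (x.base + y.base) z.base + f x.base y.base) := by abel
        _ = _ := by rw [this]; abel) (add_assoc _ _ _)
    zero_add := fun x => CocycleExtension.ext (by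
      change -f 0 0 + x.fiber + f 0 x.base = x.fiber
      rw [h0 x.base]; abel) (zero_add _)
    add_zero := fun x => CocycleExtension.ext (by
      change x.fiber + -f 0 0 + f x.base 0 = x.fiber
      rw [hs x.base, h0 x.base]; abel) (add_zero _)
    neg_add_cancel := fun x => CocycleExtension.ext (by
      change -x.fiber - f x.base (-x.base) - f 0 0 + x.fiber + f (-x.base) x.base = -f 0 0
      rw [hs (-x.base)]; abel) (neg_add_cancel _)
    add_comm := fun x y => CocycleExtension.ext (by
      change x.fiber + y.fiber + f x.base y.base = y.fiber + x.fiber + f y.base x.base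
      rw [hs, add_comm x.fiber]) (add_comm _ _) }

/-- A symmetric 2-cocycle with values in a divisible group is a coboundary. -/
theorem exists_coboundary {K A : Type*} [AddCommGroup K] [AddCommGroup A] [DivisibleBy A ℤ]
    (f : K → K → A) (hf : ∀ k l p, f (k + l) p + f k l = f l p + f k (l + p))
    (hs : ∀ k l, f k l = f l k) : ∃ h : K → A, ∀ k l, f k l = h k + h l - h (k + l) := by
  have h0 : ∀ k, f 0 k = f 0 0 := fun k => by simpa using (hf 0 0 k).symm
  let _ := CocycleExtension.addCommGroup f hf hs
  have hadd : ∀ x y : CocycleExtension f,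
      x + y = ⟨x.fiber + y.fiber + f x.base y.base, x.base + y.base⟩ := fun _ _ => rfl
  let i : A →+ CocycleExtension f :=
    { toFun := fun a => ⟨a - f 0 0, 0⟩
      map_zero' := CocycleExtension.ext (zero_sub _) rfl
      map_add' := fun a b => by
        rw [hadd]
        refine CocycleExtension.ext ?_ (add_zero 0).symm
        change a + b - f 0 0 = a - f 0 0 + (b - f 0 0) + f 0 0
        abel }
  have hi : Function.Injective i := fun a b h =>
    sub_left_injective (congrArg CocycleExtension.fiber h)
  -- Divisible groups are injective, so the extension has a retraction `r` onto its kernel. The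
  -- cochain is `r` evaluated on the section `k ↦ (0, k)`, whose failure to be additive is `f`.
  obtain ⟨r, hr⟩ := (Module.Baer.of_divisible A).extension_property_addMonoidHom i hi
    (AddMonoidHom.id A)
  refine ⟨fun k => r ⟨0, k⟩, fun k l => ?_⟩
  have h1 : (⟨0, k⟩ + ⟨0, l⟩ : CocycleExtension f) = i (f k l) + ⟨0, k + l⟩ := by
    rw [hadd, hadd]
    refine CocycleExtension.ext ?_ (zero_add _).symm
    change (0 : A) + 0 + f k l = f k l - f 0 0 + 0 + f 0 (k + l)
    rw [h0 (k + l)]; abel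
  have h2 := congrArg r h1
  rw [map_add, map_add, show r (i (f k l)) = f k l from DFunLike.congr_fun hr (f k l)] at h2
  rw [h2, add_sub_cancel_right]

instance divisibleByCircle : DivisibleBy (Additive Circle) ℤ :=
  Function.Surjective.divisibleBy Circle.expHom
    (fun z => (Circle.exp_surjective z.toMul))
    (fun a n => map_zsmul Circle.expHom n a)

/-- If every cocycle were symmetric, each would be a coboundary by divisibility of the circle, and
`H²` would vanish. -/
theorem exists_nonsymmetric_cocycle {G : Type*} [Group G] (h : Nontrivial (H2Dual G)) :
    ∃ ω : (G →* Circle) → (G →* Circle) → Circle,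
      (∀ χ₁ χ₂ χ₃, ω (χ₁ * χ₂) χ₃ * ω χ₁ χ₂ = ω χ₂ χ₃ * ω χ₁ (χ₂ * χ₃)) ∧
      ∃ χ ψ, ω χ ψ ≠ ω ψ χ := by
  by_contra! hcon
  obtain ⟨x, hx⟩ := exists_ne (0 : H2Dual G)
  refine hx ?_
  induction x using groupCohomology.H2_induction_on with
  | h f =>
    rw [groupCohomology.H2π_eq_zero_iff]
    have hf := (groupCohomology.mem_cocycles₂_iff (f : _ → _)).1 f.2
    have hf' : ∀ χ₁ χ₂ χ₃ : G →* Circle, (f (χ₁ * χ₂, χ₃)).down + (f (χ₁, χ₂)).down =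
        (f (χ₂, χ₃)).down + (f (χ₁, χ₂ * χ₃)).down := fun χ₁ χ₂ χ₃ =>
      congrArg ULift.down (hf χ₁ χ₂ χ₃)
    have hs := hcon (fun χ ψ => (f (χ, ψ)).down.toMul) fun χ₁ χ₂ χ₃ => hf' χ₁ χ₂ χ₃
    obtain ⟨b, hb⟩ := exists_coboundary (K := Additive (G →* Circle)) (A := Additive Circle)
      (fun χ ψ => (f (χ.toMul, ψ.toMul)).down) (fun χ₁ χ₂ χ₃ => hf' _ _ _) (fun χ ψ => hs _ _)
    refine ⟨fun χ => ULift.up (b (Additive.ofMul χ)), ?_⟩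
    funext p
    refine ULift.down_injective ?_
    refine Eq.trans ?_ (hb (Additive.ofMul p.1) (Additive.ofMul p.2)).symm
    change b _ - b _ + b _ = b _ + b _ - b _
    rw [← ofMul_mul]
    abel

end Cohomology

/-! ### Infinite conjugacy classes. -/

section ConjugacyClasses

variable {G K : Type*} [Group G] [Group K]

theorem setOf_isConj_eq_range (g : G) : {h | IsConj g h} = Set.range fun c => c * g * c⁻¹ := by
  ext h
  exact isConj_iff

theorem infinite_isConj_of_map {φ : G →* K} (hφ : Function.Surjective φ) {g : G}
    (h : {k | IsConj (φ g) k}.Infinite) : {k | IsConj g k}.Infinite := by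
  refine Set.Infinite.of_image φ (h.mono ?_)
  rintro k hk
  obtain ⟨c, rfl⟩ := isConj_iff.1 hk
  obtain ⟨c, rfl⟩ := hφ c
  exact ⟨c * g * c⁻¹, isConj_iff.2 ⟨c, rfl⟩, by simp⟩

/-- A family of objects with finite supports is infinite if the supports cover an infinite set. -/
theorem infinite_range_of_mem_support {α X I : Type*} {F : α → X} {x : α → I} (s : X → Set I)
    (hs : ∀ a, (s (F a)).Finite) (hx : ∀ a, x a ∈ s (F a)) (h : (Set.range x).Infinite) :
    (Set.range F).Infinite := fun hF => by
  refine h ((hF.biUnion (t := s) ?_).subset ?_)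
  · rintro _ ⟨a, rfl⟩
    exact hs a
  · rintro _ ⟨a, rfl⟩
    exact Set.mem_biUnion ⟨a, rfl⟩ (hx a)

theorem IsICC.infinite (h : IsICC G) : Infinite G := by
  have := h.1
  obtain ⟨g, hg⟩ := exists_ne (1 : G)
  exact Set.infinite_univ_iff.1 ((h.2 g hg).mono (Set.subset_univ _))

theorem IsICC.prod (hG : IsICC G) (hK : IsICC K) : IsICC (G × K) := by
  have := hG.1
  refine ⟨inferInstance, fun g hg => ?_⟩
  by_cases h1 : g.1 = 1
  · have h2 : g.2 ≠ 1 := fun h2 => hg (Prod.ext h1 h2)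
    exact infinite_isConj_of_map (φ := MonoidHom.snd G K) Prod.snd_surjective (hK.2 _ h2)
  · exact infinite_isConj_of_map (φ := MonoidHom.fst G K) Prod.fst_surjective (hG.2 _ h1)

end ConjugacyClasses

/-! ### Amenability, finite-index subgroups and the icc property. -/

section Amenable

variable {G : Type*} [Group G]

theorem isAmenableGroup_of_subsingleton [Subsingleton G] : IsAmenableGroup G := by
  classical
  refine ⟨fun S => if (1 : G) ∈ S then 1 else 0, fun S => ?_, if_pos trivial, fun S T h => ?_,
    fun g S => ?_⟩
  · dsimp only
    split_ifs <;> norm_num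
  · by_cases hS : (1 : G) ∈ S
    · have hT : (1 : G) ∉ T := fun hT => Set.disjoint_left.1 h hS hT
      simp [hS, hT]
    · simp [hS]
  · have : (fun x => g * x) '' S = S := by
      have : (fun x => g * x) = id := funext fun x => Subsingleton.elim _ _
      rw [this, Set.image_id]
    rw [this]

/-- A group with an amenable subgroup of finite index is amenable. -/
theorem IsAmenableGroup.of_finite_quotient (H : Subgroup G) [Finite (G ⧸ H)]
    (h : IsAmenableGroup H) : IsAmenableGroup G := by
  have := Fintype.ofFinite (G ⧸ H)
  obtain ⟨m, h0, h1, hadd, hinv⟩ := h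
  -- `T q S` is the part of `S` in the coset `q`, translated back into `H`; the mean on `G` averages
  -- `m` over the cosets.
  set T : G ⧸ H → Set G → Set H := fun q S => {x | q.out * (x : G) ∈ S} with hT
  refine ⟨fun S => (Fintype.card (G ⧸ H) : ℝ)⁻¹ * ∑ q, m (T q S), fun S => ?_, ?_,
    fun S S' hd => ?_, fun g S => ?_⟩
  · exact mul_nonneg (by positivity) (Finset.sum_nonneg fun q _ => h0 _)
  · have : ∀ q, T q Set.univ = Set.univ := fun q => rfl
    simp only [this, h1, Finset.sum_const, Finset.card_univ, nsmul_eq_mul, mul_one]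
    exact inv_mul_cancel₀ (by simp)
  · rw [← mul_add, ← Finset.sum_add_distrib]
    refine congrArg _ (Finset.sum_congr rfl fun q _ => ?_)
    refine hadd _ _ (Set.disjoint_left.2 fun x hx hx' => Set.disjoint_left.1 hd hx hx')
  · dsimp only
    congr 1
    refine Fintype.sum_equiv (MulAction.toPerm g⁻¹) (fun q => m (T q ((fun x => g * x) '' S)))
      (fun q => m (T q S)) fun q => ?_
    -- The chosen representative of `g⁻¹ q` differs from `g⁻¹ * q.out` by some `y` in `H`, which the
    -- invariance of `m` absorbs.
    obtain ⟨y, hy⟩ := QuotientGroup.mk_out_eq_mul H (g⁻¹ * q.out)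
    have hq : MulAction.toPerm g⁻¹ q = ((g⁻¹ * q.out : G) : G ⧸ H) := by
      conv_lhs => rw [← QuotientGroup.out_eq' q]
      rfl
    rw [hq, ← hinv y (T _ S)]
    congr 1
    ext x
    constructor
    · rintro ⟨s, hs, hsx⟩
      refine ⟨y⁻¹ * x, ?_, by simp⟩
      change _ * _ ∈ S
      rw [hy]
      have : s = g⁻¹ * (q.out * x) := by rw [← hsx]; simp
      rw [this] at hs
      simpa [mul_assoc] using hs
    · rintro ⟨z, hz, rfl⟩
      change _ * _ ∈ S at hz
      rw [hy] at hz
      exact ⟨_, hz, by simp [mul_assoc]⟩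

theorem finite_quotient_centralizer {g : G} (h : {k | IsConj g k}.Finite) :
    Finite (G ⧸ Subgroup.centralizer {g}) := by
  have := h.to_subtype
  refine Finite.of_injective
    (fun q => (⟨q.out * g * q.out⁻¹, isConj_iff.2 ⟨_, rfl⟩⟩ : {k | IsConj g k})) ?_
  intro q r hqr
  have h1 : q.out * g * q.out⁻¹ = r.out * g * r.out⁻¹ := congrArg Subtype.val hqr
  rw [← QuotientGroup.out_eq' q, ← QuotientGroup.out_eq' r]
  refine QuotientGroup.eq.2 (Subgroup.mem_centralizer_singleton_iff.2 ?_)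
  have h2 := congrArg (fun z => q.out⁻¹ * z * r.out) h1
  simp only [mul_assoc, inv_mul_cancel_left, inv_mul_cancel, mul_one] at h2
  simp only [mul_assoc]
  first | exact h2 | exact h2.symm

/-- A finite conjugacy class makes the centralizer a subgroup of finite index; if that centralizer
is amenable, so is the whole group. -/
theorem isICC_of_not_isAmenableGroup (h : ¬ IsAmenableGroup G)
    (hc : ∀ g : G, g ≠ 1 → IsAmenableGroup (Subgroup.centralizer {g})) : IsICC G := by
  refine ⟨?_, fun g hg hfin => ?_⟩
  · by_contra hG
    rw [not_nontrivial_iff_subsingleton] at hG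
    exact h isAmenableGroup_of_subsingleton
  · have := finite_quotient_centralizer hfin
    exact h (.of_finite_quotient _ (hc g hg))

end Amenable

/-! ### The icc property for wreath products. -/

section Wreath

variable {I Γ : Type*} [Group Γ]

theorem wreathAction_apply (n : ℕ) (ρ : Γ →* Equiv.Perm I) (γ : Γ)
    (f : Multiplicative (I →₀ ZMod n)) (i : I) :
    (wreathAction n ρ γ f).toAdd (ρ γ i) = f.toAdd i := by
  change f.toAdd ((ρ γ).symm (ρ γ i)) = _
  rw [Equiv.symm_apply_apply]

/-- A generalized wreath product over an icc group with infinite orbits is icc. -/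
theorem isICC_genWreath (n : ℕ) (ρ : Γ →* Equiv.Perm I) (hΓ : IsICC Γ)
    (hρ : ∀ i, (Set.range fun γ => ρ γ i).Infinite) : IsICC (GenWreath n ρ) := by
  have := hΓ.1
  refine ⟨(SemidirectProduct.inr_injective (φ := wreathAction n ρ)).nontrivial, fun w hw => ?_⟩
  by_cases h : w.right = 1
  · obtain ⟨f, γ⟩ := w
    obtain rfl : γ = 1 := h
    have hf : f.toAdd ≠ 0 := fun hf => hw (SemidirectProduct.ext hf rfl)
    obtain ⟨i, hi⟩ := Finsupp.ne_iff.1 hf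
    rw [setOf_isConj_eq_range]
    -- Conjugation by `Γ` drags a point `i` of the finite support of `f` along its infinite orbit.
    have h1 : (Set.range fun γ => wreathAction n ρ γ f).Infinite :=
      infinite_range_of_mem_support (fun f => (f.toAdd.support : Set I))
        (fun _ => Finset.finite_toSet _) (x := fun γ => ρ γ i) (fun γ => by
          rw [Finset.mem_coe, Finsupp.mem_support_iff, wreathAction_apply]
          exact hi) (hρ i)
    refine (h1.image (SemidirectProduct.inl_injective (φ := wreathAction n ρ)).injOn).mono ?_
    rintro _ ⟨_, ⟨γ, rfl⟩, rfl⟩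
    refine ⟨SemidirectProduct.inr γ, ?_⟩
    rw [SemidirectProduct.inl_aut, map_inv]
    rfl
  · exact infinite_isConj_of_map (φ := SemidirectProduct.rightHom)
      SemidirectProduct.rightHom_surjective (hΓ.2 _ h)

theorem isICC_leftRight (n : ℕ) (hΓ : IsICC Γ) : IsICC (GenWreath n (leftRight Γ)) := by
  have := hΓ.infinite
  refine isICC_genWreath n _ (hΓ.prod hΓ) fun k => ?_
  refine Set.infinite_univ.mono fun x _ => ⟨(x * k⁻¹, 1), ?_⟩
  change x * k⁻¹ * k * 1⁻¹ = x
  simp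

end Wreath

section RestrictedWreath

variable {Γ₀ S : Type*} [Group Γ₀] [Group S]

open scoped Classical in
/-- The element of the restricted wreath product supported at one site. -/
def siteElement (c : Γ₀) (y : S) : restrictedWreath Γ₀ S :=
  ⟨⟨Pi.mulSingle y c, 1⟩, (Set.finite_singleton y).subset Pi.mulSupport_mulSingle_subset⟩

/-- The element of the restricted wreath product given by a translation. -/
def shiftElement (t : S) : restrictedWreath Γ₀ S :=
  ⟨RegularWreathProduct.inl t, by
    change (Function.mulSupport (1 : S → Γ₀)).Finite
    simp⟩

/-- An element with trivial `S`-part has its support moved by shifts. If the `S`-part is nontrivial,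
conjugation by `c` at site `y` multiplies the coordinate at `y` by `c`, and the finite set of
altered sites can be made to contain any `y`. -/
theorem isICC_restrictedWreath [Nontrivial Γ₀] [Infinite S] : IsICC (restrictedWreath Γ₀ S) := by
  classical
  have hS : Nontrivial S := inferInstance
  refine ⟨?_, fun w hw => ?_⟩
  · obtain ⟨s, hs⟩ := exists_ne (1 : S)
    exact ⟨shiftElement s, 1, fun h => hs (congrArg (fun w => w.1.right) h)⟩
  rw [setOf_isConj_eq_range]
  by_cases h : w.1.right = 1
  · have hf : w.1.left ≠ 1 := fun hf => hw (Subtype.ext (RegularWreathProduct.ext hf h))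
    obtain ⟨x, hx⟩ := Function.ne_iff.1 hf
    refine Set.Infinite.mono (Set.range_comp_subset_range (shiftElement (Γ₀ := Γ₀) (S := S)) _) ?_
    refine infinite_range_of_mem_support (fun w => Function.mulSupport w.1.left)
      (fun a => (shiftElement a * w * (shiftElement a)⁻¹).2) (x := fun t => t * x) (fun t => ?_)
      (Set.infinite_range_of_injective (mul_left_injective x))
    rw [Function.mem_mulSupport]
    simpa [shiftElement, h] using hx
  · obtain ⟨c, hc⟩ := exists_ne (1 : Γ₀)
    refine Set.Infinite.mono (Set.range_comp_subset_range (siteElement (S := S) c) _) ?_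
    refine infinite_range_of_mem_support
      (fun v => Function.mulSupport fun x => v.1.left x * (w.1.left x)⁻¹)
      (fun a => ((siteElement c a * w * (siteElement c a)⁻¹).2.union w.2).subset ?_)
      (x := id) (fun y => ?_) ?_
    · intro x hx
      by_contra! hx'
      simp only [Set.mem_union, not_or, Function.notMem_mulSupport] at hx'
      refine hx ?_
      change _ * _ = (1 : Γ₀)
      rw [hx'.2, inv_one, mul_one]
      exact hx'.1
    · have h1 : w.1.right⁻¹ * y ≠ y := fun h' => h (by simpa using h')
      rw [Function.mem_mulSupport]
      simpa [siteElement, Pi.mulSingle_eq_of_ne h1] using hc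
    · simpa using Set.infinite_univ

/-- The elements equal to `c` at one site lie in distinct cosets, since elements of the copy of `S`
have trivial coordinates. -/
theorem infinite_quotient_wreathBase [Nontrivial Γ₀] [Infinite S] :
    Infinite (restrictedWreath Γ₀ S ⧸ wreathBase Γ₀ S) := by
  classical
  obtain ⟨c, hc⟩ := exists_ne (1 : Γ₀)
  refine Infinite.of_injective
    (fun y : S => (siteElement c y : restrictedWreath Γ₀ S ⧸ wreathBase Γ₀ S)) fun y z hyz => ?_
  obtain ⟨t, ht⟩ := QuotientGroup.eq.1 hyz
  have h1 := congrFun (congrArg RegularWreathProduct.left ht) y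
  by_contra hne
  refine hc ?_
  simpa [siteElement, Pi.mulSingle_eq_of_ne hne] using h1

theorem isICC_genWreath_quotient (n : ℕ) [Nontrivial Γ₀] [Infinite S] :
    IsICC (GenWreath n (MulAction.toPermHom (restrictedWreath Γ₀ S)
      (restrictedWreath Γ₀ S ⧸ wreathBase Γ₀ S))) := by
  have := infinite_quotient_wreathBase (Γ₀ := Γ₀) (S := S)
  refine isICC_genWreath n _ isICC_restrictedWreath fun k => ?_
  exact Set.infinite_univ.mono fun x _ => MulAction.exists_smul_eq _ k x

end RestrictedWreath

/-! ### A non-symmetric bicharacter on the dual of (ℤ/n)², and the conclusions. -/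

section WreathCocycle

variable (n : ℕ) [NeZero n]

/-- The restriction of a character of `(ℤ/nℤ)²` to the first factor. -/
def charRestrict (χ : Multiplicative (ZMod n × ZMod n) →* Circle) : AddChar (ZMod n) Circle where
  toFun x := χ (Multiplicative.ofAdd (x, 0))
  map_zero_eq_one' := map_one χ
  map_add_eq_mul' x y := by
    rw [← map_mul χ, ← ofAdd_add, Prod.mk_add_mk, add_zero]

/-- The restriction of a character of `(ℤ/nℤ)²` to the first factor, as an element of `ℤ/nℤ`. -/
def charIndex : (Multiplicative (ZMod n × ZMod n) →* Circle) →* Multiplicative (ZMod n) :=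
  MonoidHom.mk' (fun χ => Multiplicative.ofAdd
    (AddChar.zmodAddEquiv.symm (AddChar.circleEquivComplex (charRestrict n χ)))) fun χ ψ => by
      rw [← ofAdd_add, ← map_add, ← map_add]
      rfl

/-- The character of the first factor of `(ℤ/nℤ)²` with index one. -/
def firstChar : Multiplicative (ZMod n × ZMod n) →* Circle :=
  (AddChar.zmod n 1).toMonoidHom.comp
    (AddMonoidHom.toMultiplicative (AddMonoidHom.fst (ZMod n) (ZMod n)))

theorem charIndex_firstChar : charIndex n (firstChar n) = Multiplicative.ofAdd 1 := by
  refine congrArg Multiplicative.ofAdd ?_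
  rw [AddEquiv.symm_apply_eq, AddChar.zmodAddEquiv_apply]
  rfl

theorem firstChar_ofAdd (x : ZMod n) : firstChar n (Multiplicative.ofAdd (0, x)) = 1 :=
  AddChar.map_zero_eq_one (AddChar.zmod n 1)

/-- The bicharacter on the dual of `(ℤ/nℤ)²` pairing the two factors. -/
def pairing (χ ψ : Multiplicative (ZMod n × ZMod n) →* Circle) : Circle :=
  ψ (Multiplicative.ofAdd (0, (charIndex n χ).toAdd))

theorem pairing_mul_left (χ χ' ψ : Multiplicative (ZMod n × ZMod n) →* Circle) :
    pairing n (χ * χ') ψ = pairing n χ ψ * pairing n χ' ψ := by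
  rw [pairing, pairing, pairing, ← map_mul ψ, map_mul (charIndex n), toAdd_mul, ← ofAdd_add,
    Prod.mk_add_mk, add_zero]

theorem pairing_mul_right (χ ψ ψ' : Multiplicative (ZMod n × ZMod n) →* Circle) :
    pairing n χ (ψ * ψ') = pairing n χ ψ * pairing n χ ψ' := rfl

/-- Take `χ` of index one on the first factor and `ψ = θ` on the second with `θ(1) ≠ 1`. One order
gives `θ(1)`; the other gives `1`, because `χ` is trivial on the second factor. -/
theorem exists_pairing_ne (hn : 2 ≤ n) : ∃ χ ψ, pairing n χ ψ ≠ pairing n ψ χ := by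
  have : Fact (1 < n) := ⟨hn⟩
  obtain ⟨θ, hθ⟩ := exists_char_ne_one (Q := Multiplicative (ZMod n))
    (a := Multiplicative.ofAdd 1) (fun h => one_ne_zero (α := ZMod n) h)
  refine ⟨firstChar n, θ.comp (AddMonoidHom.toMultiplicative
    (AddMonoidHom.snd (ZMod n) (ZMod n))), ?_⟩
  rw [pairing, pairing, firstChar_ofAdd, charIndex_firstChar]
  exact hθ

end WreathCocycle

/-- An icc generalized wreath product over a set with at least two elements is not quantum
W*-superrigid. -/
theorem not_superrigid_genWreath {I Γ : Type*} [Group Γ] [Nontrivial I] {n : ℕ} (hn : 2 ≤ n)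
    (ρ : Γ →* Equiv.Perm I) (h : IsICC (GenWreath n ρ)) :
    ¬ IsQuantumWStarSuperrigidGroup (GenWreath n ρ) := by
  have : NeZero n := ⟨by omega⟩
  obtain ⟨i, j, hij⟩ := exists_pair_ne I
  let σ : ZMod n × ZMod n →+ I →₀ ZMod n :=
    (Finsupp.singleAddHom i).coprod (Finsupp.singleAddHom j)
  have hσ : Function.Injective σ := fun x y hxy => by
    have h1 : ∀ x : ZMod n × ZMod n, σ x i = x.1 := fun x => by
      simp [σ, Finsupp.single_eq_of_ne hij]
    have h2 : ∀ x : ZMod n × ZMod n, σ x j = x.2 := fun x => by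
      simp [σ, Finsupp.single_eq_of_ne hij.symm]
    exact Prod.ext (by rw [← h1, hxy, h1]) (by rw [← h2, hxy, h2])
  obtain ⟨χ, ψ, hne⟩ := exists_pairing_ne n hn
  obtain ⟨Δ, hΔ, hΔ', -⟩ := exists_twist h
    ((SemidirectProduct.inl (φ := wreathAction n ρ)).comp (AddMonoidHom.toMultiplicative σ))
    ((SemidirectProduct.inl_injective (φ := wreathAction n ρ)).comp hσ) (pairing n)
    -- Any bicharacter is a 2-cocycle: both sides expand to the same three factors.
    (fun χ₁ χ₂ χ₃ => by
      rw [pairing_mul_left, pairing_mul_right]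
      ac_rfl) hne
  exact not_superrigid_of_twist hΔ hΔ'

theorem exists_kac_twist {G : Type*} [Group G] (hG : IsICC G) (G₀ : Subgroup G)
    (hfin : (G₀ : Set G).Finite) (hcomm : ∀ x ∈ G₀, ∀ y ∈ G₀, x * y = y * x)
    (h : Nontrivial (H2Dual G₀)) :
    ∃ Δ : Elem (groupVN G) →⋆ₐ[ℂ] Elem (vnTensor (groupVN G) (groupVN G)),
      IsKacType Δ ∧ ¬ QGIsomorphic (groupComul G) Δ ∧ ¬ QGIsomorphic Δ (groupComul G) := by
  obtain ⟨ω, hω, χ, ψ, hne⟩ := exists_nonsymmetric_cocycle h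
  let _ : CommGroup G₀ :=
    { (inferInstance : Group G₀) with
      mul_comm := fun x y => Subtype.ext (hcomm x x.2 y y.2) }
  have : Finite G₀ := hfin
  exact exists_twist hG G₀.subtype G₀.subtype_injective ω hω hne

end QGroup

end

theorem mainTheorem3 :
    -- the corollary
    (∀ (G : Type u) [Group G], QGroup.IsICC G →
      ∀ G₀ : Subgroup G, (G₀ : Set G).Finite → (∀ x ∈ G₀, ∀ y ∈ G₀, x * y = y * x) →
        Nontrivial (QGroup.H2Dual G₀) →
        (∃ (K : Type u) (_ : NormedAddCommGroup K) (_ : InnerProductSpace ℂ K)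
            (_ : CompleteSpace K) (B : VonNeumannAlgebra K)
            (Δ : QGroup.Elem B →⋆ₐ[ℂ] QGroup.Elem (QGroup.vnTensor B B)),
            QGroup.IsKacType Δ ∧
            Nonempty (QGroup.Elem B ≃⋆ₐ[ℂ] QGroup.Elem (QGroup.groupVN G)) ∧
            ¬ QGroup.QGIsomorphic Δ (QGroup.groupComul G)) ∧
          ¬ QGroup.IsQuantumWStarSuperrigidGroup G) ∧
    -- generalized wreath products
    (∀ (n : ℕ) (I Γ : Type*) [Group Γ] (ρ : Γ →* Equiv.Perm I), 2 ≤ n → Nontrivial I →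
      QGroup.IsICC (QGroup.GenWreath n ρ) →
        ¬ QGroup.IsQuantumWStarSuperrigidGroup (QGroup.GenWreath n ρ)) ∧
    -- left-right wreath products
    (∀ (n : ℕ) (Γ : Type*) [Group Γ], 2 ≤ n →
      (QGroup.IsICC Γ ∨ (¬ QGroup.IsAmenableGroup Γ ∧
        ∀ g : Γ, g ≠ 1 → QGroup.IsAmenableGroup (Subgroup.centralizer {g}))) →
        ¬ QGroup.IsQuantumWStarSuperrigidGroup (QGroup.GenWreath n (QGroup.leftRight Γ))) ∧
    -- wreath products over the coset action of a wreath product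
    (∀ (n : ℕ) (Γ₀ S : Type*) [Group Γ₀] [Group S], 2 ≤ n → Nontrivial Γ₀ → Infinite S →
        ¬ QGroup.IsQuantumWStarSuperrigidGroup (QGroup.GenWreath n
          (MulAction.toPermHom (QGroup.restrictedWreath Γ₀ S)
            (QGroup.restrictedWreath Γ₀ S ⧸ QGroup.wreathBase Γ₀ S)))) := by
  refine ⟨fun G _ hG G₀ hfin hcomm h => ?_, fun n I Γ _ ρ hn hI h => ?_, fun n Γ _ hn h => ?_,
    fun n Γ₀ S _ _ hn hΓ₀ hS => ?_⟩
  · obtain ⟨Δ, hΔ, h1, h2⟩ := QGroup.exists_kac_twist hG G₀ hfin hcomm h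
    exact ⟨⟨QGroup.ell2 G, _, _, inferInstance, QGroup.groupVN G, Δ, hΔ,
      ⟨StarAlgEquiv.refl ℂ _⟩, h2⟩, QGroup.not_superrigid_of_twist hΔ h1⟩
  · exact QGroup.not_superrigid_genWreath hn ρ h
  · have hΓ : QGroup.IsICC Γ := h.elim id fun h => QGroup.isICC_of_not_isAmenableGroup h.1 h.2
    -- The index set of the left-right action is `Γ` itself, so nontriviality of `Γ` gives two
    -- coordinates.
    have := hΓ.1
    exact QGroup.not_superrigid_genWreath hn _ (QGroup.isICC_leftRight n hΓ)
  · have := QGroup.infinite_quotient_wreathBase (Γ₀ := Γ₀) (S := S)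
    exact QGroup.not_superrigid_genWreath hn _ (QGroup.isICC_genWreath_quotient n)
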